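/- Write $\langle\rho\rangle=(1+\rho^2)^{1/2}$. The $3$-dimensional catenoid $\mathcal C\subset\mathbb R^4$ is the minimal hypersurface parametrized by $(\rho,\omega)\in\mathbb R\times\mathbb S^2\mapsto(\langle\rho\rangle\,\omega,\,Z(\rho))$, where $Z$ is odd and $Z'(\rho)=\langle\rho\rangle^{-1}(\langle\rho\rangle^2+1)^{-1/2}$. Its induced metric is $$g=\frac{\langle\rho\rangle^2}{\langle\rho\rangle^2+1}\,d\rho^2+\langle\rho\rangle^2 g_{\mathbb S^2}.$$ Let $\Delta_{\mathcal C}$ be its Laplace–Beltrami operator, $|\mathrm{II}|^2$ the squared norm of its second fundamental form, $dV=\sqrt{|g|}\,d\rho\,d\omega$ its volume measure, and $H=\Delta_{\mathcal C}+|\mathrm{II}|^2$ its stability operator. For $j\ge 0$ let $A_j=\{2^j\le\langle\rho\rangle<2^{j+1}\}\subset\mathcal C$ and $\|f\|_{\mathcal{LE}}=\sup_{j\ge0}\|\langle\rho\rangle^{-1/2}f\|_{L^2(A_j,dV)}$. Let $\mathcal{LE}^1_\sharp$ be the local energy space, that is, the closure of $C_c^\infty(\mathcal C)$ in the norm $\|\nabla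 u\|_{\mathcal{LE}}+\|\langle\rho\rangle^{-1}u\|_{\mathcal{LE}}$. A threshold resonance of $H$ is a (real-valued, distributional) solution $\varphi$ of $H\varphi=0$ on $\mathcal C$ with $\varphi\in\mathcal{LE}^1_\sharp$ and $\varphi\notin L^2(\mathcal C,dV)$. **Lemma 2.2.** The operator $H$ has no threshold resonance. -/

import Mathlib

noncomputable section

namespace Catenoid

open MeasureTheory Filter Topology
open scoped ContDiff Manifold

/-- Euclidean three-space. -/
abbrev E3 : Type := EuclideanSpace ℝ (Fin 3)

/-- The unit sphere `S²` in `ℝ³`. -/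
abbrev S2 : Type := Metric.sphere (0 : E3) 1

/-- The parameter manifold `ℝ × S²` of the polar coordinates `(ρ, ω)`, which are global on the
catenoid. All objects on the catenoid are written in these coordinates. -/
abbrev Param : Type := ℝ × S2

instance : Fact (Module.finrank ℝ E3 = 2 + 1) := ⟨by simp⟩

/-- The Japanese bracket `⟨ρ⟩ = (1 + ρ²)^(1/2)`. -/
def jap (ρ : ℝ) : ℝ := Real.sqrt (1 + ρ ^ 2)

/-! ### The embedded catenoid in `ℝ⁴` -/

/-- The height `Z(ρ)` on the axis: the odd function with `Z' = 1 / (⟨ρ⟩ (⟨ρ⟩² + 1)^(1/2))`.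
Equivalently `⟨ρ⟩ = 𝔣 (Z ρ)`, where `𝔣` is the profile of the catenoid, that is
`𝔣'' / (1 + 𝔣'²)^(3/2) = 2 / (𝔣 (1 + 𝔣'²)^(1/2))`, `𝔣 0 = 1`, `𝔣' 0 = 0`, with the first integral
`𝔣'² = 𝔣⁴ - 1`. -/
def height (ρ : ℝ) : ℝ := ∫ s in (0 : ℝ)..ρ, 1 / (jap s * Real.sqrt (jap s ^ 2 + 1))

/-- The embedding `(ρ, ω) ↦ (⟨ρ⟩ ω, Z(ρ))` of the catenoid into `ℝ⁴`. -/
def embedding (p : Param) : EuclideanSpace ℝ (Fin 4) :=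
  !₂[jap p.1 * (p.2 : E3) 0, jap p.1 * (p.2 : E3) 1, jap p.1 * (p.2 : E3) 2, height p.1]

/-- The unit normal field `ν = (⟨ρ⟩⁻² ω, - ρ (⟨ρ⟩² + 1)^(1/2) ⟨ρ⟩⁻²)` of the catenoid. -/
def normal (p : Param) : EuclideanSpace ℝ (Fin 4) :=
  !₂[(p.2 : E3) 0 / jap p.1 ^ 2, (p.2 : E3) 1 / jap p.1 ^ 2, (p.2 : E3) 2 / jap p.1 ^ 2,
    -(p.1 * Real.sqrt (jap p.1 ^ 2 + 1)) / jap p.1 ^ 2]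

/-! ### The induced metric, its volume, gradient and Laplacian

The induced metric is `⟨ρ⟩² / (⟨ρ⟩² + 1) dρ² + ⟨ρ⟩² g_{S²}`. -/

/-- The coefficient `g_ρρ = ⟨ρ⟩² / (⟨ρ⟩² + 1)` of the induced metric. -/
def gRho (ρ : ℝ) : ℝ := jap ρ ^ 2 / (jap ρ ^ 2 + 1)

/-! The formulas above agree with the embedding: `gRho` and `⟨ρ⟩²` are the coefficients of the
induced metric, and `normal` is a unit normal field. -/

theorem jap_sq (ρ : ℝ) : jap ρ ^ 2 = 1 + ρ ^ 2 := Real.sq_sqrt (by positivity)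

theorem jap_pos (ρ : ℝ) : 0 < jap ρ := Real.sqrt_pos.2 (by positivity)

theorem sphere_sum (y : S2) : (y : E3) 0 ^ 2 + (y : E3) 1 ^ 2 + (y : E3) 2 ^ 2 = 1 := by
  have h : ‖(y : E3)‖ = 1 := by simp
  have h2 := EuclideanSpace.real_norm_sq_eq (y : E3)
  rw [h, Fin.sum_univ_three] at h2
  linarith

theorem hasDerivAt_jap (ρ : ℝ) : HasDerivAt jap (ρ / jap ρ) ρ := by
  have h : HasDerivAt (fun r : ℝ => 1 + r ^ 2) (2 * ρ) ρ := by
    simpa using (hasDerivAt_pow 2 ρ).const_add 1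
  have := h.sqrt (by positivity)
  have e : 2 * ρ / (2 * Real.sqrt (1 + ρ ^ 2)) = ρ / jap ρ := by
    unfold jap; field_simp
  exact e ▸ this

theorem continuous_jap : Continuous jap := by unfold jap; fun_prop

theorem hasDerivAt_height (ρ : ℝ) :
    HasDerivAt height (1 / (jap ρ * Real.sqrt (jap ρ ^ 2 + 1))) ρ := by
  have hc : Continuous fun s => 1 / (jap s * Real.sqrt (jap s ^ 2 + 1)) := by
    have := continuous_jap
    refine Continuous.div (by fun_prop) (by fun_prop) fun s => ?_
    have := jap_pos s
    positivity
  exact (hc.integral_hasStrictDerivAt 0 ρ).hasDerivAt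

/-- The tangent vector `∂_ρ` of the embedded catenoid. -/
def tangentRho (p : Param) : EuclideanSpace ℝ (Fin 4) :=
  !₂[p.1 / jap p.1 * (p.2 : E3) 0, p.1 / jap p.1 * (p.2 : E3) 1, p.1 / jap p.1 * (p.2 : E3) 2,
    1 / (jap p.1 * Real.sqrt (jap p.1 ^ 2 + 1))]

theorem hasDerivAt_embedding (p : Param) :
    HasDerivAt (fun r => embedding (r, p.2)) (tangentRho p) p.1 := by
  suffices h : HasDerivAt (fun r i => embedding (r, p.2) i) (fun i => tangentRho p i) p.1 by
    have key := ((PiLp.continuousLinearEquiv 2 ℝ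
      (fun _ : Fin 4 => ℝ)).symm.toContinuousLinearMap.hasFDerivAt
      (x := fun i => embedding (p.1, p.2) i)).comp_hasDerivAt p.1 h
    exact key
  rw [hasDerivAt_pi]
  have hj := hasDerivAt_jap p.1
  have hz := hasDerivAt_height p.1
  intro i
  fin_cases i
  · simpa [embedding, tangentRho] using hj.mul_const ((p.2 : E3) 0)
  · simpa [embedding, tangentRho] using hj.mul_const ((p.2 : E3) 1)
  · simpa [embedding, tangentRho] using hj.mul_const ((p.2 : E3) 2)
  · simpa [embedding, tangentRho] using hz

theorem norm_tangentRho_sq (p : Param) : ‖tangentRho p‖ ^ 2 = gRho p.1 := by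
  have h := sphere_sum p.2
  have hj := jap_sq p.1
  have hp := jap_pos p.1
  have hs : Real.sqrt (jap p.1 ^ 2 + 1) ^ 2 = jap p.1 ^ 2 + 1 := Real.sq_sqrt (by positivity)
  have e : ‖tangentRho p‖ ^ 2 = (p.1 / jap p.1) ^ 2 *
      ((p.2 : E3) 0 ^ 2 + (p.2 : E3) 1 ^ 2 + (p.2 : E3) 2 ^ 2)
      + (1 / (jap p.1 * Real.sqrt (jap p.1 ^ 2 + 1))) ^ 2 := by
    rw [EuclideanSpace.real_norm_sq_eq, Fin.sum_univ_four]
    simp [tangentRho]; ring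
  rw [e, h, gRho, div_pow, div_pow, mul_pow, hs]
  have h1 : p.1 ^ 2 = jap p.1 ^ 2 - 1 := by linarith
  rw [h1]
  field_simp
  ring

/-- The slice `ρ = const` is a round sphere of radius `⟨ρ⟩`. -/
theorem norm_embedding_sub_sq (ρ : ℝ) (y y' : S2) :
    ‖embedding (ρ, y) - embedding (ρ, y')‖ ^ 2 = jap ρ ^ 2 * ‖(y : E3) - (y' : E3)‖ ^ 2 := by
  rw [EuclideanSpace.real_norm_sq_eq, EuclideanSpace.real_norm_sq_eq, Fin.sum_univ_four,
    Fin.sum_univ_three]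
  simp [embedding]; ring

theorem norm_normal_sq (p : Param) : ‖normal p‖ ^ 2 = 1 := by
  have h := sphere_sum p.2
  have hj := jap_sq p.1
  have hp := jap_pos p.1
  have hs : Real.sqrt (jap p.1 ^ 2 + 1) ^ 2 = jap p.1 ^ 2 + 1 := Real.sq_sqrt (by positivity)
  have e : ‖normal p‖ ^ 2 =
      ((p.2 : E3) 0 ^ 2 + (p.2 : E3) 1 ^ 2 + (p.2 : E3) 2 ^ 2) / (jap p.1 ^ 2) ^ 2
      + p.1 ^ 2 * Real.sqrt (jap p.1 ^ 2 + 1) ^ 2 / (jap p.1 ^ 2) ^ 2 := by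
    rw [EuclideanSpace.real_norm_sq_eq, Fin.sum_univ_four]
    simp [normal]; ring
  have h1 : p.1 ^ 2 = jap p.1 ^ 2 - 1 := by linarith
  rw [e, h, hs, h1]
  field_simp
  ring

theorem inner_normal_tangentRho (p : Param) : inner ℝ (normal p) (tangentRho p) = 0 := by
  have h := sphere_sum p.2
  have hp := jap_pos p.1
  have hs : 0 < Real.sqrt (jap p.1 ^ 2 + 1) := Real.sqrt_pos.2 (by positivity)
  have e : inner ℝ (normal p) (tangentRho p) = p.1 / jap p.1 ^ 3 *
      ((p.2 : E3) 0 ^ 2 + (p.2 : E3) 1 ^ 2 + (p.2 : E3) 2 ^ 2) - p.1 / jap p.1 ^ 3 := by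
    simp [PiLp.inner_apply, Fin.sum_univ_four, normal, tangentRho]
    field_simp
    ring
  rw [e, h]; ring

theorem inner_normal_tangentSphere (p : Param) (v : E3) (hv : inner ℝ (p.2 : E3) v = 0) :
    inner ℝ (normal p) (!₂[jap p.1 * v 0, jap p.1 * v 1, jap p.1 * v 2, 0] :
      EuclideanSpace ℝ (Fin 4)) = 0 := by
  have hp := jap_pos p.1
  simp only [PiLp.inner_apply, Fin.sum_univ_three, RCLike.inner_apply, conj_trivial] at hv
  simp [PiLp.inner_apply, Fin.sum_univ_four, normal]
  field_simp
  linarith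

/-- The volume density `|g|^(1/2) = (g_ρρ)^(1/2) ⟨ρ⟩²` with respect to `dρ dω`. -/
def density (ρ : ℝ) : ℝ := Real.sqrt (gRho ρ) * jap ρ ^ 2

/-- The Riemannian volume measure `|g|^(1/2) dρ dω`, where `dω` is the surface measure of `S²`. -/
def vol : Measure Param :=
  ((volume : Measure ℝ).prod (volume : Measure E3).toSphere).withDensity
    fun p => ENNReal.ofReal (density p.1)

/-- The extension of a function on `S²` to `ℝ³ ∖ {0}` that is homogeneous of degree zero. -/
def homExt (f : S2 → ℝ) (x : E3) : ℝ :=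
  if hx : x ≠ 0 then f ⟨‖x‖⁻¹ • x, by simp [norm_smul, hx]⟩ else 0

/-- The gradient of a function on the round unit sphere: the Euclidean gradient, at `y`, of its
extension of degree zero. It is tangent to the sphere. -/
def sphereGrad (f : S2 → ℝ) (y : S2) : E3 := gradient (homExt f) (y : E3)

/-- The Laplacian of a function on the round unit sphere: the Euclidean Laplacian, at `y`, of its
extension of degree zero. -/
def sphereLaplacian (f : S2 → ℝ) (y : S2) : ℝ := Laplacian.laplacian (homExt f) (y : E3)

/-- The derivative `∂_ρ u`. -/
def dRho (u : Param → ℝ) (p : Param) : ℝ := deriv (fun r => u (r, p.2)) p.1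

/-- The squared length `|∇u|²` of the gradient in the induced metric. -/
def gradSq (u : Param → ℝ) (p : Param) : ℝ :=
  (gRho p.1)⁻¹ * dRho u p ^ 2 + (jap p.1 ^ 2)⁻¹ * ‖sphereGrad (fun y => u (p.1, y)) p.2‖ ^ 2

/-- The Laplace–Beltrami operator of the induced metric,
`Δ u = |g|^(-1/2) ∂_ρ (|g|^(1/2) g^ρρ ∂_ρ u) + ⟨ρ⟩⁻² Δ_{S²} u`. -/
def laplaceBeltrami (u : Param → ℝ) (p : Param) : ℝ :=
  (density p.1)⁻¹ * dRho (fun q => density q.1 * (gRho q.1)⁻¹ * dRho u q) p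
    + (jap p.1 ^ 2)⁻¹ * sphereLaplacian (fun y => u (p.1, y)) p.2

/-- The squared norm `|II|²` of the second fundamental form. The second fundamental form is given
by the differential `dν` of the unit normal, and `|dν|² = ∑ₐ |∇νₐ|²` over the four components
of `ν` in `ℝ⁴`. -/
def secondFundSq (p : Param) : ℝ := ∑ a : Fin 4, gradSq (fun q => normal q a) p

/-- The stability operator `H = Δ + |II|²` of the catenoid. -/
def stabilityOp (u : Param → ℝ) (p : Param) : ℝ := laplaceBeltrami u p + secondFundSq p * u p

/-! ### Solutions, the local energy space and threshold resonances -/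

/-- Test functions: smooth functions with compact support on the catenoid. -/
def IsTest (η : Param → ℝ) : Prop :=
  ContMDiff (𝓘(ℝ, ℝ).prod (𝓡 2)) 𝓘(ℝ, ℝ) ∞ η ∧ HasCompactSupport η

/-- Solutions of `H φ = 0` in the sense of distributions. -/
def IsZeroSolution (φ : Param → ℝ) : Prop :=
  LocallyIntegrable φ vol ∧ ∀ η : Param → ℝ, IsTest η → ∫ p, φ p * stabilityOp η p ∂vol = 0

/-- The dyadic region `2^j ≤ ⟨ρ⟩ < 2^(j+1)`; it meets both ends of the catenoid. -/
def annulus (j : ℕ) : Set Param := {p | 2 ^ j ≤ jap p.1 ∧ jap p.1 < 2 ^ (j + 1)}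

/-- The stationary local energy norm `sup_j ‖⟨ρ⟩^(-1/2) f‖_{L²(A_j)}` over the dyadic regions. -/
def leNorm (f : Param → ℝ) : ENNReal :=
  ⨆ j : ℕ, eLpNorm (fun p => (jap p.1) ^ (-(1 / 2) : ℝ) * f p) 2 (vol.restrict (annulus j))

/-- The local energy space: the closure of the smooth compactly supported functions in the norm
`‖u‖ = ‖∇u‖_LE + ‖⟨ρ⟩⁻¹ u‖_LE`. Concretely, `φ` is a limit, with respect to the zeroth order part
of the norm, of test functions whose gradients form a Cauchy sequence. -/
def LocalEnergySpace (φ : Param → ℝ) : Prop :=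
  AEStronglyMeasurable φ vol ∧ ∃ u : ℕ → Param → ℝ, (∀ n, IsTest (u n)) ∧
    Tendsto (fun n => leNorm fun p => (jap p.1)⁻¹ * (u n p - φ p)) atTop (𝓝 0) ∧
    Tendsto (fun nm : ℕ × ℕ => leNorm fun p =>
      Real.sqrt (gradSq (fun q => u nm.1 q - u nm.2 q) p)) atTop (𝓝 0)

/-- A threshold resonance of `H`: a solution of `H φ = 0` which belongs to the local energy space
but not to `L²`. -/
def IsThresholdResonance (φ : Param → ℝ) : Prop :=
  IsZeroSolution φ ∧ LocalEnergySpace φ ∧ ¬ MemLp φ 2 vol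

end Catenoid

end

/-!
A solution `φ` of `H φ = 0` in the local energy space is shown to be square integrable, so that it
is not a resonance. The argument treats the spherical means of `φ` and the remaining modes
separately.

**Spherical means.** Tested against radial functions, the equation says that the spherical mean of
`φ` is a distributional solution of a Sturm–Liouville equation on `ℝ`. Two solutions of it are
explicit: the Jacobi fields of the vertical translations (odd in `ρ`, tending to `±1`) and of the
dilations (even in `ρ`, tending to a negative constant). Variation of constants inverts the radial
operator on test functions orthogonal to both fields (`exists_radialOp_eq`), hence the mean is a
combination of the two (`Approximates.mean_eq`). A nonzero combination stays away from zero at one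
of the two ends, and a function of that kind has a positive distance from every test function in
the local energy norm, as a dyadic region beyond the support of the test function shows
(`le_leNorm_of_mean`). Thus the spherical mean vanishes (`Approximates.mean_eq_zero`). It is here
that the weight of the local energy norm matters: with a weight that damps the far regions, the
test functions would approximate constants.

**Other modes.** In the remaining modes the angular derivative is at least as strong as
`4 / 5 · ⟨ρ⟩⁻² φ²`. With the weight `w ≈ ⟨ρ⟩`, regularized to `w = ⟨ρ⟩ / (1 + ε ⟨ρ⟩²)`, the
quadratic form of `-H` tested with `w² φ` is coercive up to a lower order term: Hardy's inequality
contributes `1 / 4`, the derivative of the weight costs at most `1`, the sphere contributes `4 / 5`,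
and `|II|² = 6 ⟨ρ⟩⁻⁶` is negligible near infinity (`coercivity`). Since the form is at most zero on
a solution (`Approximates.eventually_form_le`), the integral of `w² φ²` over `dρ dω` is bounded
uniformly in `ε`, and letting `ε → 0` gives `φ ∈ L²` (`Approximates.memLp_two`).

The first nonzero eigenvalue of the sphere is `2`, but any constant above `3 / 4` is enough. The
bound `8 / π² ≥ 4 / 5` (`poincare_sphere`) comes from Gaussian rotations: `f` is extended to `ℝ³` as
a function homogeneous of degree zero, and the increment between independent Gaussian vectors `x`
and `y` is integrated along `cos θ x + sin θ y`.
-/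

noncomputable section

namespace Catenoid

open MeasureTheory Filter Topology
open scoped ContDiff Manifold

/-! ### Homogeneous extensions and test functions -/

/-- The extension of a function on `ℝ × S²` to `ℝ × (ℝ³ ∖ {0})` that is homogeneous of degree zero
in the second variable. -/
def ext (u : Param → ℝ) (q : ℝ × E3) : ℝ := homExt (fun y => u (q.1, y)) q.2

/-- The domain `ℝ × (ℝ³ ∖ {0})` of the extensions. -/
def extDomain : Set (ℝ × E3) := {q | q.2 ≠ 0}

theorem isOpen_extDomain : IsOpen extDomain :=
  isOpen_ne.preimage continuous_snd

/-- Radial projection `x ↦ x / |x|` onto the sphere, off the origin. -/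
def proj (x : E3) (hx : x ≠ 0) : S2 := ⟨‖x‖⁻¹ • x, by simp [norm_smul, hx]⟩

theorem homExt_of_ne (f : S2 → ℝ) {x : E3} (hx : x ≠ 0) : homExt f x = f (proj x hx) := by
  simp [homExt, hx, proj]

theorem sphere_ne_zero (y : S2) : (y : E3) ≠ 0 := ne_zero_of_mem_unit_sphere y

theorem proj_coe (y : S2) : proj (y : E3) (sphere_ne_zero y) = y := by
  ext1; simp [proj]

theorem homExt_coe (f : S2 → ℝ) (y : S2) : homExt f (y : E3) = f y := by
  rw [homExt_of_ne f (sphere_ne_zero y), proj_coe]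

theorem ext_coe (u : Param → ℝ) (ρ : ℝ) (y : S2) : ext u (ρ, (y : E3)) = u (ρ, y) :=
  homExt_coe _ y

/-- The passage from smoothness on the manifold `ℝ × S²` to smoothness in `ℝ × ℝ³`. -/
theorem contDiffOn_ext {u : Param → ℝ}
    (hu : ContMDiff (𝓘(ℝ, ℝ).prod (𝓡 2)) 𝓘(ℝ, ℝ) ∞ u) : ContDiffOn ℝ ∞ (ext u) extDomain := by
  let U : TopologicalSpace.Opens (ℝ × E3) := ⟨extDomain, isOpen_extDomain⟩
  have h1 : ContMDiff 𝓘(ℝ, ℝ × E3) 𝓘(ℝ, E3) ∞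
      (fun q : U => ‖(q : ℝ × E3).2‖⁻¹ • (q : ℝ × E3).2) := by
    intro q
    rw [contMDiffAt_subtype_iff (f := fun q : ℝ × E3 => ‖q.2‖⁻¹ • q.2)]
    have hq : (q : ℝ × E3).2 ≠ 0 := q.2
    refine ContDiffAt.contMDiffAt ?_
    exact ((contDiffAt_snd.norm ℝ hq).inv (norm_ne_zero_iff.2 hq)).smul contDiffAt_snd
  have h2 := h1.codRestrict_sphere (n := 2) (fun q => by
    have hq : (q : ℝ × E3).2 ≠ 0 := q.2
    simp [norm_smul, hq])
  have h3 : ContMDiff 𝓘(ℝ, ℝ × E3) 𝓘(ℝ, ℝ) ∞ (fun q : U => (q : ℝ × E3).1) := by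
    intro q
    rw [contMDiffAt_subtype_iff (f := fun q : ℝ × E3 => q.1)]
    exact contDiffAt_fst.contMDiffAt
  have h4 := hu.comp (h3.prodMk h2)
  intro q hq
  refine ContDiffAt.contDiffWithinAt ?_
  have h5 := h4 ⟨q, hq⟩
  have h6 : ContMDiffAt 𝓘(ℝ, ℝ × E3) 𝓘(ℝ, ℝ) ∞ (ext u) q := by
    rw [← contMDiffAt_subtype_iff (U := U) (x := ⟨q, hq⟩)]
    convert! h5 using 1
    ext1 r
    have hr : (r : ℝ × E3).2 ≠ 0 := r.2
    simp only [ext, homExt_of_ne _ hr]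
    rfl
  exact h6.contDiffAt

/-- Functions on `ℝ × S²` whose homogeneous extension is smooth and which vanish for large `|ρ|`.
Test functions have this property, and it is inherited by their derivatives in `ρ`. -/
structure SmoothSupp (u : Param → ℝ) : Prop where
  smooth : ContDiffOn ℝ ∞ (ext u) extDomain
  supp : ∃ R : ℝ, ∀ ρ y, R < |ρ| → u (ρ, y) = 0

theorem IsTest.smoothSupp {u : Param → ℝ} (hu : IsTest u) : SmoothSupp u := by
  refine ⟨contDiffOn_ext hu.1, ?_⟩
  have hK : IsCompact (Prod.fst '' tsupport u) := hu.2.isCompact.image continuous_fst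
  obtain ⟨R, hR⟩ := hK.isBounded.exists_norm_le
  refine ⟨R, fun ρ y h => ?_⟩
  by_contra hne
  have := hR ρ ⟨(ρ, y), subset_tsupport _ hne, rfl⟩
  rw [Real.norm_eq_abs] at this
  linarith

theorem hasCompactSupport_of_vanish {E : Type*} [Zero E] {u : Param → E}
    (h : ∃ R : ℝ, ∀ ρ y, R < |ρ| → u (ρ, y) = 0) : HasCompactSupport u := by
  obtain ⟨R, hR⟩ := h
  refine HasCompactSupport.intro (K := Set.Icc (-R) R ×ˢ Set.univ)
    (isCompact_Icc.prod isCompact_univ) ?_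
  rintro ⟨ρ, y⟩ hp
  refine hR ρ y ?_
  by_contra hc
  exact hp ⟨abs_le.1 (not_lt.1 hc), trivial⟩

theorem contMDiff_radial_mul {W : ℝ → ℝ} (hW : ContDiff ℝ ∞ W) :
    ContMDiff (𝓘(ℝ, ℝ).prod (𝓡 2)) 𝓘(ℝ, ℝ) ∞ (fun p : Param => W p.1) :=
  hW.contMDiff.comp contMDiff_fst

theorem IsTest.radial_mul {W : ℝ → ℝ} (hW : ContDiff ℝ ∞ W) {u : Param → ℝ} (hu : IsTest u) :
    IsTest (fun p => W p.1 * u p) :=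
  ⟨(contMDiff_radial_mul hW).mul hu.1, hu.2.mul_left⟩

theorem isTest_radial {h : ℝ → ℝ} (hh : ContDiff ℝ ∞ h) (hc : HasCompactSupport h) :
    IsTest (fun p => h p.1) := by
  refine ⟨contMDiff_radial_mul hh, hasCompactSupport_of_vanish ?_⟩
  obtain ⟨R, hR⟩ := hc.isCompact.isBounded.exists_norm_le
  refine ⟨R, fun ρ y h' => ?_⟩
  by_contra hne
  have := hR ρ (subset_tsupport _ hne)
  rw [Real.norm_eq_abs] at this
  linarith

theorem IsTest.sub {u v : Param → ℝ} (hu : IsTest u) (hv : IsTest v) :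
    IsTest (fun p => u p - v p) :=
  ⟨hu.1.sub hv.1, hu.2.sub hv.2⟩

/-! ### Derivatives of homogeneous extensions -/

/-- The standard basis vectors of `ℝ³`. -/
def stdB (i : Fin 3) : E3 := EuclideanSpace.single i 1

theorem homExt_smul (f : S2 → ℝ) {t : ℝ} (ht : 0 < t) (x : E3) :
    homExt f (t • x) = homExt f x := by
  by_cases hx : x = 0
  · simp [hx]
  · rw [homExt_of_ne f hx, homExt_of_ne f (smul_ne_zero ht.ne' hx)]
    congr 1
    ext1
    simp only [proj, norm_smul, Real.norm_eq_abs, abs_of_pos ht, smul_smul]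
    congr 1
    field_simp

/-- Functions on the sphere whose homogeneous extension of degree zero is smooth. -/
def SmoothSphere (f : S2 → ℝ) : Prop := ContDiffOn ℝ ∞ (homExt f) {x | x ≠ 0}

theorem SmoothSphere.contDiffAt {f : S2 → ℝ} (hf : SmoothSphere f) {x : E3} (hx : x ≠ 0) :
    ContDiffAt ℝ ∞ (homExt f) x :=
  ContDiffOn.contDiffAt hf (isOpen_ne.mem_nhds hx)

theorem SmoothSphere.differentiableAt {f : S2 → ℝ} (hf : SmoothSphere f) {x : E3} (hx : x ≠ 0) :
    DifferentiableAt ℝ (homExt f) x :=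
  (hf.contDiffAt hx).differentiableAt (by simp)

/-- The homogeneous extension is constant along rays, so its gradient is tangential. -/
theorem fderiv_homExt_radial {f : S2 → ℝ} (hf : SmoothSphere f) {x : E3} (hx : x ≠ 0) :
    fderiv ℝ (homExt f) x x = 0 := by
  have h1 : HasDerivAt (fun t : ℝ => homExt f (t • x)) (fderiv ℝ (homExt f) x x) 1 := by
    have hd : HasFDerivAt (homExt f) (fderiv ℝ (homExt f) x) ((1 : ℝ) • x) := by
      rw [one_smul]; exact (hf.differentiableAt hx).hasFDerivAt
    have := hd.comp_hasDerivAt (1 : ℝ) ((hasDerivAt_id (1 : ℝ)).smul_const x)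
    simpa [Function.comp_def] using this
  have h2 : (fun t : ℝ => homExt f (t • x)) =ᶠ[𝓝 1] fun _ => homExt f x := by
    filter_upwards [lt_mem_nhds (zero_lt_one' ℝ)] with t ht
    rw [homExt_smul f ht]
  exact h1.unique ((hasDerivAt_const (1 : ℝ) (homExt f x)).congr_of_eventuallyEq h2)

theorem inner_gradient {F : E3 → ℝ} {x : E3} (v : E3) :
    inner ℝ (gradient F x) v = fderiv ℝ F x v := by
  simp [gradient]

theorem inner_sphereGrad (f : S2 → ℝ) (y : S2) (v : E3) :
    inner ℝ (sphereGrad f y) v = fderiv ℝ (homExt f) y v := inner_gradient v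

theorem sphereGrad_apply (f : S2 → ℝ) (y : S2) (i : Fin 3) :
    sphereGrad f y i = fderiv ℝ (homExt f) y (stdB i) := by
  rw [← inner_sphereGrad, stdB, EuclideanSpace.inner_single_right]; simp

theorem SmoothSphere.contDiffOn_partial {f : S2 → ℝ} (hf : SmoothSphere f) (v : E3) :
    ContDiffOn ℝ ∞ (fun x => fderiv ℝ (homExt f) x v) {x | x ≠ 0} :=
  (hf.fderiv_of_isOpen isOpen_ne (by simp)).clm_apply contDiffOn_const

theorem SmoothSphere.laplacian_eq {f : S2 → ℝ} (hf : SmoothSphere f) {x : E3} (hx : x ≠ 0) :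
    Laplacian.laplacian (homExt f) x =
      ∑ i, fderiv ℝ (fun z => fderiv ℝ (homExt f) z (stdB i)) x (stdB i) := by
  rw [InnerProductSpace.laplacian_eq_iteratedFDeriv_orthonormalBasis _
    (EuclideanSpace.basisFun (Fin 3) ℝ)]
  refine Finset.sum_congr rfl fun i _ => ?_
  rw [iteratedFDeriv_two_apply]
  have hd : DifferentiableAt ℝ (fderiv ℝ (homExt f)) x :=
    ((hf.fderiv_of_isOpen (m := ∞) isOpen_ne (by simp)).contDiffAt
      (isOpen_ne.mem_nhds hx)).differentiableAt (by simp)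
  rw [fderiv_clm_apply hd (differentiableAt_const _)]
  simp [stdB]

theorem SmoothSupp.contDiffAt {u : Param → ℝ} (hu : SmoothSupp u) {q : ℝ × E3} (hq : q.2 ≠ 0) :
    ContDiffAt ℝ ∞ (ext u) q :=
  hu.smooth.contDiffAt (isOpen_extDomain.mem_nhds hq)

theorem SmoothSupp.hasFDerivAt {u : Param → ℝ} (hu : SmoothSupp u) {q : ℝ × E3} (hq : q.2 ≠ 0) :
    HasFDerivAt (ext u) (fderiv ℝ (ext u) q) q :=
  ((hu.contDiffAt hq).differentiableAt (by simp)).hasFDerivAt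

theorem continuous_coe_param : Continuous fun p : Param => ((p.1, (p.2 : E3)) : ℝ × E3) := by
  fun_prop

theorem continuous_of_extDomain {E : Type*} [TopologicalSpace E] {U : ℝ × E3 → E}
    (hU : ContinuousOn U extDomain) : Continuous fun p : Param => U (p.1, (p.2 : E3)) :=
  hU.comp_continuous continuous_coe_param fun p => sphere_ne_zero p.2

theorem SmoothSupp.continuous {u : Param → ℝ} (hu : SmoothSupp u) : Continuous u := by
  have := continuous_of_extDomain hu.smooth.continuousOn
  simpa only [ext_coe] using this

theorem SmoothSupp.contDiff_rho {u : Param → ℝ} (hu : SmoothSupp u) (y : S2) :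
    ContDiff ℝ ∞ fun r => u (r, y) := by
  rw [contDiff_iff_contDiffAt]
  intro r
  have h1 : ContDiffAt ℝ ∞ (fun r : ℝ => ((r, (y : E3)) : ℝ × E3)) r := by fun_prop
  have := (hu.contDiffAt (q := (r, (y : E3))) (sphere_ne_zero y)).comp r h1
  simpa only [Function.comp_def, ext_coe] using this

theorem SmoothSupp.hasDerivAt_rho {u : Param → ℝ} (hu : SmoothSupp u) (ρ : ℝ) (y : S2) :
    HasDerivAt (fun r => u (r, y)) (dRho u (ρ, y)) ρ :=
  ((hu.contDiff_rho y).differentiable (by simp) ρ).hasDerivAt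

theorem SmoothSupp.fderiv_ext_rho {u : Param → ℝ} (hu : SmoothSupp u) {q : ℝ × E3} (hq : q.2 ≠ 0) :
    ext (dRho u) q = fderiv ℝ (ext u) q (1, 0) := by
  have h1 : HasDerivAt (fun r : ℝ => ((r, q.2) : ℝ × E3)) (1, 0) q.1 :=
    (hasDerivAt_id q.1).prodMk (hasDerivAt_const q.1 q.2)
  have h2 := (hu.hasFDerivAt hq).comp_hasDerivAt q.1 h1
  have h3 : (ext u ∘ fun r : ℝ => ((r, q.2) : ℝ × E3)) = fun r => u (r, proj q.2 hq) := by
    funext r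
    exact homExt_of_ne (fun y => u (r, y)) hq
  rw [h3] at h2
  rw [ext, homExt_of_ne _ hq]
  exact h2.deriv

theorem SmoothSupp.dRho_vanish {u : Param → ℝ} {R : ℝ} (hR : ∀ ρ y, R < |ρ| → u (ρ, y) = 0) (ρ : ℝ)
    (y : S2) (h : R < |ρ|) : dRho u (ρ, y) = 0 := by
  have : (fun r => u (r, y)) =ᶠ[𝓝 ρ] fun _ => 0 := by
    filter_upwards [continuous_abs.continuousAt.eventually (lt_mem_nhds h)] with r hr
    exact hR r y hr
  rw [dRho, this.deriv_eq, deriv_const]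

theorem SmoothSupp.dRho {u : Param → ℝ} (hu : SmoothSupp u) : SmoothSupp (dRho u) := by
  refine ⟨?_, ?_⟩
  · have h1 := (hu.smooth.fderiv_of_isOpen (m := ∞) isOpen_extDomain (by simp)).clm_apply
      (contDiffOn_const (c := ((1, 0) : ℝ × E3)))
    exact h1.congr fun q hq => hu.fderiv_ext_rho hq
  · obtain ⟨R, hR⟩ := hu.supp
    exact ⟨R, SmoothSupp.dRho_vanish hR⟩

theorem SmoothSupp.smoothSphere {u : Param → ℝ} (hu : SmoothSupp u) (ρ : ℝ) :
    SmoothSphere fun y => u (ρ, y) :=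
  hu.smooth.comp (g := ext u) (f := fun x : E3 => ((ρ, x) : ℝ × E3)) (by fun_prop) fun x hx => hx

theorem SmoothSupp.fderiv_slice {u : Param → ℝ} (hu : SmoothSupp u) (ρ : ℝ) {x : E3} (hx : x ≠ 0)
    (v : E3) :
    fderiv ℝ (homExt fun y => u (ρ, y)) x v = fderiv ℝ (ext u) (ρ, x) (0, v) := by
  have h1 : HasFDerivAt (fun z : E3 => ((ρ, z) : ℝ × E3)) (ContinuousLinearMap.inr ℝ ℝ E3) x :=
    (hasFDerivAt_const ρ x).prodMk (hasFDerivAt_id x)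
  have h2 := (hu.hasFDerivAt (q := (ρ, x)) hx).comp x h1
  have h3 : (ext u ∘ fun z : E3 => ((ρ, z) : ℝ × E3)) = homExt fun y => u (ρ, y) := rfl
  rw [h3] at h2
  rw [h2.fderiv]
  simp

theorem SmoothSupp.continuous_sphereGrad {u : Param → ℝ} (hu : SmoothSupp u) :
    Continuous fun p : Param => sphereGrad (fun y => u (p.1, y)) p.2 := by
  rw [← (PiLp.homeomorph 2 (fun _ : Fin 3 => ℝ)).comp_continuous_iff]
  refine continuous_pi fun i => ?_
  have h1 := (hu.smooth.fderiv_of_isOpen (m := ∞) isOpen_extDomain (by simp)).clm_apply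
      (contDiffOn_const (c := ((0, stdB i) : ℝ × E3)))
  refine (continuous_of_extDomain h1.continuousOn).congr fun p => ?_
  rw [← hu.fderiv_slice p.1 (sphere_ne_zero p.2)]
  exact (sphereGrad_apply _ _ i).symm

theorem SmoothSupp.continuous_sphereLaplacian {u : Param → ℝ} (hu : SmoothSupp u) :
    Continuous fun p : Param => sphereLaplacian (fun y => u (p.1, y)) p.2 := by
  have h1 (i : Fin 3) : ContDiffOn ℝ ∞ (fun q => fderiv ℝ (ext u) q (0, stdB i)) extDomain :=
    (hu.smooth.fderiv_of_isOpen (m := ∞) isOpen_extDomain (by simp)).clm_apply contDiffOn_const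
  have h2 (i : Fin 3) : ContDiffOn ℝ ∞
      (fun q => fderiv ℝ (fun q => fderiv ℝ (ext u) q (0, stdB i)) q (0, stdB i)) extDomain :=
    ((h1 i).fderiv_of_isOpen (m := ∞) isOpen_extDomain (by simp)).clm_apply contDiffOn_const
  have h3 := continuous_finsetSum Finset.univ fun i _ =>
    continuous_of_extDomain (h2 i).continuousOn
  refine h3.congr fun p => ?_
  rw [sphereLaplacian, (hu.smoothSphere p.1).laplacian_eq (sphere_ne_zero p.2)]
  refine Finset.sum_congr rfl fun i _ => ?_
  have hd : HasFDerivAt (fun q => fderiv ℝ (ext u) q (0, stdB i)) _ (p.1, (p.2 : E3)) :=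
    (((h1 i).contDiffAt (isOpen_extDomain.mem_nhds (sphere_ne_zero p.2))).differentiableAt
      (by simp)).hasFDerivAt
  have h4 : HasFDerivAt (fun z : E3 => ((p.1, z) : ℝ × E3)) (ContinuousLinearMap.inr ℝ ℝ E3)
      (p.2 : E3) := (hasFDerivAt_const p.1 _).prodMk (hasFDerivAt_id _)
  have h5 := hd.comp (p.2 : E3) h4
  have h6 : (fun z => fderiv ℝ (homExt fun y => u (p.1, y)) z (stdB i)) =ᶠ[𝓝 (p.2 : E3)]
      ((fun q => fderiv ℝ (ext u) q (0, stdB i)) ∘ fun z : E3 => ((p.1, z) : ℝ × E3)) := by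
    filter_upwards [isOpen_ne.mem_nhds (sphere_ne_zero p.2)] with z hz
    exact hu.fderiv_slice p.1 hz _
  rw [h6.fderiv_eq, h5.fderiv]
  simp

theorem homExt_zero_fun : homExt (fun _ => 0) = fun _ => 0 := by
  funext x; simp [homExt]

theorem sphereGrad_vanish {u : Param → ℝ} {R : ℝ} (hR : ∀ ρ y, R < |ρ| → u (ρ, y) = 0) (ρ : ℝ)
    (y : S2) (h : R < |ρ|) : sphereGrad (fun y => u (ρ, y)) y = 0 := by
  have : (fun y => u (ρ, y)) = fun _ => 0 := funext fun y => hR ρ y h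
  rw [this, sphereGrad, homExt_zero_fun]; simp

theorem sphereLaplacian_vanish {u : Param → ℝ} {R : ℝ} (hR : ∀ ρ y, R < |ρ| → u (ρ, y) = 0)
    (ρ : ℝ) (y : S2) (h : R < |ρ|) : sphereLaplacian (fun y => u (ρ, y)) y = 0 := by
  have : (fun y => u (ρ, y)) = fun _ => 0 := funext fun y => hR ρ y h
  rw [this, sphereLaplacian, homExt_zero_fun]
  exact congrFun InnerProductSpace.laplacian_const _

/-! ### Polar coordinates and Green's formula on the sphere -/

/-- The surface measure of the unit sphere `S²`. -/
abbrev sph : Measure S2 := (volume : Measure E3).toSphere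

theorem finrank_E3 : Module.finrank ℝ E3 = 3 := by simp

theorem homeomorphUnitSphereProd_fst (x : ({(0)}ᶜ : Set E3)) :
    (homeomorphUnitSphereProd E3 x).1 = proj x.1 x.2 := by
  ext1
  simp [proj, homeomorphUnitSphereProd_apply_fst_coe]

/-- Polar coordinates in `ℝ³`: the integral of a radial function times a function of the
direction. -/
theorem integral_polar (k : ℝ → ℝ) (ψ : S2 → ℝ) :
    ∫ x : E3, k ‖x‖ * homExt ψ x = (∫ r in Set.Ioi (0 : ℝ), r ^ 2 * k r) * ∫ y, ψ y ∂sph := by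
  have h0 : ∫ x : E3, k ‖x‖ * homExt ψ x =
      ∫ x : ({(0)}ᶜ : Set E3), k ‖x.1‖ * homExt ψ x.1 ∂((volume : Measure E3).comap (↑)) := by
    rw [integral_subtype_comap (measurableSet_singleton _).compl
      (fun x : E3 => k ‖x‖ * homExt ψ x), restrict_compl_singleton]
  have h1 := (volume : Measure E3).measurePreserving_homeomorphUnitSphereProd.integral_comp
    (Homeomorph.measurableEmbedding _) (fun q : S2 × Set.Ioi (0 : ℝ) => ψ q.1 * k q.2)
  rw [h0, mul_comm, ← integral_subtype_comap measurableSet_Ioi (fun r : ℝ => r ^ 2 * k r)]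
  have h2 : ∫ r : Set.Ioi (0 : ℝ), (r : ℝ) ^ 2 * k r ∂(Measure.comap Subtype.val volume) =
      ∫ r : Set.Ioi (0 : ℝ), k r ∂(Measure.volumeIoiPow (Module.finrank ℝ E3 - 1)) := by
    rw [finrank_E3]
    simp only [Measure.volumeIoiPow, ENNReal.ofReal]
    rw [integral_withDensity_eq_integral_smul (measurable_subtype_coe.pow_const _).real_toNNReal]
    refine integral_congr_ae (.of_forall fun r => ?_)
    simp only [NNReal.smul_def, smul_eq_mul]
    rw [Real.coe_toNNReal _ (pow_nonneg (le_of_lt r.2) _)]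
  rw [h2, ← integral_prod_mul, ← h1]
  refine integral_congr_ae (.of_forall fun x => ?_)
  have hx : (x : E3) ≠ 0 := x.2
  simp only [homExt_of_ne ψ hx, homeomorphUnitSphereProd_apply_snd_coe]
  rw [mul_comm, homeomorphUnitSphereProd_fst]

/-- Polar coordinates for the lower integral. The equation `hG` leaves the value at the origin
free. -/
theorem lintegral_polar {k : ℝ → ENNReal} (hk : Measurable k) {ψ : S2 → ENNReal}
    (hψ : Measurable ψ) {G : E3 → ENNReal} (hG : ∀ x, ∀ hx : x ≠ 0, G x = k ‖x‖ * ψ (proj x hx)) :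
    ∫⁻ x : E3, G x =
      (∫⁻ r in Set.Ioi (0 : ℝ), ENNReal.ofReal (r ^ 2) * k r) * ∫⁻ y, ψ y ∂sph := by
  have h0 : ∫⁻ x : E3, G x =
      ∫⁻ x : ({(0)}ᶜ : Set E3), G x.1 ∂((volume : Measure E3).comap (↑)) := by
    rw [lintegral_subtype_comap (measurableSet_singleton _).compl G, restrict_compl_singleton]
  have h1 := (volume : Measure E3).measurePreserving_homeomorphUnitSphereProd.lintegral_comp_emb
    (Homeomorph.measurableEmbedding _) (fun q : S2 × Set.Ioi (0 : ℝ) => ψ q.1 * k q.2)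
  rw [h0, mul_comm, ← lintegral_subtype_comap measurableSet_Ioi
    (fun r : ℝ => ENNReal.ofReal (r ^ 2) * k r)]
  have h2 : ∫⁻ r : Set.Ioi (0 : ℝ), ENNReal.ofReal ((r : ℝ) ^ 2) * k r
        ∂(Measure.comap Subtype.val volume) =
      ∫⁻ r : Set.Ioi (0 : ℝ), k r ∂(Measure.volumeIoiPow (Module.finrank ℝ E3 - 1)) := by
    rw [finrank_E3, Measure.volumeIoiPow, lintegral_withDensity_eq_lintegral_mul _
      (by fun_prop) (by fun_prop)]
    rfl
  rw [h2, ← lintegral_prod_mul hψ.aemeasurable (by fun_prop), ← h1]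
  refine lintegral_congr fun x => ?_
  have hx : (x : E3) ≠ 0 := x.2
  rw [hG x hx, mul_comm, homeomorphUnitSphereProd_fst, homeomorphUnitSphereProd_apply_snd_coe]

theorem SmoothSphere.continuous {f : S2 → ℝ} (hf : SmoothSphere f) : Continuous f := by
  have := hf.continuousOn.comp_continuous (f := fun y : S2 => (y : E3)) (by fun_prop)
    (fun y => sphere_ne_zero y)
  simpa only [Function.comp_def, homExt_coe] using this

theorem SmoothSphere.continuous_sphereGrad {u : S2 → ℝ} (hu : SmoothSphere u) :
    Continuous (sphereGrad u) := by
  rw [← (PiLp.homeomorph 2 (fun _ : Fin 3 => ℝ)).comp_continuous_iff]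
  refine continuous_pi fun i => ?_
  refine ((hu.contDiffOn_partial (stdB i)).continuousOn.comp_continuous
    (f := fun y : S2 => (y : E3)) (by fun_prop) fun y => sphere_ne_zero y).congr fun y => ?_
  exact (sphereGrad_apply _ _ i).symm

theorem _root_.Continuous.integrable_sph {E : Type*} [NormedAddCommGroup E] {f : S2 → E}
    (hf : Continuous f) : Integrable f sph :=
  hf.integrable_of_hasCompactSupport (HasCompactSupport.of_compactSpace _)

theorem fderiv_homExt_smul {f : S2 → ℝ} {t : ℝ} (ht : 0 < t) (x : E3) :
    fderiv ℝ (homExt f) (t • x) = t⁻¹ • fderiv ℝ (homExt f) x := by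
  have h : (fun z => homExt f (t • z)) = homExt f := funext fun z => homExt_smul f ht z
  have h2 := fderiv_comp_smul (f := homExt f) (x := x) t
  rw [h] at h2
  rw [h2, smul_smul, inv_mul_cancel₀ ht.ne', one_smul]

theorem SmoothSphere.gradient_proj {f : S2 → ℝ} {x : E3} (hx : x ≠ 0) :
    gradient (homExt f) x = ‖x‖⁻¹ • sphereGrad f (proj x hx) := by
  have hn : 0 < ‖x‖ := norm_pos_iff.2 hx
  have h := fderiv_homExt_smul (f := f) hn (proj x hx : E3)
  have e : ‖x‖ • (proj x hx : E3) = x := by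
    simp [proj, smul_smul, hn.ne']
  rw [e] at h
  simp [sphereGrad, gradient, h]

theorem SmoothSphere.laplacian_proj {f : S2 → ℝ} (hf : SmoothSphere f) {x : E3} (hx : x ≠ 0) :
    Laplacian.laplacian (homExt f) x = (‖x‖ ^ 2)⁻¹ * sphereLaplacian f (proj x hx) := by
  have hn : 0 < ‖x‖ := norm_pos_iff.2 hx
  have e : ‖x‖ • (proj x hx : E3) = x := by
    simp [proj, smul_smul, hn.ne']
  rw [sphereLaplacian, hf.laplacian_eq hx, hf.laplacian_eq (sphere_ne_zero _), Finset.mul_sum]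
  refine Finset.sum_congr rfl fun i _ => ?_
  set g := fun z => fderiv ℝ (homExt f) z (stdB i) with hg
  have h1 : (fun z => g (‖x‖ • z)) = fun z => ‖x‖⁻¹ • g z := by
    funext z
    simp [hg, fderiv_homExt_smul hn]
  have h2 := fderiv_comp_smul (f := g) (x := (proj x hx : E3)) ‖x‖
  rw [h1, e] at h2
  have hd : DifferentiableAt ℝ g (proj x hx : E3) :=
    ((hf.contDiffOn_partial (stdB i)).contDiffAt
      (isOpen_ne.mem_nhds (sphere_ne_zero _))).differentiableAt (by simp)
  rw [fderiv_fun_const_smul hd] at h2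
  have h3 : fderiv ℝ g x = (‖x‖ ^ 2)⁻¹ • fderiv ℝ g (proj x hx : E3) := by
    have : fderiv ℝ g x = ‖x‖⁻¹ • (‖x‖ • fderiv ℝ g x) := by
      rw [smul_smul, inv_mul_cancel₀ hn.ne', one_smul]
    rw [this, ← h2, smul_smul]
    congr 1
    field_simp
  rw [h3]
  simp

/-- Multiplying by a function supported away from the origin removes the singularity. -/
theorem contDiff_mul_of_support {c F : E3 → ℝ} (hc : ContDiff ℝ ∞ c)
    (h0 : ∀ᶠ x in 𝓝 (0 : E3), c x = 0) (hF : ContDiffOn ℝ ∞ F {x | x ≠ 0}) :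
    ContDiff ℝ ∞ fun x => c x * F x := by
  rw [contDiff_iff_contDiffAt]
  intro x
  by_cases hx : x = 0
  · subst hx
    refine (contDiffAt_const (c := (0 : ℝ))).congr_of_eventuallyEq ?_
    filter_upwards [h0] with z hz
    simp [hz]
  · exact hc.contDiffAt.mul (hF.contDiffAt (isOpen_ne.mem_nhds hx))

theorem integral_fderiv_eq_zero {h : E3 → ℝ} (hh : ContDiff ℝ ∞ h) (hc : HasCompactSupport h)
    (v : E3) : ∫ x, fderiv ℝ h x v = 0 := by
  have hi : Integrable fun x => fderiv ℝ h x v := by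
    refine Continuous.integrable_of_hasCompactSupport ?_ (hc.fderiv_apply ℝ v)
    exact (hh.continuous_fderiv (by simp)).clm_apply continuous_const
  have := integral_mul_fderiv_eq_neg_fderiv_mul_of_integrable (μ := (volume : Measure E3))
    (f := fun _ : E3 => (1 : ℝ)) (g := h) (v := v) (by simp) (by simpa using hi)
    (by simpa using hh.continuous.integrable_of_hasCompactSupport hc)
    (fun _ _ => differentiableAt_const _) (fun _ _ => hh.differentiable (by simp) _)
  simpa using this

theorem inner_eq_sum_coord (v w : E3) : inner ℝ v w = ∑ i, v i * w i := by
  simp [PiLp.inner_apply, mul_comm]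

/-- Green's formula on the sphere. It follows from the divergence theorem in `ℝ³`, applied to
`c F ∇G` where `F`, `G` are the extensions of degree zero and `c` is a radial cutoff supported away
from the origin: `∇c` is radial and `∇G` tangential, so the cutoff is not differentiated. -/
theorem integral_mul_sphereLaplacian {f g : S2 → ℝ} (hf : SmoothSphere f) (hg : SmoothSphere g) :
    ∫ y, f y * sphereLaplacian g y ∂sph =
      -∫ y, inner ℝ (sphereGrad f y) (sphereGrad g y) ∂sph := by
  -- a bump function of `|x|²`, supported in `1 ≤ |x|² ≤ 3`
  let B : ContDiffBump (2 : ℝ) := ⟨1 / 2, 1, by norm_num, by norm_num⟩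
  let c : E3 → ℝ := fun x => B (‖x‖ ^ 2)
  have hc : ContDiff ℝ ∞ c := B.contDiff.comp (contDiff_norm_sq ℝ)
  have hc0 : ∀ᶠ x in 𝓝 (0 : E3), c x = 0 := by
    have : ∀ᶠ x in 𝓝 (0 : E3), ‖x‖ ^ 2 < 1 := by
      have hcont : ContinuousAt (fun x : E3 => ‖x‖ ^ 2) 0 := by fun_prop
      exact hcont.eventually_lt continuousAt_const (by simp)
    filter_upwards [this] with x hx
    refine B.zero_of_le_dist ?_
    rw [Real.dist_eq]
    have := neg_abs_le (‖x‖ ^ 2 - 2)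
    change (1 : ℝ) ≤ _
    linarith
  have hcs : HasCompactSupport c := by
    refine HasCompactSupport.intro (isCompact_closedBall (0 : E3) 2) fun x hx => ?_
    refine B.zero_of_le_dist ?_
    have h2 : 2 < ‖x‖ := by simpa using hx
    rw [Real.dist_eq]
    have := le_abs_self (‖x‖ ^ 2 - 2)
    change (1 : ℝ) ≤ _
    nlinarith
  have hcd (x : E3) (i : Fin 3) : fderiv ℝ c x (stdB i) = 2 * deriv B (‖x‖ ^ 2) * x i := by
    have h1 : HasFDerivAt (fun x : E3 => ‖x‖ ^ 2) (2 • innerSL ℝ x) x :=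
      (hasStrictFDerivAt_norm_sq x).hasFDerivAt
    have h2 : HasDerivAt B (deriv B (‖x‖ ^ 2)) (‖x‖ ^ 2) :=
      ((B.contDiff (n := ⊤)).differentiable (by simp) _).hasDerivAt
    have h3 := h2.comp_hasFDerivAt x h1
    have : fderiv ℝ c x = _ := h3.fderiv
    rw [this]
    simp [stdB, EuclideanSpace.inner_single_right]
    ring
  let F := homExt f
  let Gi : Fin 3 → E3 → ℝ := fun i x => fderiv ℝ (homExt g) x (stdB i)
  have hGi (i : Fin 3) : ContDiffOn ℝ ∞ (Gi i) {x | x ≠ 0} := hg.contDiffOn_partial _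
  have hFG (i : Fin 3) : ContDiffOn ℝ ∞ (fun x => F x * Gi i x) {x | x ≠ 0} := hf.mul (hGi i)
  have hz (i : Fin 3) : ∫ x, fderiv ℝ (fun x => c x * (F x * Gi i x)) x (stdB i) = 0 :=
    integral_fderiv_eq_zero (contDiff_mul_of_support hc hc0 (hFG i)) hcs.mul_right _
  have hint (i : Fin 3) :
      Integrable fun x => fderiv ℝ (fun x => c x * (F x * Gi i x)) x (stdB i) := by
    refine Continuous.integrable_of_hasCompactSupport ?_ (hcs.mul_right.fderiv_apply ℝ _)
    exact ((contDiff_mul_of_support hc hc0 (hFG i)).continuous_fderiv (by simp)).clm_apply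
      continuous_const
  have hsum : ∫ x, ∑ i, fderiv ℝ (fun x => c x * (F x * Gi i x)) x (stdB i) = 0 := by
    rw [integral_finsetSum _ fun i _ => hint i]
    simp [hz]
  let k : ℝ → ℝ := fun r => B (r ^ 2) * (r ^ 2)⁻¹
  let ψ : S2 → ℝ := fun y => inner ℝ (sphereGrad f y) (sphereGrad g y) + f y * sphereLaplacian g y
  have hpt (x : E3) : ∑ i, fderiv ℝ (fun x => c x * (F x * Gi i x)) x (stdB i) =
      k ‖x‖ * homExt ψ x := by
    by_cases hx : x = 0
    · subst hx
      have e (i : Fin 3) : fderiv ℝ (fun x => c x * (F x * Gi i x)) 0 (stdB i) = 0 := by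
        have : (fun x => c x * (F x * Gi i x)) =ᶠ[𝓝 0] fun _ => 0 := by
          filter_upwards [hc0] with z hz
          simp [hz]
        rw [this.fderiv_eq]; simp
      simp [e, homExt]
    · have hdc : DifferentiableAt ℝ c x := hc.differentiable (by simp) x
      have hdF : DifferentiableAt ℝ F x := hf.differentiableAt hx
      have hdG (i : Fin 3) : DifferentiableAt ℝ (Gi i) x :=
        ((hGi i).contDiffAt (isOpen_ne.mem_nhds hx)).differentiableAt (by simp)
      have e (i : Fin 3) : fderiv ℝ (fun x => c x * (F x * Gi i x)) x (stdB i) =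
          c x * (F x * fderiv ℝ (Gi i) x (stdB i) + fderiv ℝ F x (stdB i) * Gi i x)
            + 2 * deriv B (‖x‖ ^ 2) * F x * (x i * Gi i x) := by
        rw [fderiv_fun_mul hdc (hdF.fun_mul (hdG i)), fderiv_fun_mul hdF (hdG i)]
        simp only [add_apply, smul_apply, smul_eq_mul, hcd]
        ring
      have hrad : ∑ i, x i * Gi i x = 0 := by
        have h1 := fderiv_homExt_radial hg hx
        have h2 : x = ∑ i, x i • stdB i := by
          ext j
          simp [stdB, Finset.sum_apply, Pi.single_apply]
        rw [h2] at h1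
        conv at h1 => lhs; arg 1; rw [← h2]
        simpa [map_sum] using h1
      have hlap := hg.laplacian_proj hx
      rw [hg.laplacian_eq hx] at hlap
      have hgr : ∑ i, fderiv ℝ F x (stdB i) * Gi i x =
          (‖x‖ ^ 2)⁻¹ * inner ℝ (sphereGrad f (proj x hx)) (sphereGrad g (proj x hx)) := by
        have h1 : ∑ i, fderiv ℝ F x (stdB i) * Gi i x =
            inner ℝ (gradient (homExt f) x) (gradient (homExt g) x) := by
          rw [inner_eq_sum_coord]
          refine Finset.sum_congr rfl fun i _ => ?_
          have e (u : E3 → ℝ) : gradient u x i = fderiv ℝ u x (stdB i) := by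
            rw [← inner_gradient, stdB, EuclideanSpace.inner_single_right]; simp
          rw [e, e]
        rw [h1, SmoothSphere.gradient_proj hx, SmoothSphere.gradient_proj hx, inner_smul_left,
          inner_smul_right]
        simp
        ring
      simp only [e, Finset.sum_add_distrib, ← Finset.mul_sum]
      rw [hrad, hlap, hgr, homExt_of_ne _ hx]
      simp only [k, ψ, c, F, homExt_of_ne _ hx]
      ring
  simp only [hpt] at hsum
  rw [integral_polar] at hsum
  have hk : 0 < ∫ r in Set.Ioi (0 : ℝ), r ^ 2 * k r := by
    have e : ∫ r in Set.Ioi (0 : ℝ), r ^ 2 * k r = ∫ r in Set.Ioi (0 : ℝ), B (r ^ 2) := by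
      refine setIntegral_congr_fun measurableSet_Ioi fun r hr => ?_
      have : r ≠ 0 := ne_of_gt hr
      simp only [k]
      field_simp
    rw [e]
    have hBc : Continuous fun r : ℝ => B (r ^ 2) := B.continuous.comp (by fun_prop)
    have hBi : Integrable fun r : ℝ => B (r ^ 2) := by
      refine hBc.integrable_of_hasCompactSupport ?_
      refine HasCompactSupport.intro (isCompact_Icc (a := (-2 : ℝ)) (b := 2)) fun r hr => ?_
      refine B.zero_of_le_dist ?_
      have h2 : 2 < |r| := by
        by_contra hcon
        exact hr (abs_le.1 (not_lt.1 hcon))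
      rw [Real.dist_eq]
      have h3 := le_abs_self (r ^ 2 - 2)
      have h4 := sq_abs r
      change (1 : ℝ) ≤ _
      nlinarith
    rw [setIntegral_pos_iff_support_of_nonneg_ae (.of_forall fun r => B.nonneg) hBi.integrableOn]
    refine lt_of_lt_of_le ?_ (measure_mono (s := Set.Ioo (1.3 : ℝ) 1.5) ?_)
    · simp; norm_num
    · intro r hr
      refine ⟨?_, ?_⟩
      · have : 0 < B (r ^ 2) := by
          refine B.pos_of_mem_ball ?_
          rw [Metric.mem_ball, Real.dist_eq, abs_lt]
          change -(1 : ℝ) < _ ∧ _ < (1 : ℝ)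
          constructor <;> nlinarith [hr.1, hr.2]
        exact this.ne'
      · have := hr.1
        simp only [Set.mem_Ioi]
        linarith
  have h0 := (mul_eq_zero.1 hsum).resolve_left hk.ne'
  have hlc : Continuous (sphereLaplacian g) := by
    have := continuous_finsetSum Finset.univ fun i _ =>
      (((hGi i).fderiv_of_isOpen (m := ∞) isOpen_ne (by simp)).clm_apply
        (contDiffOn_const (c := stdB i))).continuousOn.comp_continuous
        (f := fun y : S2 => (y : E3)) (by fun_prop) fun y => sphere_ne_zero y
    exact this.congr fun y => (hg.laplacian_eq (sphere_ne_zero y)).symm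
  have hint1 : Integrable (fun y => inner ℝ (sphereGrad f y) (sphereGrad g y)) sph :=
    (hf.continuous_sphereGrad.inner hg.continuous_sphereGrad).integrable_sph
  have hint2 : Integrable (fun y => f y * sphereLaplacian g y) sph :=
    (hf.continuous.mul hlc).integrable_sph
  rw [integral_add hint1 hint2] at h0
  linarith

/-! ### Gaussian measures and rotations -/

/-- The Gaussian weight `exp (-|x|² / 2)`. -/
def gaussW (x : E3) : ℝ := Real.exp (-(1 / 2) * ‖x‖ ^ 2)

theorem gaussW_pos (x : E3) : 0 < gaussW x := Real.exp_pos _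

theorem continuous_gaussW : Continuous gaussW := by unfold gaussW; fun_prop

theorem integrableOn_pow_mul_gauss (n : ℕ) :
    IntegrableOn (fun r : ℝ => r ^ n * Real.exp (-(1 / 2) * r ^ 2)) (Set.Ioi 0) := by
  have := integrableOn_rpow_mul_exp_neg_mul_sq (b := 1 / 2) (by norm_num) (s := n)
    (by have := Nat.cast_nonneg (α := ℝ) n; linarith)
  simpa only [Real.rpow_natCast] using this

theorem integrable_norm_pow_mul_gaussW (n : ℕ) : Integrable fun x : E3 => ‖x‖ ^ n * gaussW x := by
  have := (integrable_fun_norm_addHaar (volume : Measure E3)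
    (f := fun r => r ^ n * Real.exp (-(1 / 2) * r ^ 2))).2 (by
      rw [finrank_E3]
      refine (integrableOn_pow_mul_gauss (n + 2)).congr_fun (fun r _ => ?_) measurableSet_Ioi
      simp only [smul_eq_mul]
      ring)
  exact this

theorem integrable_gaussW : Integrable gaussW := by
  simpa using integrable_norm_pow_mul_gaussW 0

/-- The radial moment `∫₀^∞ r² exp (-r² / 2) dr`. -/
def radialMoment : ℝ := ∫ r in Set.Ioi (0 : ℝ), r ^ 2 * Real.exp (-(1 / 2) * r ^ 2)

theorem radialMoment_pos : 0 < radialMoment := by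
  unfold radialMoment
  rw [setIntegral_pos_iff_support_of_nonneg_ae (.of_forall fun r => by positivity)
    (integrableOn_pow_mul_gauss 2)]
  refine lt_of_lt_of_le ?_ (measure_mono (s := Set.Ioo (1 : ℝ) 2) ?_)
  · simp
  · intro r hr
    have h1 : 0 < r := by linarith [hr.1]
    exact ⟨by simp [h1.ne', (Real.exp_pos _).ne'], h1⟩

theorem integral_gauss_eq_radialMoment :
    ∫ r in Set.Ioi (0 : ℝ), Real.exp (-(1 / 2) * r ^ 2) = radialMoment := by
  have hi0 : IntegrableOn (fun r : ℝ => Real.exp (-(1 / 2) * r ^ 2)) (Set.Ioi 0) := by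
    simpa using integrableOn_pow_mul_gauss 0
  have hi2 := integrableOn_pow_mul_gauss 2
  have hd (r : ℝ) : HasDerivAt (fun r : ℝ => r * Real.exp (-(1 / 2) * r ^ 2))
      (Real.exp (-(1 / 2) * r ^ 2) - r ^ 2 * Real.exp (-(1 / 2) * r ^ 2)) r := by
    have h1 : HasDerivAt (fun r : ℝ => -(1 / 2) * r ^ 2) (-r) r := by
      have := (hasDerivAt_pow 2 r).const_mul (-(1 / 2) : ℝ)
      convert! this using 1
      simp
    have := (hasDerivAt_id r).mul h1.exp
    convert! this using 1
    simp; ring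
  have ht : Tendsto (fun r : ℝ => r * Real.exp (-(1 / 2) * r ^ 2)) atTop (𝓝 0) := by
    refine squeeze_zero' (g := fun r : ℝ => r ^ 1 * Real.exp (-r)) ?_ ?_
      (Real.tendsto_pow_mul_exp_neg_atTop_nhds_zero 1)
    · filter_upwards [eventually_ge_atTop 0] with r hr
      positivity
    · filter_upwards [eventually_ge_atTop 2] with r hr
      rw [pow_one]
      refine mul_le_mul_of_nonneg_left (Real.exp_le_exp.2 ?_) (by linarith)
      nlinarith
  have h := integral_Ioi_of_hasDerivAt_of_tendsto' (a := (0 : ℝ)) (fun r _ => hd r)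
    (hi0.sub hi2) ht
  rw [integral_sub hi0 hi2] at h
  unfold radialMoment
  simp at h ⊢
  linarith

theorem integral_homExt_mul_gaussW (ψ : S2 → ℝ) :
    ∫ x, homExt ψ x * gaussW x = radialMoment * ∫ y, ψ y ∂sph := by
  have := integral_polar (fun r => Real.exp (-(1 / 2) * r ^ 2)) ψ
  rw [radialMoment, ← this]
  exact integral_congr_ae (.of_forall fun x => mul_comm _ _)

theorem integral_gaussW : ∫ x, gaussW x = radialMoment * sph.real Set.univ := by
  have := integral_homExt_mul_gaussW fun _ => 1
  rw [integral_const, smul_eq_mul, mul_one] at this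
  rw [← this]
  refine integral_congr_ae ?_
  filter_upwards [compl_mem_ae_iff.2 (measure_singleton (0 : E3))] with x hx
  rw [homExt_of_ne _ hx, one_mul]

theorem fderiv_gaussW (x v : E3) : fderiv ℝ gaussW x v = -(inner ℝ v x * gaussW x) := by
  have h1 : HasFDerivAt (fun x : E3 => ‖x‖ ^ 2) (2 • innerSL ℝ x) x :=
    (hasStrictFDerivAt_norm_sq x).hasFDerivAt
  have h2 := (h1.const_mul (-(1 / 2) : ℝ)).exp
  have : fderiv ℝ gaussW x = _ := h2.fderiv
  rw [this]
  simp [gaussW, real_inner_comm]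
  ring

/-- Integration by parts: the Gaussian weight has covariance the identity. -/
theorem integral_inner_sq_mul_gaussW (v : E3) :
    ∫ y, inner ℝ v y ^ 2 * gaussW y = ‖v‖ ^ 2 * ∫ y, gaussW y := by
  have hm (n : ℕ) : Integrable fun y : E3 => inner ℝ v y ^ n * gaussW y := by
    refine ((integrable_norm_pow_mul_gaussW n).const_mul (‖v‖ ^ n)).mono' ?_
      (.of_forall fun y => ?_)
    · have := continuous_gaussW
      exact Continuous.aestronglyMeasurable (by fun_prop)
    · rw [norm_mul, norm_pow, Real.norm_eq_abs, Real.norm_eq_abs, abs_of_pos (gaussW_pos y),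
        ← mul_assoc, ← mul_pow]
      gcongr
      · exact (gaussW_pos y).le
      · exact abs_real_inner_le_norm v y
  have hf (y : E3) : fderiv ℝ (fun y => inner ℝ v y) y v = ‖v‖ ^ 2 := by
    have h : HasFDerivAt (fun y => inner ℝ v y) (innerSL ℝ v) y := (innerSL ℝ v).hasFDerivAt
    rw [h.fderiv]
    simp
  have key := integral_mul_fderiv_eq_neg_fderiv_mul_of_integrable (μ := (volume : Measure E3))
    (f := fun y => inner ℝ v y) (g := gaussW) (v := v) (by
      simp only [hf]
      exact integrable_gaussW.const_mul _) (by
      simp only [fderiv_gaussW]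
      refine ((hm 2).neg).congr (.of_forall fun y => ?_)
      simp only [Pi.neg_apply]
      ring) (by simpa using hm 1)
    (fun y _ => (innerSL ℝ v).differentiableAt)
    (fun y _ => by
      unfold gaussW
      exact ((contDiff_norm_sq ℝ (n := 1)).differentiable (by simp) y).const_mul _ |>.exp)
  simp only [hf, fderiv_gaussW] at key
  rw [integral_const_mul] at key
  rw [← neg_inj, ← key, ← integral_neg]
  refine integral_congr_ae (.of_forall fun y => ?_)
  simp only
  ring

/-- The rotation of `ℝ³ × ℝ³` by the angle `θ`. -/
abbrev rot (θ : ℝ) : E3 × E3 →L[ℝ] E3 × E3 := ContinuousLinearMap.rotation θ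

theorem rot_neg_rot (θ : ℝ) (z : E3 × E3) : rot (-θ) (rot θ z) = z := by
  have h := Real.cos_sq_add_sin_sq θ
  simp only [rot, ContinuousLinearMap.rotation_apply, Real.cos_neg, Real.sin_neg]
  refine Prod.ext ?_ ?_
  · simp only [smul_add, smul_smul, neg_smul]
    match_scalars
    · linear_combination h
    · ring
  · simp only [smul_add, smul_smul, neg_smul]
    match_scalars
    · ring
    · linear_combination h

theorem gaussW_rot (θ : ℝ) (z : E3 × E3) :
    gaussW (rot θ z).1 * gaussW (rot θ z).2 = gaussW z.1 * gaussW z.2 := by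
  simp only [gaussW, ← Real.exp_add, rot, ContinuousLinearMap.rotation_apply]
  congr 1
  have h := Real.cos_sq_add_sin_sq θ
  simp only [neg_smul]
  rw [neg_add_eq_sub, norm_add_sq_real, norm_sub_sq_real]
  simp only [norm_smul, inner_smul_left, inner_smul_right, mul_pow, Real.norm_eq_abs, sq_abs]
  rw [real_inner_comm]
  simp
  linear_combination (-(1 / 2) * ‖z.1‖ ^ 2 - (1 / 2) * ‖z.2‖ ^ 2) * h

/-- Rotations of `ℝ³ × ℝ³` preserve the volume: they do so up to a constant, which is one because
the Gaussian is invariant. -/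
theorem measurePreserving_rot (θ : ℝ) :
    MeasurePreserving (rot θ) (volume : Measure (E3 × E3)) volume := by
  have hmeas : Measurable (rot θ) := (rot θ).continuous.measurable
  refine ⟨hmeas, ?_⟩
  have hH : (volume : Measure (E3 × E3)).IsAddHaarMeasure := by
    rw [Measure.volume_eq_prod]; infer_instance
  obtain ⟨c, -, hc⟩ := LinearMap.exists_map_addHaar_eq_smul_addHaar
    (rot θ : E3 × E3 →ₗ[ℝ] E3 × E3) (volume : Measure (E3 × E3)) (volume : Measure (E3 × E3))
    (fun z => ⟨rot (-θ) z, by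
      have := rot_neg_rot (-θ) z
      rwa [neg_neg] at this⟩)
  have hc' : Measure.map (rot θ) volume = c • (volume : Measure (E3 × E3)) := hc
  let G : E3 × E3 → ENNReal := fun z => ENNReal.ofReal (gaussW z.1 * gaussW z.2)
  have hGm : Measurable G := by
    have := continuous_gaussW
    exact (by fun_prop :
      Continuous fun z : E3 × E3 => gaussW z.1 * gaussW z.2).measurable.ennreal_ofReal
  have h1 : ∫⁻ z, G z = c * ∫⁻ z, G z := by
    calc ∫⁻ z, G z = ∫⁻ z, G (rot θ z) := by
          refine lintegral_congr fun z => ?_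
          simp only [G, gaussW_rot]
      _ = ∫⁻ z, G z ∂(Measure.map (rot θ) volume) := (lintegral_map hGm hmeas).symm
      _ = c * ∫⁻ z, G z := by rw [hc', lintegral_smul_measure, smul_eq_mul]
  have hint : Integrable (fun z : E3 × E3 => gaussW z.1 * gaussW z.2) :=
    integrable_gaussW.mul_prod integrable_gaussW
  have h2 : ∫⁻ z, G z = ENNReal.ofReal (∫ z : E3 × E3, gaussW z.1 * gaussW z.2) :=
    (ofReal_integral_eq_lintegral_ofReal hint
      (.of_forall fun z => (mul_pos (gaussW_pos _) (gaussW_pos _)).le)).symm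
  have h3 : 0 < ∫ z : E3 × E3, gaussW z.1 * gaussW z.2 := by
    rw [integral_pos_iff_support_of_nonneg
      (fun z => (mul_pos (gaussW_pos _) (gaussW_pos _)).le) hint]
    have : (Function.support fun z : E3 × E3 => gaussW z.1 * gaussW z.2) = Set.univ := by
      ext z
      simp [(gaussW_pos z.1).ne', (gaussW_pos z.2).ne']
    rw [this]
    exact isOpen_univ.measure_pos _ ⟨0, trivial⟩
  have h4 : ∫⁻ z, G z ≠ 0 := by rw [h2]; simpa using h3
  have h5 : ∫⁻ z, G z ≠ ⊤ := by rw [h2]; exact ENNReal.ofReal_ne_top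
  have hc1 : c = 1 := by
    rw [mul_comm] at h1
    exact (ENNReal.mul_eq_left h4 h5).1 h1.symm
  rw [hc', hc1, one_smul]

/-- The Cauchy–Schwarz inequality for the increment of a `C¹` function. -/
theorem sq_sub_le_integral_deriv_sq {g g' : ℝ → ℝ} {a b : ℝ} (hab : a < b)
    (hg : ∀ t, HasDerivAt g (g' t) t) (hc : Continuous g') :
    (g b - g a) ^ 2 ≤ (b - a) * ∫ t in a..b, g' t ^ 2 := by
  have h1 : ∫ t in a..b, g' t = g b - g a :=
    intervalIntegral.integral_eq_sub_of_hasDerivAt (fun t _ => hg t) (hc.intervalIntegrable _ _)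
  set A := (g b - g a) / (b - a) with hA
  have hba : 0 < b - a := sub_pos.2 hab
  have h2 : 0 ≤ ∫ t in a..b, (g' t - A) ^ 2 :=
    intervalIntegral.integral_nonneg hab.le fun t _ => sq_nonneg _
  have h3 : ∫ t in a..b, (g' t - A) ^ 2 =
      (∫ t in a..b, g' t ^ 2) - 2 * A * (g b - g a) + A ^ 2 * (b - a) := by
    have e : (fun t => (g' t - A) ^ 2) = fun t => (g' t ^ 2 - 2 * A * g' t) + A ^ 2 := by
      funext t; ring
    rw [e, intervalIntegral.integral_add, intervalIntegral.integral_sub,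
      intervalIntegral.integral_const_mul, h1, intervalIntegral.integral_const, smul_eq_mul]
    · ring
    all_goals exact Continuous.intervalIntegrable (by fun_prop) _ _
  have h4 : g b - g a = A * (b - a) := by rw [hA]; field_simp
  rw [h3, h4] at h2
  rw [h4]
  nlinarith

/-! ### The Poincaré inequality on the sphere -/

/-- Almost every pair of vectors is linearly independent, so that its rotations never have a
vanishing first component. -/
theorem ae_rot_fst_ne_zero :
    ∀ᵐ z : E3 × E3, ∀ θ : ℝ, Real.cos θ • z.1 + Real.sin θ • z.2 ≠ 0 := by
  let s : Set (E3 × E3) := {z | ‖z.1‖ ^ 2 • z.2 = inner ℝ z.1 z.2 • z.1}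
  have hs : MeasurableSet s := (isClosed_eq (by fun_prop) (by fun_prop)).measurableSet
  have h0 : volume s = 0 := by
    rw [Measure.volume_eq_prod, Measure.measure_prod_null hs]
    filter_upwards [compl_mem_ae_iff.2 (measure_singleton (0 : E3))] with x hx
    have hx : x ≠ 0 := hx
    have hsub : Prod.mk x ⁻¹' s ⊆ (Submodule.span ℝ {x} : Submodule ℝ E3) := by
      intro y hy
      have hy : ‖x‖ ^ 2 • y = inner ℝ x y • x := hy
      have hn : ‖x‖ ^ 2 ≠ 0 := pow_ne_zero 2 (norm_ne_zero_iff.2 hx)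
      refine Submodule.mem_span_singleton.2 ⟨(‖x‖ ^ 2)⁻¹ * inner ℝ x y, ?_⟩
      rw [mul_smul, ← hy, smul_smul, inv_mul_cancel₀ hn, one_smul]
    refine measure_mono_null hsub (Measure.addHaar_submodule _ _ fun htop => ?_)
    have h1 := finrank_span_le_card (R := ℝ) ({x} : Set E3)
    rw [htop, finrank_top, finrank_E3] at h1
    simp at h1
  filter_upwards [compl_mem_ae_iff.2 h0] with z hz θ hθ
  refine hz ?_
  change ‖z.1‖ ^ 2 • z.2 = inner ℝ z.1 z.2 • z.1
  by_cases hsin : Real.sin θ = 0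
  · have hcos : Real.cos θ ≠ 0 := by
      intro hc
      have := Real.cos_sq_add_sin_sq θ
      rw [hsin, hc] at this
      norm_num at this
    have : z.1 = 0 := by simpa [hsin, hcos] using hθ
    simp [this]
  · have h2 : z.2 = (-(Real.cos θ / Real.sin θ)) • z.1 := by
      have h3 : Real.sin θ • z.2 = -(Real.cos θ • z.1) := by
        rw [eq_neg_iff_add_eq_zero, add_comm]; exact hθ
      have h4 : z.2 = (Real.sin θ)⁻¹ • (Real.sin θ • z.2) := by
        rw [smul_smul, inv_mul_cancel₀ hsin, one_smul]
      rw [h4, h3, ← neg_smul, smul_smul]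
      congr 1
      field_simp
    rw [h2, inner_smul_right, real_inner_self_eq_norm_sq, smul_smul]
    congr 1
    ring

theorem measurable_gradient (F : E3 → ℝ) : Measurable (gradient F) :=
  (InnerProductSpace.toDual ℝ E3).symm.continuous.measurable.comp (measurable_fderiv ℝ F)

/-- The squared increment of the extension from `x` to `y` is bounded by the integral of its squared
derivative along `cos θ x + sin θ y`. -/
theorem ae_sq_sub_le {f : S2 → ℝ} (hf : SmoothSphere f) :
    ∀ᵐ z : E3 × E3, ENNReal.ofReal ((homExt f z.1 - homExt f z.2) ^ 2) ≤
      ENNReal.ofReal (Real.pi / 2) * ∫⁻ θ in Set.Ioc 0 (Real.pi / 2),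
        ENNReal.ofReal (inner ℝ (gradient (homExt f) (rot θ z).1) (rot θ z).2 ^ 2) := by
  filter_upwards [ae_rot_fst_ne_zero] with z hz
  let x : ℝ → E3 := fun θ => Real.cos θ • z.1 + Real.sin θ • z.2
  let y : ℝ → E3 := fun θ => -Real.sin θ • z.1 + Real.cos θ • z.2
  have hxd (θ : ℝ) : HasDerivAt x (y θ) θ :=
    ((Real.hasDerivAt_cos θ).smul_const z.1).add ((Real.hasDerivAt_sin θ).smul_const z.2)
  have hxc : Continuous x := by fun_prop
  have hyc : Continuous y := by fun_prop
  have hgd (θ : ℝ) : HasDerivAt (fun θ => homExt f (x θ)) (fderiv ℝ (homExt f) (x θ) (y θ)) θ :=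
    HasFDerivAt.comp_hasDerivAt (l := homExt f) (f := x) θ
      (hf.differentiableAt (hz θ)).hasFDerivAt (hxd θ)
  have hgc : Continuous fun θ => fderiv ℝ (homExt f) (x θ) (y θ) := by
    have h1 : ContinuousOn (fderiv ℝ (homExt f)) {x | x ≠ 0} :=
      hf.continuousOn_fderiv_of_isOpen isOpen_ne (by simp)
    exact (h1.comp_continuous hxc hz).clm_apply hyc
  have hpi : (0 : ℝ) < Real.pi / 2 := by positivity
  have h := sq_sub_le_integral_deriv_sq hpi hgd hgc
  have hx0 : x 0 = z.1 := by simp [x]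
  have hx1 : x (Real.pi / 2) = z.2 := by simp [x]
  rw [hx0, hx1, sub_zero, intervalIntegral.integral_of_le hpi.le] at h
  have hi : IntegrableOn (fun θ => fderiv ℝ (homExt f) (x θ) (y θ) ^ 2)
      (Set.Ioc 0 (Real.pi / 2)) := by
    rw [← intervalIntegrable_iff_integrableOn_Ioc_of_le hpi.le]
    exact (hgc.pow 2).intervalIntegrable _ _
  calc ENNReal.ofReal ((homExt f z.1 - homExt f z.2) ^ 2)
      ≤ ENNReal.ofReal (Real.pi / 2 *
          ∫ θ in Set.Ioc 0 (Real.pi / 2), fderiv ℝ (homExt f) (x θ) (y θ) ^ 2) := by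
        refine ENNReal.ofReal_le_ofReal (le_trans (le_of_eq ?_) h)
        ring
    _ = ENNReal.ofReal (Real.pi / 2) * ∫⁻ θ in Set.Ioc 0 (Real.pi / 2),
          ENNReal.ofReal (fderiv ℝ (homExt f) (x θ) (y θ) ^ 2) := by
        rw [ENNReal.ofReal_mul hpi.le,
          ofReal_integral_eq_lintegral_ofReal hi (.of_forall fun θ => sq_nonneg _)]
    _ = _ := by
        simp only [inner_gradient]
        rfl

theorem sph_univ_pos : 0 < sph.real Set.univ := by
  rw [Measure.toSphere_real_apply_univ, finrank_E3]
  have : 0 < (volume : Measure E3).real (Metric.ball 0 1) :=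
    ENNReal.toReal_pos (Metric.measure_ball_pos _ _ one_pos).ne' measure_ball_lt_top.ne
  positivity

/-- The Gaussian mean of `⟨∇F(x), y⟩²`, where `F` is the extension of `f`. The factor `|x|⁻²` in
`|∇F(x)|²` replaces one radial moment by `∫₀^∞ exp (-r² / 2) dr`, which has the same value. -/
theorem lintegral_inner_gradient_sq {f : S2 → ℝ} (hf : SmoothSphere f) :
    ∫⁻ z : E3 × E3, ENNReal.ofReal (inner ℝ (gradient (homExt f) z.1) z.2 ^ 2) *
        ENNReal.ofReal (gaussW z.1 * gaussW z.2) =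
      ENNReal.ofReal (radialMoment ^ 2 * sph.real Set.univ * ∫ y, ‖sphereGrad f y‖ ^ 2 ∂sph) := by
  have hgm := measurable_gradient (homExt f)
  have hgw := continuous_gaussW.measurable
  have hm : Measurable fun z : E3 × E3 =>
      ENNReal.ofReal (inner ℝ (gradient (homExt f) z.1) z.2 ^ 2) *
        ENNReal.ofReal (gaussW z.1 * gaussW z.2) := by
    exact (((hgm.comp measurable_fst).inner measurable_snd).pow_const 2).ennreal_ofReal.mul
      ((hgw.comp measurable_fst).mul (hgw.comp measurable_snd)).ennreal_ofReal
  have ha : 0 ≤ ∫ y, gaussW y := integral_nonneg fun y => (gaussW_pos y).le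
  rw [Measure.volume_eq_prod, lintegral_prod _ hm.aemeasurable]
  have h1 (x : E3) : ∫⁻ y, ENNReal.ofReal (inner ℝ (gradient (homExt f) x) y ^ 2) *
        ENNReal.ofReal (gaussW x * gaussW y) =
      ENNReal.ofReal (∫ y, gaussW y) *
        ENNReal.ofReal (‖gradient (homExt f) x‖ ^ 2 * gaussW x) := by
    set v := gradient (homExt f) x
    have hi : Integrable fun y => inner ℝ v y ^ 2 * gaussW y := by
      by_cases hv : v = 0
      · simp [hv]
      refine Integrable.of_integral_ne_zero ?_
      rw [integral_inner_sq_mul_gaussW, integral_gaussW]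
      have := sph_univ_pos
      have := radialMoment_pos
      positivity
    have e (y : E3) : ENNReal.ofReal (inner ℝ v y ^ 2) * ENNReal.ofReal (gaussW x * gaussW y) =
        ENNReal.ofReal (gaussW x) * ENNReal.ofReal (inner ℝ v y ^ 2 * gaussW y) := by
      rw [← ENNReal.ofReal_mul (sq_nonneg _), ← ENNReal.ofReal_mul (gaussW_pos x).le]
      congr 1; ring
    simp only [e]
    rw [lintegral_const_mul' _ _ ENNReal.ofReal_ne_top, ← ofReal_integral_eq_lintegral_ofReal hi
      (.of_forall fun y => mul_nonneg (sq_nonneg _) (gaussW_pos y).le),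
      integral_inner_sq_mul_gaussW, ← ENNReal.ofReal_mul (gaussW_pos x).le, ← ENNReal.ofReal_mul ha]
    congr 1; ring
  simp only [h1]
  rw [lintegral_const_mul' _ _ ENNReal.ofReal_ne_top]
  have hk : Measurable fun r : ℝ => ENNReal.ofReal ((r ^ 2)⁻¹ * Real.exp (-(1 / 2) * r ^ 2)) := by
    fun_prop
  have hψ : Measurable fun y : S2 => ENNReal.ofReal (‖sphereGrad f y‖ ^ 2) := by
    have := hf.continuous_sphereGrad
    exact (by fun_prop : Continuous fun y : S2 => ‖sphereGrad f y‖ ^ 2).measurable.ennreal_ofReal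
  have hpol := lintegral_polar
    (G := fun x => ENNReal.ofReal (‖gradient (homExt f) x‖ ^ 2 * gaussW x))
    hk hψ (fun x hx => by
      rw [← ENNReal.ofReal_mul (by positivity), SmoothSphere.gradient_proj hx, norm_smul, mul_pow,
        norm_inv, norm_norm, gaussW]
      congr 1
      rw [inv_pow]; ring)
  rw [hpol]
  have hrad : ∫⁻ r in Set.Ioi (0 : ℝ), ENNReal.ofReal (r ^ 2) *
      ENNReal.ofReal ((r ^ 2)⁻¹ * Real.exp (-(1 / 2) * r ^ 2)) = ENNReal.ofReal radialMoment := by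
    rw [← integral_gauss_eq_radialMoment, ofReal_integral_eq_lintegral_ofReal
      (by simpa [IntegrableOn] using integrableOn_pow_mul_gauss 0)
      (.of_forall fun r => (Real.exp_pos _).le)]
    refine setLIntegral_congr_fun measurableSet_Ioi fun r hr => ?_
    have : r ≠ 0 := ne_of_gt hr
    rw [← ENNReal.ofReal_mul (sq_nonneg _)]
    congr 1
    field_simp
  have hgi : Integrable (fun y => ‖sphereGrad f y‖ ^ 2) sph :=
    (hf.continuous_sphereGrad.norm.pow 2).integrable_sph
  rw [hrad, ← ofReal_integral_eq_lintegral_ofReal hgi (.of_forall fun y => sq_nonneg _),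
    ← ENNReal.ofReal_mul radialMoment_pos.le, ← ENNReal.ofReal_mul ha, integral_gaussW]
  congr 1
  ring

/-- A Poincaré inequality on the sphere. For independent standard Gaussian vectors `x`, `y` of `ℝ³`,
the path `cos θ x + sin θ y`, `0 ≤ θ ≤ π / 2`, leads from `x` to `y`, and the pair formed by a point
of the path and its velocity has the law of `(x, y)` for every `θ`. -/
theorem poincare_sphere {f : S2 → ℝ} (hf : SmoothSphere f) :
    sph.real Set.univ * ∫ y, f y ^ 2 ∂sph - (∫ y, f y ∂sph) ^ 2 ≤
      Real.pi ^ 2 / 8 * sph.real Set.univ * ∫ y, ‖sphereGrad f y‖ ^ 2 ∂sph := by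
  set F := homExt f with hF
  have hpi : (0 : ℝ) < Real.pi / 2 := by positivity
  have hFc : ContinuousOn F {x | x ≠ 0} := hf.continuousOn
  have hFm : AEStronglyMeasurable F (volume : Measure E3) := by
    have := hFc.aestronglyMeasurable (μ := (volume : Measure E3)) isOpen_ne.measurableSet
    rwa [show {x : E3 | x ≠ 0} = {0}ᶜ from rfl, restrict_compl_singleton] at this
  obtain ⟨C, hC⟩ : ∃ C, ∀ y, ‖f y‖ ≤ C := by
    obtain ⟨C, hC⟩ := isCompact_univ.exists_bound_of_continuousOn hf.continuous.continuousOn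
    exact ⟨C, fun y => hC y trivial⟩
  have hC0 : 0 ≤ C := (norm_nonneg _).trans (hC (proj (stdB 0) (by simp [stdB])))
  have hFb (x : E3) : ‖F x‖ ≤ C := by
    by_cases hx : x = 0
    · simpa [hF, homExt, hx] using hC0
    · rw [hF, homExt_of_ne f hx]; exact hC _
  have hi1 : Integrable fun x => F x * gaussW x :=
    integrable_gaussW.bdd_mul hFm (.of_forall hFb)
  have hi2 : Integrable fun x => F x ^ 2 * gaussW x :=
    integrable_gaussW.bdd_mul (hFm.pow 2) (c := C ^ 2) (.of_forall fun x => by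
      rw [norm_pow]; exact pow_le_pow_left₀ (norm_nonneg _) (hFb x) 2)
  have hs2 : ∫ x, F x ^ 2 * gaussW x = radialMoment * ∫ y, f y ^ 2 ∂sph := by
    rw [← integral_homExt_mul_gaussW]
    refine integral_congr_ae (.of_forall fun x => ?_)
    by_cases hx : x = 0
    · simp [hF, homExt, hx]
    · simp [hF, homExt_of_ne _ hx]
  have hs1 : ∫ x, F x * gaussW x = radialMoment * ∫ y, f y ∂sph := integral_homExt_mul_gaussW f
  -- the left-hand side as a Gaussian double integral
  have hexp : (fun z : E3 × E3 => (F z.1 - F z.2) ^ 2 * (gaussW z.1 * gaussW z.2)) =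
      fun z => (F z.1 ^ 2 * gaussW z.1) * gaussW z.2 + gaussW z.1 * (F z.2 ^ 2 * gaussW z.2)
        - 2 * ((F z.1 * gaussW z.1) * (F z.2 * gaussW z.2)) := by
    funext z; ring
  have hj1 : Integrable fun z : E3 × E3 => (F z.1 ^ 2 * gaussW z.1) * gaussW z.2 :=
    hi2.mul_prod integrable_gaussW
  have hj2 : Integrable fun z : E3 × E3 => gaussW z.1 * (F z.2 ^ 2 * gaussW z.2) :=
    integrable_gaussW.mul_prod hi2
  have hj3 : Integrable fun z : E3 × E3 => 2 * ((F z.1 * gaussW z.1) * (F z.2 * gaussW z.2)) :=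
    (hi1.mul_prod hi1).const_mul 2
  have hint : Integrable fun z : E3 × E3 => (F z.1 - F z.2) ^ 2 * (gaussW z.1 * gaussW z.2) := by
    rw [hexp]; exact (hj1.add hj2).sub hj3
  have hval : ∫ z : E3 × E3, (F z.1 - F z.2) ^ 2 * (gaussW z.1 * gaussW z.2) =
      2 * radialMoment ^ 2 *
        (sph.real Set.univ * ∫ y, f y ^ 2 ∂sph - (∫ y, f y ∂sph) ^ 2) := by
    rw [hexp, integral_sub (by exact hj1.add hj2) hj3, integral_add hj1 hj2, integral_const_mul,
      Measure.volume_eq_prod, integral_prod_mul (fun x => F x ^ 2 * gaussW x) gaussW,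
      integral_prod_mul gaussW (fun x => F x ^ 2 * gaussW x),
      integral_prod_mul (fun x => F x * gaussW x) (fun x => F x * gaussW x),
      hs1, hs2, integral_gaussW]
    ring
  let Φ : E3 × E3 → ENNReal := fun z =>
    ENNReal.ofReal (inner ℝ (gradient F z.1) z.2 ^ 2) * ENNReal.ofReal (gaussW z.1 * gaussW z.2)
  have hgm := measurable_gradient F
  have hgw := continuous_gaussW.measurable
  have hΦ : Measurable Φ := by
    exact (((hgm.comp measurable_fst).inner measurable_snd).pow_const 2).ennreal_ofReal.mul
      ((hgw.comp measurable_fst).mul (hgw.comp measurable_snd)).ennreal_ofReal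
  have hrotc : Continuous fun q : (E3 × E3) × ℝ => rot q.2 q.1 := by
    simp only [rot, ContinuousLinearMap.rotation_apply]
    fun_prop
  have key : ENNReal.ofReal (∫ z : E3 × E3, (F z.1 - F z.2) ^ 2 * (gaussW z.1 * gaussW z.2)) ≤
      ENNReal.ofReal (Real.pi / 2 * (Real.pi / 2) *
        (radialMoment ^ 2 * sph.real Set.univ * ∫ y, ‖sphereGrad f y‖ ^ 2 ∂sph)) := by
    calc ENNReal.ofReal (∫ z : E3 × E3, (F z.1 - F z.2) ^ 2 * (gaussW z.1 * gaussW z.2))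
        = ∫⁻ z : E3 × E3, ENNReal.ofReal ((F z.1 - F z.2) ^ 2) *
            ENNReal.ofReal (gaussW z.1 * gaussW z.2) := by
          rw [ofReal_integral_eq_lintegral_ofReal hint (.of_forall fun z =>
            mul_nonneg (sq_nonneg _) (mul_pos (gaussW_pos _) (gaussW_pos _)).le)]
          refine lintegral_congr fun z => ?_
          rw [ENNReal.ofReal_mul (sq_nonneg _)]
      _ ≤ ∫⁻ z : E3 × E3, ENNReal.ofReal (Real.pi / 2) *
            ∫⁻ θ in Set.Ioc 0 (Real.pi / 2), Φ (rot θ z) := by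
          refine lintegral_mono_ae ?_
          filter_upwards [ae_sq_sub_le hf] with z hz
          refine (mul_le_mul_left hz _).trans (le_of_eq ?_)
          rw [mul_assoc, ← lintegral_mul_const' _ _ ENNReal.ofReal_ne_top]
          simp only [Φ, gaussW_rot]
          rfl
      _ = ENNReal.ofReal (Real.pi / 2) *
            ∫⁻ θ in Set.Ioc 0 (Real.pi / 2), ∫⁻ z : E3 × E3, Φ (rot θ z) := by
          rw [lintegral_const_mul' _ _ ENNReal.ofReal_ne_top, lintegral_lintegral_swap]
          exact (hΦ.comp hrotc.measurable).aemeasurable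
      _ = ENNReal.ofReal (Real.pi / 2) *
            ∫⁻ θ in Set.Ioc 0 (Real.pi / 2), ∫⁻ z : E3 × E3, Φ z := by
          congr 1
          refine lintegral_congr fun θ => ?_
          exact (measurePreserving_rot θ).lintegral_comp hΦ
      _ = _ := by
          rw [lintegral_const, lintegral_inner_gradient_sq hf, Measure.restrict_apply_univ,
            Real.volume_Ioc, sub_zero, mul_comm (ENNReal.ofReal (_ * _)), ← mul_assoc,
            ← ENNReal.ofReal_mul hpi.le, ← ENNReal.ofReal_mul (by positivity)]
  have hnn : 0 ≤ Real.pi / 2 * (Real.pi / 2) *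
        (radialMoment ^ 2 * sph.real Set.univ * ∫ y, ‖sphereGrad f y‖ ^ 2 ∂sph) := by
    have : 0 ≤ ∫ y, ‖sphereGrad f y‖ ^ 2 ∂sph := integral_nonneg fun y => sq_nonneg _
    positivity
  rw [ENNReal.ofReal_le_ofReal_iff hnn, hval] at key
  have hr := radialMoment_pos
  have : radialMoment ^ 2 * (sph.real Set.univ * ∫ y, f y ^ 2 ∂sph - (∫ y, f y ∂sph) ^ 2) ≤
      radialMoment ^ 2 *
        (Real.pi ^ 2 / 8 * sph.real Set.univ * ∫ y, ‖sphereGrad f y‖ ^ 2 ∂sph) := by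
    linarith
  exact le_of_mul_le_mul_left this (by positivity)

/-! ### The coefficients of the metric and the second fundamental form -/

theorem one_le_jap (ρ : ℝ) : 1 ≤ jap ρ := by
  have h := jap_sq ρ
  have := jap_pos ρ
  nlinarith [sq_nonneg ρ]

theorem gRho_pos (ρ : ℝ) : 0 < gRho ρ := by
  have := jap_pos ρ
  unfold gRho; positivity

theorem gRho_eq (ρ : ℝ) : gRho ρ = (1 + ρ ^ 2) / (2 + ρ ^ 2) := by
  rw [gRho, jap_sq]; ring

theorem density_pos (ρ : ℝ) : 0 < density ρ := by
  have := jap_pos ρ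
  have := Real.sqrt_pos.2 (gRho_pos ρ)
  unfold density; positivity

theorem density_sq (ρ : ℝ) : density ρ ^ 2 = (1 + ρ ^ 2) ^ 3 / (2 + ρ ^ 2) := by
  rw [density, mul_pow, Real.sq_sqrt (gRho_pos ρ).le, gRho_eq, jap_sq]
  ring

theorem density_eq (ρ : ℝ) : density ρ = Real.sqrt ((1 + ρ ^ 2) ^ 3 / (2 + ρ ^ 2)) := by
  rw [← density_sq, Real.sqrt_sq (density_pos ρ).le]

theorem contDiff_density : ContDiff ℝ ∞ density := by
  have : density = fun ρ => Real.sqrt ((1 + ρ ^ 2) ^ 3 / (2 + ρ ^ 2)) := funext density_eq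
  rw [this]
  refine ContDiff.sqrt (ContDiff.div (by fun_prop) (by fun_prop) fun x => ?_) fun x => ?_ <;>
    positivity

theorem contDiff_jap : ContDiff ℝ ∞ jap := by
  unfold jap
  refine ContDiff.sqrt (by fun_prop) fun x => ?_
  positivity

theorem density_le (ρ : ℝ) : density ρ ≤ 1 + ρ ^ 2 := by
  refine abs_le_of_sq_le_sq' ?_ (by positivity) |>.2
  rw [density_sq, div_le_iff₀ (by positivity)]
  nlinarith [sq_nonneg ρ, sq_nonneg (1 + ρ ^ 2)]

theorem le_density (ρ : ℝ) : (1 + ρ ^ 2) / 2 ≤ density ρ := by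
  refine abs_le_of_sq_le_sq' ?_ (density_pos ρ).le |>.2
  rw [density_sq, le_div_iff₀ (by positivity)]
  have : (0 : ℝ) < (1 + ρ ^ 2) ^ 2 := by positivity
  nlinarith [sq_nonneg ρ]

/-- The coefficient `|g|^(1/2) g^ρρ` of the radial part of the Laplacian. -/
def flux (ρ : ℝ) : ℝ := density ρ * (gRho ρ)⁻¹

theorem flux_pos (ρ : ℝ) : 0 < flux ρ := mul_pos (density_pos ρ) (inv_pos.2 (gRho_pos ρ))

theorem flux_sq (ρ : ℝ) : flux ρ ^ 2 = (1 + ρ ^ 2) * (2 + ρ ^ 2) := by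
  rw [flux, mul_pow, density_sq, gRho_eq]
  field_simp

theorem flux_eq (ρ : ℝ) : flux ρ = jap ρ * Real.sqrt (2 + ρ ^ 2) := by
  have h := flux_sq ρ
  have h2 : (jap ρ * Real.sqrt (2 + ρ ^ 2)) ^ 2 = (1 + ρ ^ 2) * (2 + ρ ^ 2) := by
    rw [mul_pow, jap_sq, Real.sq_sqrt (by positivity)]
  have := jap_pos ρ
  exact (pow_left_inj₀ (flux_pos ρ).le (by positivity) two_ne_zero).1 (h.trans h2.symm)

theorem contDiff_flux : ContDiff ℝ ∞ flux := by
  have : flux = fun ρ => jap ρ * Real.sqrt (2 + ρ ^ 2) := funext flux_eq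
  rw [this]
  refine contDiff_jap.mul (ContDiff.sqrt (by fun_prop) fun x => ?_)
  positivity

/-- The gradient of a coordinate function on the sphere is the projection of the coordinate vector
to the tangent space. -/
theorem sphereGrad_coord (a : Fin 3) (c : ℝ) (y : S2) :
    sphereGrad (fun y => (y : E3) a * c) y = c • (stdB a - (y : E3) a • (y : E3)) := by
  have hy : ‖(y : E3)‖ = 1 := by simp
  have h1 : HasFDerivAt (fun x : E3 => ‖x‖ ^ 2) (2 • innerSL ℝ (y : E3)) (y : E3) :=
    (hasStrictFDerivAt_norm_sq (y : E3)).hasFDerivAt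
  have h2 : HasFDerivAt (fun x : E3 => ‖x‖) (innerSL ℝ (y : E3)) (y : E3) := by
    have := h1.sqrt (by simp [hy])
    simp only [Real.sqrt_sq (norm_nonneg _), hy] at this
    convert! this using 1
    ext v
    simp
  have h3 : HasFDerivAt (fun x : E3 => ‖x‖⁻¹) (-innerSL ℝ (y : E3)) (y : E3) := by
    have hinv : HasDerivAt (fun t : ℝ => t⁻¹) (-1) ‖(y : E3)‖ := by
      have := hasDerivAt_inv (x := ‖(y : E3)‖) (by rw [hy]; norm_num)
      simpa [hy] using this
    have := hinv.comp_hasFDerivAt (y : E3) h2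
    simpa [Function.comp_def] using this
  have h4 : HasFDerivAt (fun x : E3 => x a) (innerSL ℝ (stdB a)) (y : E3) := by
    have : (fun x : E3 => x a) = innerSL ℝ (stdB a) := by
      funext x
      simp [stdB, EuclideanSpace.inner_single_left]
    rw [this]
    exact (innerSL ℝ (stdB a)).hasFDerivAt
  have h5 := (h3.mul h4).mul_const c
  have h6 : homExt (fun y => (y : E3) a * c) =ᶠ[𝓝 (y : E3)] fun x => ‖x‖⁻¹ * x a * c := by
    filter_upwards [isOpen_ne.mem_nhds (sphere_ne_zero y)] with x hx
    rw [homExt_of_ne _ hx]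
    simp [proj]
  have h7 := h5.congr_of_eventuallyEq h6
  refine ext_inner_right ℝ fun v => ?_
  rw [inner_sphereGrad, h7.fderiv, inner_smul_left, inner_sub_left, inner_smul_left]
  simp [hy]
  ring

theorem norm_tangential_sq (a : Fin 3) (y : S2) :
    ‖stdB a - (y : E3) a • (y : E3)‖ ^ 2 = 1 - (y : E3) a ^ 2 := by
  rw [norm_sub_sq_real, norm_smul, inner_smul_right]
  simp [stdB, EuclideanSpace.inner_single_left]
  ring

theorem hasDerivAt_normal_axis (ρ : ℝ) :
    HasDerivAt (fun r => -(r * Real.sqrt (jap r ^ 2 + 1)) / jap r ^ 2)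
      (-2 / ((1 + ρ ^ 2) ^ 2 * Real.sqrt (2 + ρ ^ 2))) ρ := by
  have e : (fun r => -(r * Real.sqrt (jap r ^ 2 + 1)) / jap r ^ 2) =
      fun r => -(r * Real.sqrt (2 + r ^ 2)) / (1 + r ^ 2) := by
    funext r
    rw [jap_sq]
    ring_nf
  rw [e]
  have hp : HasDerivAt (fun r : ℝ => r ^ 2) (2 * ρ) ρ := by simpa using hasDerivAt_pow 2 ρ
  have h1 := (hp.const_add 2).sqrt (by positivity)
  have h2 := ((hasDerivAt_id ρ).mul h1).neg.div (hp.const_add 1) (by positivity)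
  convert! h2 using 1
  have hs : Real.sqrt (2 + ρ ^ 2) ^ 2 = 2 + ρ ^ 2 := Real.sq_sqrt (by positivity)
  have hs0 : 0 < Real.sqrt (2 + ρ ^ 2) := Real.sqrt_pos.2 (by positivity)
  simp only [id, Pi.mul_apply, Pi.neg_apply, one_mul]
  generalize Real.sqrt (2 + ρ ^ 2) = t at hs hs0 ⊢
  field_simp
  have : t ^ 2 = 2 + ρ ^ 2 := hs
  linear_combination (1 - ρ ^ 2) * this

/-- The squared norm of the second fundamental form is `6 ⟨ρ⟩⁻⁶`. -/
theorem secondFundSq_eq (p : Param) : secondFundSq p = 6 / (1 + p.1 ^ 2) ^ 3 := by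
  obtain ⟨ρ, y⟩ := p
  have hs0 : (0 : ℝ) < 1 + ρ ^ 2 := by positivity
  have hd : HasDerivAt (fun r => (jap r ^ 2)⁻¹) (-(2 * ρ) / (1 + ρ ^ 2) ^ 2) ρ := by
    have hp : HasDerivAt (fun r : ℝ => 1 + r ^ 2) (2 * ρ) ρ := by
      simpa using (hasDerivAt_pow 2 ρ).const_add 1
    have := hp.inv hs0.ne'
    simp only [jap_sq]
    exact this
  have h3 (a : Fin 3) : gradSq (fun q => (q.2 : E3) a * (jap q.1 ^ 2)⁻¹) (ρ, y) =
      (gRho ρ)⁻¹ * ((y : E3) a * (-(2 * ρ) / (1 + ρ ^ 2) ^ 2)) ^ 2 +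
        ((1 + ρ ^ 2) ^ 3)⁻¹ * (1 - (y : E3) a ^ 2) := by
    have e1 : dRho (fun q => (q.2 : E3) a * (jap q.1 ^ 2)⁻¹) (ρ, y) =
        (y : E3) a * (-(2 * ρ) / (1 + ρ ^ 2) ^ 2) := (hd.const_mul ((y : E3) a)).deriv
    rw [gradSq, e1]
    simp only
    rw [sphereGrad_coord, norm_smul, mul_pow ‖(jap ρ ^ 2)⁻¹‖, norm_tangential_sq,
      Real.norm_eq_abs, sq_abs, jap_sq]
    field_simp
  have h4 : gradSq (fun q => normal q 3) (ρ, y) =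
      (gRho ρ)⁻¹ * (-2 / ((1 + ρ ^ 2) ^ 2 * Real.sqrt (2 + ρ ^ 2))) ^ 2 := by
    have e1 : dRho (fun q => normal q 3) (ρ, y) =
        -2 / ((1 + ρ ^ 2) ^ 2 * Real.sqrt (2 + ρ ^ 2)) := by
      have := (hasDerivAt_normal_axis ρ).deriv
      simpa [dRho, normal] using this
    have e2 : sphereGrad (fun _ : S2 => normal (ρ, y) 3) y = 0 := by
      have : homExt (fun _ : S2 => normal (ρ, y) 3) =ᶠ[𝓝 (y : E3)] fun _ => normal (ρ, y) 3 := by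
        filter_upwards [isOpen_ne.mem_nhds (sphere_ne_zero y)] with x hx
        rw [homExt_of_ne _ hx]
      rw [sphereGrad, this.gradient_eq]; simp
    have e3 : (fun y' : S2 => normal (ρ, y') 3) = fun _ => normal (ρ, y) 3 := by
      funext y'; simp [normal]
    rw [gradSq, e1]
    simp only [e3, e2]
    simp
  have e (a : Fin 3) : (fun q : Param => normal q a.castSucc) =
      fun q => (q.2 : E3) a * (jap q.1 ^ 2)⁻¹ := by
    funext q
    fin_cases a <;> simp [normal, div_eq_mul_inv]
  rw [secondFundSq, Fin.sum_univ_castSucc]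
  simp only [e, h3]
  have hlast : (Fin.last 3) = (3 : Fin 4) := rfl
  rw [hlast, h4, Fin.sum_univ_three, gRho_eq, div_pow (-2 : ℝ), mul_pow ((1 + ρ ^ 2) ^ 2),
    Real.sq_sqrt (by positivity)]
  have hy := sphere_sum y
  have hy0 : (y : E3) 0 ^ 2 = 1 - (y : E3) 1 ^ 2 - (y : E3) 2 ^ 2 := by linarith
  simp only [mul_pow, hy0]
  field_simp
  ring

/-! ### The volume measure and Green's formula on the catenoid -/

/-- The product measure `dρ dω`. -/
abbrev prodMeas : Measure Param := (volume : Measure ℝ).prod sph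

theorem measurable_density_fst : Measurable fun p : Param => ENNReal.ofReal (density p.1) :=
  (contDiff_density.continuous.comp continuous_fst).measurable.ennreal_ofReal

theorem vol_eq : vol = prodMeas.withDensity fun p => ENNReal.ofReal (density p.1) := rfl

theorem integral_vol (f : Param → ℝ) : ∫ p, f p ∂vol = ∫ p, density p.1 * f p ∂prodMeas := by
  have hm : Measurable fun p : Param => (density p.1).toNNReal :=
    (contDiff_density.continuous.comp continuous_fst).measurable.real_toNNReal
  have : vol = prodMeas.withDensity fun p => ((density p.1).toNNReal : ENNReal) := rfl
  rw [this, integral_withDensity_eq_integral_smul hm]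
  refine integral_congr_ae (.of_forall fun p => ?_)
  simp only [NNReal.smul_def, smul_eq_mul, Real.coe_toNNReal _ (density_pos p.1).le]

theorem lintegral_vol {f : Param → ENNReal} (hf : AEMeasurable f prodMeas) :
    ∫⁻ p, f p ∂vol = ∫⁻ p, ENNReal.ofReal (density p.1) * f p ∂prodMeas := by
  rw [vol_eq, lintegral_withDensity_eq_lintegral_mul₀ measurable_density_fst.aemeasurable hf]
  rfl

theorem ae_vol_iff {P : Param → Prop} : (∀ᵐ p ∂vol, P p) ↔ ∀ᵐ p ∂prodMeas, P p := by
  rw [vol_eq, ae_withDensity_iff measurable_density_fst]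
  refine ⟨fun h => ?_, fun h => ?_⟩
  · filter_upwards [h] with p hp
    exact hp (by simpa using density_pos p.1)
  · filter_upwards [h] with p hp _ using hp

theorem prodMeas_ac_vol : prodMeas ≪ vol := fun s hs => by
  have h1 : ∀ᵐ p ∂vol, p ∉ s := by rwa [← compl_mem_ae_iff] at hs
  have h2 := ae_vol_iff.1 h1
  exact compl_mem_ae_iff.1 h2

theorem integrable_prodMeas {f : Param → ℝ} (hf : Continuous f)
    (hv : ∃ R : ℝ, ∀ ρ y, R < |ρ| → f (ρ, y) = 0) : Integrable f prodMeas :=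
  hf.integrable_of_hasCompactSupport (hasCompactSupport_of_vanish hv)

theorem SmoothSupp.radial_mul {W : ℝ → ℝ} (hW : ContDiff ℝ ∞ W) {u : Param → ℝ}
    (hu : SmoothSupp u) :
    SmoothSupp fun p => W p.1 * u p := by
  refine ⟨?_, ?_⟩
  · have h : ContDiffOn ℝ ∞ (fun q : ℝ × E3 => W q.1 * ext u q) extDomain :=
      (hW.comp contDiff_fst).contDiffOn.mul hu.smooth
    refine h.congr fun q hq => ?_
    have hq : q.2 ≠ 0 := hq
    simp only [ext, homExt_of_ne _ hq]
  · obtain ⟨R, hR⟩ := hu.supp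
    exact ⟨R, fun ρ y h => by simp [hR ρ y h]⟩

theorem SmoothSupp.sub {u v : Param → ℝ} (hu : SmoothSupp u) (hv : SmoothSupp v) :
    SmoothSupp fun p => u p - v p := by
  refine ⟨?_, ?_⟩
  · refine (hu.smooth.sub hv.smooth).congr fun q hq => ?_
    have hq : q.2 ≠ 0 := hq
    simp only [ext, homExt_of_ne _ hq]
  · obtain ⟨R, hR⟩ := hu.supp
    obtain ⟨R', hR'⟩ := hv.supp
    exact ⟨max R R', fun ρ y h => by
      rw [hR ρ y ((le_max_left _ _).trans_lt h), hR' ρ y ((le_max_right _ _).trans_lt h), sub_zero]⟩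

/-- The polarization of `gradSq`. -/
def gradInner (u v : Param → ℝ) (p : Param) : ℝ :=
  (gRho p.1)⁻¹ * (dRho u p * dRho v p) +
    (jap p.1 ^ 2)⁻¹ * inner ℝ (sphereGrad (fun y => u (p.1, y)) p.2)
      (sphereGrad (fun y => v (p.1, y)) p.2)

theorem gradInner_self (u : Param → ℝ) (p : Param) : gradInner u u p = gradSq u p := by
  rw [gradInner, gradSq, real_inner_self_eq_norm_sq, sq (dRho u p)]

theorem continuous_gRho : Continuous gRho := by
  have : gRho = fun ρ => (1 + ρ ^ 2) / (2 + ρ ^ 2) := funext gRho_eq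
  rw [this]
  exact Continuous.div (by fun_prop) (by fun_prop) fun x => by positivity

theorem SmoothSupp.continuous_gradInner {u v : Param → ℝ} (hu : SmoothSupp u) (hv : SmoothSupp v) :
    Continuous (gradInner u v) := by
  have h1 := hu.dRho.continuous
  have h2 := hv.dRho.continuous
  have h3 := hu.continuous_sphereGrad
  have h4 := hv.continuous_sphereGrad
  have h5 : Continuous fun p : Param => (gRho p.1)⁻¹ :=
    (continuous_gRho.comp continuous_fst).inv₀ fun p => (gRho_pos p.1).ne'
  have h6 : Continuous fun p : Param => (jap p.1 ^ 2)⁻¹ :=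
    ((continuous_jap.comp continuous_fst).pow 2).inv₀ fun p => (pow_pos (jap_pos p.1) 2).ne'
  exact (h5.mul (h1.mul h2)).add (h6.mul (h3.inner h4))

theorem gradInner_vanish {u v : Param → ℝ} {R : ℝ} (hR : ∀ ρ y, R < |ρ| → u (ρ, y) = 0) (ρ : ℝ)
    (y : S2) (h : R < |ρ|) : gradInner u v (ρ, y) = 0 := by
  simp [gradInner, SmoothSupp.dRho_vanish hR ρ y h, sphereGrad_vanish hR ρ y h]

/-- The stability operator multiplied by the volume density. -/
theorem density_mul_stabilityOp (v : Param → ℝ) (p : Param) :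
    density p.1 * stabilityOp v p = dRho (fun q => flux q.1 * dRho v q) p +
      density p.1 * (jap p.1 ^ 2)⁻¹ * sphereLaplacian (fun y => v (p.1, y)) p.2 +
      density p.1 * (6 / (1 + p.1 ^ 2) ^ 3) * v p := by
  have := (density_pos p.1).ne'
  have e : (fun q : Param => density q.1 * (gRho q.1)⁻¹ * dRho v q) =
      fun q => flux q.1 * dRho v q := rfl
  rw [stabilityOp, secondFundSq_eq, laplaceBeltrami, e]
  field_simp

theorem continuous_potential :
    Continuous fun ρ : ℝ => density ρ * (6 / (1 + ρ ^ 2) ^ 3) :=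
  contDiff_density.continuous.mul
    (Continuous.div (by fun_prop) (by fun_prop) fun x => by positivity)

theorem continuous_sphereCoeff : Continuous fun ρ : ℝ => density ρ * (jap ρ ^ 2)⁻¹ :=
  contDiff_density.continuous.mul
    ((continuous_jap.pow 2).inv₀ fun ρ => (pow_pos (jap_pos ρ) 2).ne')

theorem SmoothSupp.continuous_stabilityOp {v : Param → ℝ} (hv : SmoothSupp v) :
    Continuous (stabilityOp v) := by
  have h1 := (hv.dRho.radial_mul contDiff_flux).dRho.continuous
  have h2 := hv.continuous_sphereLaplacian
  have h3 := continuous_sphereCoeff.comp (continuous_fst (X := ℝ) (Y := S2))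
  have h4 := continuous_potential.comp (continuous_fst (X := ℝ) (Y := S2))
  have h5 : Continuous fun p : Param => (density p.1)⁻¹ :=
    (contDiff_density.continuous.comp continuous_fst).inv₀ fun p => (density_pos p.1).ne'
  refine (h5.mul ((h1.add (h3.mul h2)).add (h4.mul hv.continuous))).congr fun p => ?_
  have := (density_pos p.1).ne'
  have h6 := density_mul_stabilityOp v p
  have h7 : stabilityOp v p = (density p.1)⁻¹ * (density p.1 * stabilityOp v p) := by field_simp
  rw [h7, h6]
  rfl

theorem stabilityOp_vanish {v : Param → ℝ} {R : ℝ} (hR : ∀ ρ y, R < |ρ| → v (ρ, y) = 0) (ρ : ℝ)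
    (y : S2) (h : R < |ρ|) : stabilityOp v (ρ, y) = 0 := by
  have h1 : ∀ ρ y, R < |ρ| → flux ρ * Catenoid.dRho v (ρ, y) = 0 := fun ρ y h => by
    rw [SmoothSupp.dRho_vanish hR ρ y h, mul_zero]
  have h2 := density_mul_stabilityOp v (ρ, y)
  rw [SmoothSupp.dRho_vanish (u := fun q => flux q.1 * Catenoid.dRho v q) h1 ρ y h, hR ρ y h] at h2
  simp only [sphereLaplacian_vanish hR ρ y h] at h2
  have := (density_pos ρ).ne'
  simpa [this] using h2

/-- Integration by parts in the radial variable. -/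
theorem integral_mul_dRho_flux {u v : Param → ℝ} (hu : SmoothSupp u) (hv : SmoothSupp v) (y : S2) :
    ∫ ρ, u (ρ, y) * dRho (fun q => flux q.1 * dRho v q) (ρ, y) =
      -∫ ρ, flux ρ * (dRho u (ρ, y) * dRho v (ρ, y)) := by
  have hw : SmoothSupp fun q => flux q.1 * dRho v q := hv.dRho.radial_mul contDiff_flux
  have hint {f : ℝ → ℝ} (hf : Continuous f) (hs : ∃ R, ∀ ρ, R < |ρ| → f ρ = 0) : Integrable f := by
    obtain ⟨R, hR⟩ := hs
    refine hf.integrable_of_hasCompactSupport (HasCompactSupport.intro (K := Set.Icc (-R) R)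
      isCompact_Icc fun ρ hρ => hR ρ ?_)
    by_contra hc
    exact hρ (abs_le.1 (not_lt.1 hc))
  obtain ⟨R, hR⟩ := hu.supp
  let a : ℝ → ℝ := fun ρ => u (ρ, y)
  let a' : ℝ → ℝ := fun ρ => dRho u (ρ, y)
  let b : ℝ → ℝ := fun ρ => flux ρ * dRho v (ρ, y)
  let b' : ℝ → ℝ := fun ρ => dRho (fun q => flux q.1 * dRho v q) (ρ, y)
  have ha (ρ : ℝ) : HasDerivAt a (a' ρ) ρ := hu.hasDerivAt_rho ρ y
  have hb (ρ : ℝ) : HasDerivAt b (b' ρ) ρ := hw.hasDerivAt_rho ρ y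
  have ca : Continuous a := (hu.contDiff_rho y).continuous
  have ca' : Continuous a' := (hu.dRho.contDiff_rho y).continuous
  have cb : Continuous b := (hw.contDiff_rho y).continuous
  have cb' : Continuous b' := (hw.dRho.contDiff_rho y).continuous
  have va (ρ : ℝ) (h : R < |ρ|) : a ρ = 0 := hR ρ y h
  have va' (ρ : ℝ) (h : R < |ρ|) : a' ρ = 0 := SmoothSupp.dRho_vanish hR ρ y h
  have key := integral_mul_deriv_eq_deriv_mul_of_integrable
    (fun ρ _ => ha ρ) (fun ρ _ => hb ρ)
    (hint (ca.mul cb') ⟨R, fun ρ h => by simp [va ρ h]⟩)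
    (hint (ca'.mul cb) ⟨R, fun ρ h => by simp [va' ρ h]⟩)
    (hint (ca.mul cb) ⟨R, fun ρ h => by simp [va ρ h]⟩)
  refine key.trans ?_
  congr 1
  refine integral_congr_ae (.of_forall fun ρ => ?_)
  simp only [a', b]
  ring

/-- Green's formula for the stability operator. -/
theorem integral_mul_stabilityOp {u v : Param → ℝ} (hu : SmoothSupp u) (hv : SmoothSupp v) :
    ∫ p, u p * stabilityOp v p ∂vol =
      -∫ p, (gradInner u v p - 6 / (1 + p.1 ^ 2) ^ 3 * (u p * v p)) ∂vol := by
  obtain ⟨R, hR⟩ := hu.supp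
  have hw : SmoothSupp fun q => flux q.1 * dRho v q := hv.dRho.radial_mul contDiff_flux
  have hq := continuous_sphereCoeff.comp (continuous_fst (X := ℝ) (Y := S2))
  have hf := contDiff_flux.continuous.comp (continuous_fst (X := ℝ) (Y := S2))
  have hpot := continuous_potential.comp (continuous_fst (X := ℝ) (Y := S2))
  let A : Param → ℝ := fun p => u p * dRho (fun q => flux q.1 * dRho v q) p
  let A' : Param → ℝ := fun p => flux p.1 * (dRho u p * dRho v p)
  let B : Param → ℝ := fun p => density p.1 * (jap p.1 ^ 2)⁻¹ *
    (u p * sphereLaplacian (fun y => v (p.1, y)) p.2)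
  let B' : Param → ℝ := fun p => density p.1 * (jap p.1 ^ 2)⁻¹ *
    inner ℝ (sphereGrad (fun y => u (p.1, y)) p.2) (sphereGrad (fun y => v (p.1, y)) p.2)
  let C : Param → ℝ := fun p => density p.1 * (6 / (1 + p.1 ^ 2) ^ 3) * (u p * v p)
  have hA : Integrable A prodMeas := integrable_prodMeas
    (hu.continuous.mul hw.dRho.continuous) ⟨R, fun ρ y h => by simp [A, hR ρ y h]⟩
  have hA' : Integrable A' prodMeas := integrable_prodMeas
    (hf.mul (hu.dRho.continuous.mul hv.dRho.continuous))
    ⟨R, fun ρ y h => by simp [A', SmoothSupp.dRho_vanish hR ρ y h]⟩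
  have hB : Integrable B prodMeas := integrable_prodMeas
    (hq.mul (hu.continuous.mul hv.continuous_sphereLaplacian))
    ⟨R, fun ρ y h => by simp [B, hR ρ y h]⟩
  have hB' : Integrable B' prodMeas := integrable_prodMeas
    (hq.mul (hu.continuous_sphereGrad.inner hv.continuous_sphereGrad))
    ⟨R, fun ρ y h => by simp [B', sphereGrad_vanish hR ρ y h]⟩
  have hC : Integrable C prodMeas := integrable_prodMeas
    (hpot.mul (hu.continuous.mul hv.continuous)) ⟨R, fun ρ y h => by simp [C, hR ρ y h]⟩
  have eA : ∫ p, A p ∂prodMeas = -∫ p, A' p ∂prodMeas := by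
    rw [integral_prod_symm _ hA, integral_prod_symm _ hA', ← integral_neg]
    exact integral_congr_ae (.of_forall fun y => integral_mul_dRho_flux hu hv y)
  have eB : ∫ p, B p ∂prodMeas = -∫ p, B' p ∂prodMeas := by
    rw [integral_prod _ hB, integral_prod _ hB', ← integral_neg]
    refine integral_congr_ae (.of_forall fun ρ => ?_)
    simp only [B, B']
    rw [integral_const_mul, integral_const_mul,
      integral_mul_sphereLaplacian (hu.smoothSphere ρ) (hv.smoothSphere ρ), mul_neg]
  rw [integral_vol, integral_vol]
  have e1 : (fun p : Param => density p.1 * (u p * stabilityOp v p)) =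
      fun p => A p + B p + C p := by
    funext p
    have := density_mul_stabilityOp v p
    simp only [A, B, C]
    linear_combination u p * this
  have e2 : (fun p : Param => density p.1 * (gradInner u v p - 6 / (1 + p.1 ^ 2) ^ 3 * (u p * v p)))
      = fun p => A' p + B' p - C p := by
    funext p
    simp only [A', B', C, gradInner, flux]
    ring
  rw [e1, e2, integral_add (by exact hA.add hB) hC, integral_add hA hB,
    integral_sub (by exact hA'.add hB') hC, integral_add hA' hB', eA, eB]
  ring

/-! ### Coercivity of the weighted form -/

/-- The weight `w = ⟨ρ⟩ / (1 + ε ⟨ρ⟩²)`. It increases to `⟨ρ⟩` as `ε → 0`, decays like `⟨ρ⟩⁻¹` for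
`ε > 0`, and satisfies `|w'| ≤ w / ⟨ρ⟩`. -/
def wt (ε ρ : ℝ) : ℝ := jap ρ / (1 + ε * (1 + ρ ^ 2))

/-- The derivative of `wt`. -/
def wtDeriv (ε ρ : ℝ) : ℝ :=
  ρ / jap ρ * (1 - ε * (1 + ρ ^ 2)) / (1 + ε * (1 + ρ ^ 2)) ^ 2

/-- The square of the weight `wt`. -/
def wtSq (ε ρ : ℝ) : ℝ := (1 + ρ ^ 2) / (1 + ε * (1 + ρ ^ 2)) ^ 2

/-- The derivative of `wtSq`. -/
def wtSqDeriv (ε ρ : ℝ) : ℝ := 2 * wt ε ρ * wtDeriv ε ρ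

theorem wt_denom_pos {ε : ℝ} (hε : 0 < ε) (ρ : ℝ) : 0 < 1 + ε * (1 + ρ ^ 2) := by positivity

theorem wt_sq (ε ρ : ℝ) : wt ε ρ ^ 2 = wtSq ε ρ := by
  rw [wt, wtSq, div_pow, jap_sq]

theorem hasDerivAt_wt {ε : ℝ} (hε : 0 < ε) (ρ : ℝ) : HasDerivAt (wt ε) (wtDeriv ε ρ) ρ := by
  have hp : HasDerivAt (fun r : ℝ => 1 + r ^ 2) (2 * ρ) ρ := by
    simpa using (hasDerivAt_pow 2 ρ).const_add 1
  have h2 := (hasDerivAt_jap ρ).div ((hp.const_mul ε).const_add 1) (wt_denom_pos hε ρ).ne'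
  convert! h2 using 1
  have hj := jap_sq ρ
  have := jap_pos ρ
  have := wt_denom_pos hε ρ
  rw [wtDeriv]
  field_simp
  rw [hj]
  ring

theorem hasDerivAt_wtSq {ε : ℝ} (hε : 0 < ε) (ρ : ℝ) :
    HasDerivAt (wtSq ε) (wtSqDeriv ε ρ) ρ := by
  have e : wtSq ε = fun r => wt ε r ^ 2 := funext fun r => (wt_sq ε r).symm
  rw [e]
  have := (hasDerivAt_wt hε ρ).pow 2
  convert! this using 1
  simp [wtSqDeriv]

theorem contDiff_wtSq {ε : ℝ} (hε : 0 < ε) : ContDiff ℝ ∞ (wtSq ε) :=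
  ContDiff.div (by fun_prop) (by fun_prop) fun x => (pow_pos (wt_denom_pos hε x) 2).ne'

theorem wtSq_nonneg (ε ρ : ℝ) : 0 ≤ wtSq ε ρ := by unfold wtSq; positivity

theorem wtSq_le {ε : ℝ} (hε : 0 < ε) (ρ : ℝ) : wtSq ε ρ ≤ 1 + ρ ^ 2 := by
  unfold wtSq
  refine div_le_self (by positivity) ?_
  refine one_le_pow₀ ?_
  have : 0 < ε * (1 + ρ ^ 2) := by positivity
  linarith

theorem wtSq_le_inv {ε : ℝ} (hε : 0 < ε) (ρ : ℝ) :
    wtSq ε ρ ≤ (ε ^ 2)⁻¹ * (1 + ρ ^ 2)⁻¹ := by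
  unfold wtSq
  rw [← mul_inv, ← one_div, div_le_div_iff₀ (by positivity) (by positivity)]
  have : 0 < ε * (1 + ρ ^ 2) := by positivity
  nlinarith

theorem continuous_wtDeriv {ε : ℝ} (hε : 0 < ε) : Continuous (wtDeriv ε) := by
  have := continuous_jap
  unfold wtDeriv
  refine Continuous.div ?_ (by fun_prop) fun x => (pow_pos (wt_denom_pos hε x) 2).ne'
  exact (continuous_id.div this fun x => (jap_pos x).ne').mul (by fun_prop)

theorem continuous_wt {ε : ℝ} (hε : 0 < ε) : Continuous (wt ε) :=
  continuous_iff_continuousAt.2 fun ρ => (hasDerivAt_wt hε ρ).continuousAt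

theorem wtDeriv_sq_le {ε : ℝ} (hε : 0 < ε) (ρ : ℝ) :
    wtDeriv ε ρ ^ 2 ≤ ρ ^ 2 / (1 + ρ ^ 2) ^ 2 * wtSq ε ρ := by
  have hd := wt_denom_pos hε ρ
  have hs : (0 : ℝ) < 1 + ρ ^ 2 := by positivity
  have h1 : wtDeriv ε ρ ^ 2 = ρ ^ 2 / (1 + ρ ^ 2) ^ 2 * wtSq ε ρ *
      ((1 - ε * (1 + ρ ^ 2)) ^ 2 / (1 + ε * (1 + ρ ^ 2)) ^ 2) := by
    rw [wtDeriv, wtSq, div_pow, mul_pow, div_pow, jap_sq]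
    field_simp
  rw [h1]
  refine mul_le_of_le_one_right (mul_nonneg (by positivity) (wtSq_nonneg _ _)) ?_
  rw [div_le_one (by positivity)]
  have : 0 < ε * (1 + ρ ^ 2) := by positivity
  nlinarith

theorem flux_mul_wtDeriv_sq_le {ε : ℝ} (hε : 0 < ε) (ρ : ℝ) :
    flux ρ * wtDeriv ε ρ ^ 2 ≤ wtSq ε ρ := by
  have h1 := wtDeriv_sq_le hε ρ
  have hs : (0 : ℝ) < 1 + ρ ^ 2 := by positivity
  have h2 : flux ρ * (ρ ^ 2 / (1 + ρ ^ 2) ^ 2) ≤ 1 := by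
    refine abs_le_of_sq_le_sq' ?_ zero_le_one |>.2
    rw [mul_pow, flux_sq, div_pow, one_pow, mul_div_assoc', div_le_one (by positivity)]
    have := sq_nonneg ρ
    nlinarith [pow_nonneg this 2, pow_nonneg this 3, pow_nonneg this 4]
  calc flux ρ * wtDeriv ε ρ ^ 2 ≤ flux ρ * (ρ ^ 2 / (1 + ρ ^ 2) ^ 2 * wtSq ε ρ) :=
        mul_le_mul_of_nonneg_left h1 (flux_pos ρ).le
    _ = flux ρ * (ρ ^ 2 / (1 + ρ ^ 2) ^ 2) * wtSq ε ρ := by ring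
    _ ≤ 1 * wtSq ε ρ := mul_le_mul_of_nonneg_right h2 (wtSq_nonneg _ _)
    _ = wtSq ε ρ := one_mul _

theorem sq_le_flux (ρ : ℝ) : ρ ^ 2 ≤ flux ρ := by
  refine abs_le_of_sq_le_sq' ?_ (flux_pos ρ).le |>.2
  rw [flux_sq]
  nlinarith [sq_nonneg ρ]

theorem integrable_of_vanish {f : ℝ → ℝ} (hf : Continuous f)
    (hs : ∃ R, ∀ ρ, R < |ρ| → f ρ = 0) : Integrable f := by
  obtain ⟨R, hR⟩ := hs
  refine hf.integrable_of_hasCompactSupport (HasCompactSupport.intro (K := Set.Icc (-R) R)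
    isCompact_Icc fun ρ hρ => hR ρ ?_)
  by_contra hc
  exact hρ (abs_le.1 (not_lt.1 hc))

/-- The radial part of the weighted energy. Hardy's inequality for `h = w a` contributes
`1 / 4`, and the derivative of the weight costs `1`. -/
theorem radial_energy_ge {ε : ℝ} (hε : 0 < ε) {a a' : ℝ → ℝ} (ha : ∀ ρ, HasDerivAt a (a' ρ) ρ)
    (ha' : Continuous a') {R : ℝ} (hR : ∀ ρ, R < |ρ| → a ρ = 0)
    (hR' : ∀ ρ, R < |ρ| → a' ρ = 0) :
    -(3 / 4) * ∫ ρ, wtSq ε ρ * a ρ ^ 2 ≤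
      ∫ ρ, flux ρ * (a' ρ * (wtSqDeriv ε ρ * a ρ + wtSq ε ρ * a' ρ)) := by
  have hac : Continuous a := continuous_iff_continuousAt.2 fun ρ => (ha ρ).continuousAt
  have hwc := continuous_wt hε
  have hwc' := continuous_wtDeriv hε
  have hWc := (contDiff_wtSq hε).continuous
  have hfc := contDiff_flux.continuous
  have hWc' : Continuous (wtSqDeriv ε) := by unfold wtSqDeriv; fun_prop
  let h : ℝ → ℝ := fun ρ => wt ε ρ * a ρ
  let h' : ℝ → ℝ := fun ρ => wtDeriv ε ρ * a ρ + wt ε ρ * a' ρ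
  have hh (ρ : ℝ) : HasDerivAt h (h' ρ) ρ := (hasDerivAt_wt hε ρ).mul (ha ρ)
  let k' : ℝ → ℝ := fun ρ => h ρ ^ 2 + ρ * (2 * h ρ * h' ρ)
  have hk (ρ : ℝ) : HasDerivAt (fun r => r * h r ^ 2) (k' ρ) ρ := by
    have := (hasDerivAt_id ρ).mul ((hh ρ).pow 2)
    convert! this using 1
    simp [k']
  have hhc : Continuous h := hwc.mul hac
  have hhc' : Continuous h' := (hwc'.mul hac).add (hwc.mul ha')
  have ik' : Integrable k' := integrable_of_vanish (by fun_prop)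
    ⟨R, fun ρ hρ => by simp [k', h, hR ρ hρ]⟩
  have ik : Integrable fun r => r * h r ^ 2 := integrable_of_vanish (by fun_prop)
    ⟨R, fun ρ hρ => by simp [h, hR ρ hρ]⟩
  have hk0 : ∫ ρ, k' ρ = 0 := integral_eq_zero_of_hasDerivAt_of_integrable hk ik' ik
  have i1 : Integrable fun ρ => wtSq ε ρ * a ρ ^ 2 := integrable_of_vanish (by fun_prop)
    ⟨R, fun ρ hρ => by simp [hR ρ hρ]⟩
  have i2 : Integrable fun ρ => flux ρ * (a' ρ * (wtSqDeriv ε ρ * a ρ + wtSq ε ρ * a' ρ)) :=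
    integrable_of_vanish (by fun_prop) ⟨R, fun ρ hρ => by simp [hR' ρ hρ]⟩
  have hpt (ρ : ℝ) : -(3 / 4) * (wtSq ε ρ * a ρ ^ 2) - 1 / 2 * k' ρ ≤
      flux ρ * (a' ρ * (wtSqDeriv ε ρ * a ρ + wtSq ε ρ * a' ρ)) := by
    have e1 : a' ρ * (wtSqDeriv ε ρ * a ρ + wtSq ε ρ * a' ρ) =
        h' ρ ^ 2 - wtDeriv ε ρ ^ 2 * a ρ ^ 2 := by
      simp only [h', wtSqDeriv, ← wt_sq]; ring
    have e2 : wtSq ε ρ * a ρ ^ 2 = h ρ ^ 2 := by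
      simp only [h, ← wt_sq]; ring
    have l1 : flux ρ * wtDeriv ε ρ ^ 2 * a ρ ^ 2 ≤ wtSq ε ρ * a ρ ^ 2 :=
      mul_le_mul_of_nonneg_right (flux_mul_wtDeriv_sq_le hε ρ) (sq_nonneg _)
    have l2 : ρ ^ 2 * h' ρ ^ 2 ≤ flux ρ * h' ρ ^ 2 :=
      mul_le_mul_of_nonneg_right (sq_le_flux ρ) (sq_nonneg _)
    have l3 : 0 ≤ (ρ * h' ρ + h ρ / 2) ^ 2 := sq_nonneg _
    rw [e1]
    simp only [k']
    rw [e2] at l1 ⊢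
    nlinarith
  have key := integral_mono ((i1.const_mul (-(3 / 4))).sub (ik'.const_mul (1 / 2))) i2 hpt
  simp only [Pi.sub_apply] at key
  rw [integral_sub (i1.const_mul _) (ik'.const_mul _), integral_const_mul, integral_const_mul,
    hk0] at key
  linarith

theorem sphereGrad_const_mul {f : S2 → ℝ} (hf : SmoothSphere f) (c : ℝ) (y : S2) :
    sphereGrad (fun y => c * f y) y = c • sphereGrad f y := by
  have e : homExt (fun y => c * f y) = fun x => c • homExt f x := by
    funext x
    by_cases hx : x = 0
    · simp [homExt, hx]
    · simp [homExt_of_ne _ hx]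
  refine ext_inner_right ℝ fun v => ?_
  rw [inner_sphereGrad, inner_smul_left, inner_sphereGrad, e,
    fderiv_fun_const_smul (hf.differentiableAt (sphere_ne_zero y))]
  simp

theorem dRho_radial_mul {W : ℝ → ℝ} {W' : ℝ} {u : Param → ℝ} (hu : SmoothSupp u) (ρ : ℝ) (y : S2)
    (hW : HasDerivAt W W' ρ) :
    dRho (fun p => W p.1 * u p) (ρ, y) = W' * u (ρ, y) + W ρ * dRho u (ρ, y) :=
  (hW.mul (hu.hasDerivAt_rho ρ y)).deriv

theorem gradInner_wtSq_mul {ε : ℝ} (hε : 0 < ε) {u v : Param → ℝ} (hv : SmoothSupp v) (p : Param) :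
    gradInner u (fun q => wtSq ε q.1 * v q) p =
      (gRho p.1)⁻¹ * (dRho u p * (wtSqDeriv ε p.1 * v p + wtSq ε p.1 * dRho v p)) +
      (jap p.1 ^ 2)⁻¹ * (wtSq ε p.1 * inner ℝ (sphereGrad (fun y => u (p.1, y)) p.2)
        (sphereGrad (fun y => v (p.1, y)) p.2)) := by
  obtain ⟨ρ, y⟩ := p
  rw [gradInner, dRho_radial_mul hv ρ y (hasDerivAt_wtSq hε ρ)]
  simp only
  rw [sphereGrad_const_mul (hv.smoothSphere ρ), inner_smul_right]

theorem sphereCoeff_le_one (ρ : ℝ) : density ρ * (jap ρ ^ 2)⁻¹ ≤ 1 := by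
  have := density_le ρ
  have hs : (0 : ℝ) < 1 + ρ ^ 2 := by positivity
  rw [jap_sq, ← div_eq_mul_inv]
  exact (div_le_one hs).2 this

theorem le_sphereCoeff (ρ : ℝ) : 1 - (1 + ρ ^ 2)⁻¹ ≤ density ρ * (jap ρ ^ 2)⁻¹ := by
  have h1 : (density ρ * (jap ρ ^ 2)⁻¹) ^ 2 = (1 + ρ ^ 2) / (2 + ρ ^ 2) := by
    rw [mul_pow, density_sq, jap_sq]; field_simp
  have h2 : 0 ≤ density ρ * (jap ρ ^ 2)⁻¹ := by
    have := density_pos ρ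
    positivity
  refine abs_le_of_sq_le_sq' ?_ h2 |>.2
  have e : 1 - (1 + ρ ^ 2)⁻¹ = ρ ^ 2 / (1 + ρ ^ 2) := by
    field_simp
    ring
  rw [h1, e, div_pow, div_le_div_iff₀ (by positivity) (by positivity)]
  nlinarith [sq_nonneg ρ, sq_nonneg (ρ ^ 2), pow_nonneg (sq_nonneg ρ) 3]

/-- The zeroth order coefficient that results from Hardy's inequality, the weight, the Poincaré
inequality and the potential tends to `-3 / 4 + 4 / 5 = 1 / 20`; it is positive near infinity. -/
theorem coefficient_ge (ρ : ℝ) :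
    1 / 100 - 300 * ((1 + ρ ^ 2) ^ 2)⁻¹ ≤ -(3 / 4) + 4 / 5 * (density ρ * (jap ρ ^ 2)⁻¹) -
      density ρ * (6 / (1 + ρ ^ 2) ^ 3) := by
  have h1 := le_sphereCoeff ρ
  have hs : (0 : ℝ) < 1 + ρ ^ 2 := by positivity
  have h2 : density ρ * (6 / (1 + ρ ^ 2) ^ 3) ≤ 6 * (1 + ρ ^ 2)⁻¹ ^ 2 := by
    calc density ρ * (6 / (1 + ρ ^ 2) ^ 3) ≤ (1 + ρ ^ 2) * (6 / (1 + ρ ^ 2) ^ 3) :=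
          mul_le_mul_of_nonneg_right (density_le ρ) (by positivity)
      _ = 6 * (1 + ρ ^ 2)⁻¹ ^ 2 := by field_simp
  rw [← inv_pow]
  set t := (1 + ρ ^ 2)⁻¹
  nlinarith [sq_nonneg (t - 1 / 700)]

theorem pi_sq_le : Real.pi ^ 2 ≤ 10 := by
  have h1 := Real.pi_lt_d2
  have h2 := Real.pi_pos
  nlinarith

/-- The Poincaré inequality with the constant rounded by `π² / 8 ≤ 5 / 4`. -/
theorem poincare_slice {f : S2 → ℝ} (hf : SmoothSphere f) :
    4 / 5 * ∫ y, f y ^ 2 ∂sph - (sph.real Set.univ)⁻¹ * (∫ y, f y ∂sph) ^ 2 ≤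
      ∫ y, ‖sphereGrad f y‖ ^ 2 ∂sph := by
  have h := poincare_sphere hf
  have hT := sph_univ_pos
  have hG : 0 ≤ ∫ y, ‖sphereGrad f y‖ ^ 2 ∂sph := integral_nonneg fun y => sq_nonneg _
  set T := sph.real Set.univ
  set A := ∫ y, f y ^ 2 ∂sph
  set m := ∫ y, f y ∂sph
  set G := ∫ y, ‖sphereGrad f y‖ ^ 2 ∂sph
  have h1 : Real.pi ^ 2 / 8 * T * G ≤ 10 / 8 * T * G := by
    have := pi_sq_le
    gcongr
  have h2 : T * (4 / 5 * A - T⁻¹ * m ^ 2) ≤ T * G := by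
    have e : T * (T⁻¹ * m ^ 2) = m ^ 2 := by field_simp
    rw [mul_sub, e]
    nlinarith [sq_nonneg m]
  exact le_of_mul_le_mul_left h2 hT

/-- The quadratic form of `-H`, tested with `w² u`, controls the weighted `L²` norm, uniformly in
`ε`, up to a lower order term and the spherical means. -/
theorem coercivity {ε : ℝ} (hε : 0 < ε) {u : Param → ℝ} (hu : SmoothSupp u) :
    1 / 100 * ∫ p, wtSq ε p.1 * u p ^ 2 ∂prodMeas ≤
      ∫ p, (gradInner u (fun q => wtSq ε q.1 * u q) p -
        6 / (1 + p.1 ^ 2) ^ 3 * (u p * (wtSq ε p.1 * u p))) ∂vol +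
      300 * ∫ p, (1 + p.1 ^ 2)⁻¹ * u p ^ 2 ∂prodMeas +
      (sph.real Set.univ)⁻¹ * ∫ ρ, wtSq ε ρ * (∫ y, u (ρ, y) ∂sph) ^ 2 := by
  obtain ⟨R, hR⟩ := hu.supp
  have hW := contDiff_wtSq hε
  have hWc := hW.continuous.comp (continuous_fst (X := ℝ) (Y := S2))
  have hWd : Continuous (wtSqDeriv ε) := by
    have := continuous_wt hε
    have := continuous_wtDeriv hε
    unfold wtSqDeriv; fun_prop
  have hWdc := hWd.comp (continuous_fst (X := ℝ) (Y := S2))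
  have hqc := continuous_sphereCoeff.comp (continuous_fst (X := ℝ) (Y := S2))
  have hfc := contDiff_flux.continuous.comp (continuous_fst (X := ℝ) (Y := S2))
  have hpc := continuous_potential.comp (continuous_fst (X := ℝ) (Y := S2))
  have hsc : Continuous fun p : Param => (1 + p.1 ^ 2)⁻¹ :=
    Continuous.inv₀ (by fun_prop) fun p => by positivity
  have huc := hu.continuous
  let A : Param → ℝ := fun p =>
    flux p.1 * (dRho u p * (wtSqDeriv ε p.1 * u p + wtSq ε p.1 * dRho u p))
  let B : Param → ℝ := fun p => density p.1 * (jap p.1 ^ 2)⁻¹ * wtSq ε p.1 *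
    ‖sphereGrad (fun y => u (p.1, y)) p.2‖ ^ 2
  let C : Param → ℝ := fun p => density p.1 * (6 / (1 + p.1 ^ 2) ^ 3) * (wtSq ε p.1 * u p ^ 2)
  let D : Param → ℝ := fun p => wtSq ε p.1 * u p ^ 2
  let S : Param → ℝ := fun p => (1 + p.1 ^ 2)⁻¹ * u p ^ 2
  let Q : Param → ℝ := fun p => density p.1 * (jap p.1 ^ 2)⁻¹ * (wtSq ε p.1 * u p ^ 2)
  have iA : Integrable A prodMeas := integrable_prodMeas
    (hfc.mul (hu.dRho.continuous.mul ((hWdc.mul huc).add (hWc.mul hu.dRho.continuous))))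
    ⟨R, fun ρ y h => by simp [A, SmoothSupp.dRho_vanish hR ρ y h]⟩
  have iB : Integrable B prodMeas := integrable_prodMeas
    ((hqc.mul hWc).mul (hu.continuous_sphereGrad.norm.pow 2))
    ⟨R, fun ρ y h => by simp [B, sphereGrad_vanish hR ρ y h]⟩
  have iC : Integrable C prodMeas := integrable_prodMeas
    (hpc.mul (hWc.mul (huc.pow 2))) ⟨R, fun ρ y h => by simp [C, hR ρ y h]⟩
  have iD : Integrable D prodMeas := integrable_prodMeas
    (hWc.mul (huc.pow 2)) ⟨R, fun ρ y h => by simp [D, hR ρ y h]⟩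
  have iS : Integrable S prodMeas := integrable_prodMeas
    (hsc.mul (huc.pow 2)) ⟨R, fun ρ y h => by simp [S, hR ρ y h]⟩
  have iQ : Integrable Q prodMeas := integrable_prodMeas
    (hqc.mul (hWc.mul (huc.pow 2))) ⟨R, fun ρ y h => by simp [Q, hR ρ y h]⟩
  have e1 : ∫ p, (gradInner u (fun q => wtSq ε q.1 * u q) p -
        6 / (1 + p.1 ^ 2) ^ 3 * (u p * (wtSq ε p.1 * u p))) ∂vol =
      ∫ p, A p ∂prodMeas + ∫ p, B p ∂prodMeas - ∫ p, C p ∂prodMeas := by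
    rw [integral_vol, ← integral_add iA iB, ← integral_sub (by exact iA.add iB) iC]
    refine integral_congr_ae (.of_forall fun p => ?_)
    simp only [A, B, C, gradInner_wtSq_mul hε hu, flux, real_inner_self_eq_norm_sq]
    ring
  have hA : -(3 / 4) * ∫ p, D p ∂prodMeas ≤ ∫ p, A p ∂prodMeas := by
    rw [integral_prod_symm _ iA, integral_prod_symm _ iD, ← integral_const_mul]
    refine integral_mono (iD.integral_prod_right.const_mul _) iA.integral_prod_right fun y => ?_
    exact radial_energy_ge hε (fun ρ => hu.hasDerivAt_rho ρ y) (hu.dRho.contDiff_rho y).continuous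
      (fun ρ h => hR ρ y h) fun ρ h => SmoothSupp.dRho_vanish hR ρ y h
  have iM : Integrable fun ρ => wtSq ε ρ * (∫ y, u (ρ, y) ∂sph) ^ 2 := by
    refine integrable_of_vanish (hW.continuous.mul (Continuous.pow ?_ 2)) ⟨R, fun ρ h => ?_⟩
    · exact continuous_parametric_integral_of_continuous (μ := sph) (f := fun ρ y => u (ρ, y))
        (s := Set.univ) (by simpa [Function.uncurry_def] using huc) isCompact_univ |>.congr
        fun ρ => by simp
    · simp [hR _ _ h]
  have hB : 4 / 5 * ∫ p, Q p ∂prodMeas -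
      (sph.real Set.univ)⁻¹ * ∫ ρ, wtSq ε ρ * (∫ y, u (ρ, y) ∂sph) ^ 2 ≤ ∫ p, B p ∂prodMeas := by
    rw [integral_prod _ iB, integral_prod _ iQ, ← integral_const_mul, ← integral_const_mul,
      ← integral_sub (iQ.integral_prod_left.const_mul _) (iM.const_mul _)]
    refine integral_mono ((iQ.integral_prod_left.const_mul _).sub (iM.const_mul _))
      iB.integral_prod_left fun ρ => ?_
    simp only [B, Q]
    rw [integral_const_mul, integral_const_mul, integral_const_mul]
    have h1 := poincare_slice (hu.smoothSphere ρ)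
    have h2 := sphereCoeff_le_one ρ
    have h3 : 0 ≤ density ρ * (jap ρ ^ 2)⁻¹ := by
      have := density_pos ρ
      positivity
    have h4 := wtSq_nonneg ε ρ
    have h5 := inv_pos.2 sph_univ_pos
    generalize density ρ * (jap ρ ^ 2)⁻¹ = q at h2 h3 ⊢
    generalize wtSq ε ρ = w at h4 ⊢
    have h6 : 0 ≤ (sph.real Set.univ)⁻¹ * (∫ y, u (ρ, y) ∂sph) ^ 2 := by positivity
    have h7 := mul_le_mul_of_nonneg_left h1 (mul_nonneg h3 h4)
    have h8 : q * w * ((sph.real Set.univ)⁻¹ * (∫ y, u (ρ, y) ∂sph) ^ 2) ≤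
        w * ((sph.real Set.univ)⁻¹ * (∫ y, u (ρ, y) ∂sph) ^ 2) :=
      mul_le_mul_of_nonneg_right (mul_le_of_le_one_left h4 h2) h6
    linarith
  have hfin : 1 / 100 * ∫ p, D p ∂prodMeas - 300 * ∫ p, S p ∂prodMeas ≤
      -(3 / 4) * ∫ p, D p ∂prodMeas + 4 / 5 * ∫ p, Q p ∂prodMeas - ∫ p, C p ∂prodMeas := by
    rw [← integral_const_mul, ← integral_const_mul, ← integral_const_mul, ← integral_const_mul,
      ← integral_sub (iD.const_mul _) (iS.const_mul _),
      ← integral_add (iD.const_mul _) (iQ.const_mul _),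
      ← integral_sub (by exact (iD.const_mul _).add (iQ.const_mul _)) iC]
    refine integral_mono ((iD.const_mul _).sub (iS.const_mul _))
      (((iD.const_mul _).add (iQ.const_mul _)).sub iC) fun p => ?_
    simp only [D, S, Q, C]
    have h1 := mul_le_mul_of_nonneg_right (coefficient_ge p.1)
      (mul_nonneg (wtSq_nonneg ε p.1) (sq_nonneg (u p)))
    have h2 : ((1 + p.1 ^ 2) ^ 2)⁻¹ * wtSq ε p.1 ≤ (1 + p.1 ^ 2)⁻¹ := by
      calc ((1 + p.1 ^ 2) ^ 2)⁻¹ * wtSq ε p.1 ≤ ((1 + p.1 ^ 2) ^ 2)⁻¹ * (1 + p.1 ^ 2) :=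
            mul_le_mul_of_nonneg_left (wtSq_le hε p.1) (by positivity)
        _ = (1 + p.1 ^ 2)⁻¹ := by field_simp
    have h3 := mul_le_mul_of_nonneg_right h2 (sq_nonneg (u p))
    linarith
  rw [e1]
  linarith

/-! ### Consequences of the local energy norm -/

theorem eLpNorm_two_sq {α : Type*} [MeasurableSpace α] (μ : Measure α) (f : α → ℝ) :
    eLpNorm f 2 μ ^ 2 = ∫⁻ x, ENNReal.ofReal (f x ^ 2) ∂μ := by
  have h := eLpNorm_nnreal_pow_eq_lintegral (μ := μ) (f := f) (p := 2) two_ne_zero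
  simp only [NNReal.coe_ofNat, ENNReal.rpow_ofNat, ENNReal.coe_ofNat] at h
  rw [h]
  refine lintegral_congr fun x => ?_
  rw [Real.enorm_eq_ofReal_abs, ← ENNReal.ofReal_pow (abs_nonneg _), sq_abs]

theorem lintegral_annulus_le (F : Param → ℝ) (j : ℕ) :
    ∫⁻ p in annulus j, ENNReal.ofReal ((jap p.1)⁻¹ * F p ^ 2) ∂vol ≤ leNorm F ^ 2 := by
  have h1 : eLpNorm (fun p : Param => (jap p.1) ^ (-(1 / 2) : ℝ) * F p) 2
      (vol.restrict (annulus j)) ≤ leNorm F :=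
    le_iSup (fun j : ℕ => eLpNorm (fun p : Param => (jap p.1) ^ (-(1 / 2) : ℝ) * F p) 2
      (vol.restrict (annulus j))) j
  refine le_trans (le_of_eq ?_) (pow_le_pow_left' h1 2)
  rw [eLpNorm_two_sq]
  refine lintegral_congr fun p => ?_
  congr 1
  have hp := jap_pos p.1
  have : ((jap p.1) ^ (-(1 / 2) : ℝ)) ^ 2 = (jap p.1)⁻¹ := by
    rw [← Real.rpow_natCast, ← Real.rpow_mul hp.le, ← Real.rpow_neg_one]
    norm_num
  rw [mul_pow, this]

theorem measurableSet_annulus (j : ℕ) : MeasurableSet (annulus j) := by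
  have h : Measurable fun p : Param => jap p.1 := (continuous_jap.comp continuous_fst).measurable
  exact (measurableSet_le measurable_const h).inter (measurableSet_lt h measurable_const)

theorem iUnion_annulus : ⋃ j, annulus j = Set.univ := by
  refine Set.eq_univ_of_forall fun p => ?_
  obtain ⟨n, hn⟩ := exists_nat_pow_near (one_le_jap p.1) (y := (2 : ℝ)) one_lt_two
  exact Set.mem_iUnion.2 ⟨n, hn⟩

/-- Summing the geometric series over the dyadic regions. -/
theorem lintegral_le_leNorm (F : Param → ℝ) :
    ∫⁻ p, ENNReal.ofReal ((1 + p.1 ^ 2)⁻¹ * F p ^ 2) ∂vol ≤ 2 * leNorm F ^ 2 := by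
  have hj (j : ℕ) : ∫⁻ p in annulus j, ENNReal.ofReal ((1 + p.1 ^ 2)⁻¹ * F p ^ 2) ∂vol ≤
      (2⁻¹ : ENNReal) ^ j * leNorm F ^ 2 := by
    have h2 : ((2⁻¹ : ENNReal) ^ j) = ENNReal.ofReal ((2 ^ j)⁻¹) := by
      rw [ENNReal.ofReal_inv_of_pos (by positivity), ENNReal.ofReal_pow (by norm_num),
        ENNReal.ofReal_ofNat, ENNReal.inv_pow]
    refine le_trans ?_ (mul_le_mul_right (lintegral_annulus_le F j) _)
    rw [h2, ← lintegral_const_mul' _ _ ENNReal.ofReal_ne_top]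
    refine setLIntegral_mono' (measurableSet_annulus j) fun p hp => ?_
    rw [← ENNReal.ofReal_mul (by positivity)]
    refine ENNReal.ofReal_le_ofReal ?_
    rw [← mul_assoc, ← jap_sq, sq (jap p.1), mul_inv]
    have h3 := jap_pos p.1
    have h4 : (jap p.1)⁻¹ ≤ (2 ^ j)⁻¹ := inv_anti₀ (by positivity) hp.1
    gcongr
  calc ∫⁻ p, ENNReal.ofReal ((1 + p.1 ^ 2)⁻¹ * F p ^ 2) ∂vol
      = ∫⁻ p in ⋃ j, annulus j, ENNReal.ofReal ((1 + p.1 ^ 2)⁻¹ * F p ^ 2) ∂vol := by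
        rw [iUnion_annulus, Measure.restrict_univ]
    _ ≤ ∑' j, ∫⁻ p in annulus j, ENNReal.ofReal ((1 + p.1 ^ 2)⁻¹ * F p ^ 2) ∂vol :=
        lintegral_iUnion_le _ _
    _ ≤ ∑' j, (2⁻¹ : ENNReal) ^ j * leNorm F ^ 2 := ENNReal.tsum_le_tsum hj
    _ = 2 * leNorm F ^ 2 := by rw [ENNReal.tsum_mul_right, ENNReal.tsum_geometric_two]

theorem continuous_inv_one_add_sq : Continuous fun p : Param => (1 + p.1 ^ 2)⁻¹ :=
  Continuous.inv₀ (by fun_prop) fun p => by positivity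

theorem lintegral_prodMeas_le_leNorm {f : Param → ℝ} (hf : AEMeasurable f prodMeas) :
    ∫⁻ p, ENNReal.ofReal ((1 + p.1 ^ 2)⁻¹ * f p ^ 2) ∂prodMeas ≤
      4 * leNorm (fun p => (jap p.1)⁻¹ * f p) ^ 2 := by
  have h1 := lintegral_le_leNorm fun p => (jap p.1)⁻¹ * f p
  have hj : Measurable fun p : Param => jap p.1 := (continuous_jap.comp continuous_fst).measurable
  have hm : AEMeasurable (fun p : Param => (1 + p.1 ^ 2)⁻¹ * ((jap p.1)⁻¹ * f p) ^ 2) prodMeas :=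
    continuous_inv_one_add_sq.aemeasurable.mul ((hj.inv.aemeasurable.mul hf).pow_const 2)
  rw [lintegral_vol hm.ennreal_ofReal] at h1
  have h2 : ∫⁻ p, ENNReal.ofReal ((1 + p.1 ^ 2)⁻¹ * f p ^ 2) ∂prodMeas ≤
      2 * ∫⁻ p, ENNReal.ofReal (density p.1) *
        ENNReal.ofReal ((1 + p.1 ^ 2)⁻¹ * ((jap p.1)⁻¹ * f p) ^ 2) ∂prodMeas := by
    rw [← lintegral_const_mul' _ _ ENNReal.ofNat_ne_top]
    refine lintegral_mono fun p => ?_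
    rw [← ENNReal.ofReal_mul (density_pos _).le, ← ENNReal.ofReal_ofNat,
      ← ENNReal.ofReal_mul zero_le_two]
    refine ENNReal.ofReal_le_ofReal ?_
    have hs : (0 : ℝ) < 1 + p.1 ^ 2 := by positivity
    have hd := le_density p.1
    rw [mul_pow, inv_pow, jap_sq]
    have e : (1 + p.1 ^ 2)⁻¹ * f p ^ 2 =
        2 * ((1 + p.1 ^ 2) / 2 * ((1 + p.1 ^ 2)⁻¹ * ((1 + p.1 ^ 2)⁻¹ * f p ^ 2))) := by
      field_simp
    refine e.le.trans ?_
    gcongr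
  calc _ ≤ _ := h2
    _ ≤ 2 * (2 * leNorm (fun p => (jap p.1)⁻¹ * f p) ^ 2) := by gcongr
    _ = _ := by rw [← mul_assoc]; norm_num

theorem integrable_of_lintegral_lt_top {α : Type*} [MeasurableSpace α] {μ : Measure α} {f : α → ℝ}
    (hf : AEStronglyMeasurable f μ) (h0 : ∀ x, 0 ≤ f x)
    (h : ∫⁻ x, ENNReal.ofReal (f x) ∂μ < ⊤) : Integrable f μ :=
  ⟨hf, (hasFiniteIntegral_iff_ofReal (.of_forall h0)).2 h⟩

theorem SmoothSupp.integrable_weighted_sq {u : Param → ℝ} (hu : SmoothSupp u) :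
    Integrable (fun p => (1 + p.1 ^ 2)⁻¹ * u p ^ 2) prodMeas := by
  obtain ⟨R, hR⟩ := hu.supp
  exact integrable_prodMeas (continuous_inv_one_add_sq.mul (hu.continuous.pow 2))
    ⟨R, fun ρ y h => by simp [hR ρ y h]⟩

/-- The weighted `L²` consequences of membership in the local energy space. Since `|g|^(1/2)` is
comparable to `⟨ρ⟩²`, the zeroth order part is stated with respect to `dρ dω`. -/
structure Approximates (u : ℕ → Param → ℝ) (φ : Param → ℝ) : Prop where
  test : ∀ n, IsTest (u n)
  meas : AEStronglyMeasurable φ prodMeas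
  integrable_sq : Integrable (fun p => (1 + p.1 ^ 2)⁻¹ * φ p ^ 2) prodMeas
  integrable_sub_sq : ∀ n, Integrable (fun p => (1 + p.1 ^ 2)⁻¹ * (u n p - φ p) ^ 2) prodMeas
  tendsto : Tendsto (fun n => ∫ p, (1 + p.1 ^ 2)⁻¹ * (u n p - φ p) ^ 2 ∂prodMeas) atTop (𝓝 0)
  cauchy : Tendsto (fun nm : ℕ × ℕ => ∫ p, (1 + p.1 ^ 2)⁻¹ *
    gradSq (fun q => u nm.1 q - u nm.2 q) p ∂vol) atTop (𝓝 0)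

theorem gradSq_nonneg (u : Param → ℝ) (p : Param) : 0 ≤ gradSq u p := by
  have := gRho_pos p.1
  unfold gradSq
  positivity

theorem SmoothSupp.continuous_gradSq {u : Param → ℝ} (hu : SmoothSupp u) : Continuous (gradSq u) :=
  (hu.continuous_gradInner hu).congr fun p => gradInner_self u p

theorem integrable_vol_iff {f : Param → ℝ} :
    Integrable f vol ↔ Integrable (fun p => density p.1 * f p) prodMeas := by
  rw [vol_eq, integrable_withDensity_iff_integrable_smul' measurable_density_fst
    (.of_forall fun p => ENNReal.ofReal_lt_top)]
  simp only [ENNReal.toReal_ofReal (density_pos _).le, smul_eq_mul]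

theorem integrable_vol {f : Param → ℝ} (hf : Continuous f)
    (hv : ∃ R : ℝ, ∀ ρ y, R < |ρ| → f (ρ, y) = 0) : Integrable f vol := by
  obtain ⟨R, hR⟩ := hv
  exact integrable_vol_iff.2 (integrable_prodMeas
    ((contDiff_density.continuous.comp continuous_fst).mul hf) ⟨R, fun ρ y h => by simp [hR ρ y h]⟩)

theorem approximates_of_leNorm {φ : Param → ℝ} {u : ℕ → Param → ℝ} (hφ : AEStronglyMeasurable φ vol)
    (hu : ∀ n, IsTest (u n))
    (h1 : Tendsto (fun n => leNorm fun p => (jap p.1)⁻¹ * (u n p - φ p)) atTop (𝓝 0))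
    (h2 : Tendsto (fun nm : ℕ × ℕ => leNorm fun p =>
      Real.sqrt (gradSq (fun q => u nm.1 q - u nm.2 q) p)) atTop (𝓝 0)) :
    Approximates u φ := by
  have hm : AEStronglyMeasurable φ prodMeas := hφ.mono_ac prodMeas_ac_vol
  have hum (n : ℕ) : AEStronglyMeasurable (fun p => u n p - φ p) prodMeas :=
    (hu n).smoothSupp.continuous.aestronglyMeasurable.sub hm
  have hwm (n : ℕ) : AEStronglyMeasurable (fun p => (1 + p.1 ^ 2)⁻¹ * (u n p - φ p) ^ 2) prodMeas :=
    continuous_inv_one_add_sq.aestronglyMeasurable.mul ((hum n).pow 2)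
  have hb (n : ℕ) := lintegral_prodMeas_le_leNorm (hum n).aemeasurable
  have hnn (n : ℕ) (p : Param) : 0 ≤ (1 + p.1 ^ 2)⁻¹ * (u n p - φ p) ^ 2 := by positivity
  have ht : Tendsto (fun n => ∫⁻ p, ENNReal.ofReal ((1 + p.1 ^ 2)⁻¹ * (u n p - φ p) ^ 2) ∂prodMeas)
      atTop (𝓝 0) := by
    refine tendsto_of_tendsto_of_tendsto_of_le_of_le tendsto_const_nhds ?_ (fun _ => zero_le) hb
    have h3 := ENNReal.Tendsto.const_mul (a := 4)
      (((ENNReal.continuous_pow 2).tendsto 0).comp h1) (Or.inr ENNReal.ofNat_ne_top)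
    simpa using h3
  have hisq : Integrable (fun p => (1 + p.1 ^ 2)⁻¹ * φ p ^ 2) prodMeas := by
    obtain ⟨n, hn⟩ := (ht.eventually_lt_const ENNReal.zero_lt_top).exists
    have i1 : Integrable (fun p => (1 + p.1 ^ 2)⁻¹ * (u n p - φ p) ^ 2) prodMeas :=
      integrable_of_lintegral_lt_top (hwm n) (hnn n) hn
    refine ((i1.const_mul 2).add ((hu n).smoothSupp.integrable_weighted_sq.const_mul 2)).mono'
      (continuous_inv_one_add_sq.aestronglyMeasurable.mul (hm.pow 2)) (.of_forall fun p => ?_)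
    have hs : (0 : ℝ) < (1 + p.1 ^ 2)⁻¹ := by positivity
    rw [Real.norm_of_nonneg (by positivity)]
    simp only [Pi.add_apply]
    nlinarith [mul_nonneg hs.le (sq_nonneg (2 * u n p - φ p))]
  have hisub (n : ℕ) : Integrable (fun p => (1 + p.1 ^ 2)⁻¹ * (u n p - φ p) ^ 2) prodMeas := by
    refine ((hisq.const_mul 2).add ((hu n).smoothSupp.integrable_weighted_sq.const_mul 2)).mono'
      (hwm n) (.of_forall fun p => ?_)
    have hs : (0 : ℝ) < (1 + p.1 ^ 2)⁻¹ := by positivity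
    rw [Real.norm_of_nonneg (by positivity)]
    simp only [Pi.add_apply]
    nlinarith [mul_nonneg hs.le (sq_nonneg (u n p + φ p))]
  refine ⟨hu, hm, hisq, hisub, ?_, ?_⟩
  · have := (ENNReal.tendsto_toReal ENNReal.zero_ne_top).comp ht
    refine this.congr fun n => ?_
    exact (integral_eq_lintegral_of_nonneg_ae (.of_forall (hnn n)) (hwm n)).symm
  · have hk (nm : ℕ × ℕ) : SmoothSupp fun q => u nm.1 q - u nm.2 q :=
      ((hu nm.1).sub (hu nm.2)).smoothSupp
    have hg (nm : ℕ × ℕ) :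
        ∫⁻ p, ENNReal.ofReal ((1 + p.1 ^ 2)⁻¹ * gradSq (fun q => u nm.1 q - u nm.2 q) p) ∂vol ≤
          2 * leNorm (fun p => Real.sqrt (gradSq (fun q => u nm.1 q - u nm.2 q) p)) ^ 2 := by
      have := lintegral_le_leNorm fun p => Real.sqrt (gradSq (fun q => u nm.1 q - u nm.2 q) p)
      simpa only [Real.sq_sqrt (gradSq_nonneg _ _)] using this
    have ht2 : Tendsto (fun nm : ℕ × ℕ => ∫⁻ p, ENNReal.ofReal ((1 + p.1 ^ 2)⁻¹ *
        gradSq (fun q => u nm.1 q - u nm.2 q) p) ∂vol) atTop (𝓝 0) := by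
      refine tendsto_of_tendsto_of_tendsto_of_le_of_le tendsto_const_nhds ?_ (fun _ => zero_le) hg
      have h3 := ENNReal.Tendsto.const_mul (a := 2)
        (((ENNReal.continuous_pow 2).tendsto 0).comp h2) (Or.inr ENNReal.ofNat_ne_top)
      simpa using h3
    have := (ENNReal.tendsto_toReal ENNReal.zero_ne_top).comp ht2
    refine this.congr fun nm => ?_
    refine (integral_eq_lintegral_of_nonneg_ae (.of_forall fun p => ?_) ?_).symm
    · have := gradSq_nonneg (fun q => u nm.1 q - u nm.2 q) p
      simp only [Pi.zero_apply]
      positivity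
    · exact (continuous_inv_one_add_sq.mul (hk nm).continuous_gradSq).aestronglyMeasurable

/-! ### The weighted form along the approximations -/

theorem sq_integral_mul_le {α : Type*} [MeasurableSpace α] {μ : Measure α} {f g : α → ℝ}
    (hf : Integrable (fun x => f x ^ 2) μ) (hg : Integrable (fun x => g x ^ 2) μ)
    (hfg : Integrable (fun x => f x * g x) μ) :
    (∫ x, f x * g x ∂μ) ^ 2 ≤ (∫ x, f x ^ 2 ∂μ) * ∫ x, g x ^ 2 ∂μ := by
  have h (t : ℝ) : 0 ≤ (∫ x, f x ^ 2 ∂μ) * (t * t) + (2 * ∫ x, f x * g x ∂μ) * t +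
      ∫ x, g x ^ 2 ∂μ := by
    have h1 : 0 ≤ ∫ x, (t * f x + g x) ^ 2 ∂μ := integral_nonneg fun x => sq_nonneg _
    have e : (fun x => (t * f x + g x) ^ 2) =
        fun x => (t * t) * f x ^ 2 + (2 * t) * (f x * g x) + g x ^ 2 := by
      funext x; ring
    rw [e, integral_add (by exact (hf.const_mul _).add (hfg.const_mul _)) hg,
      integral_add (hf.const_mul _) (hfg.const_mul _), integral_const_mul, integral_const_mul] at h1
    linarith
  have := discrim_le_zero h
  rw [discrim] at this
  linarith

/-- The density of the weighted energy `∫ ⟨ρ⟩⁻² |∇u|² + ⟨ρ⟩⁻⁴ u²`. -/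
def energyDensity (u : Param → ℝ) (p : Param) : ℝ :=
  (1 + p.1 ^ 2)⁻¹ * gradSq u p + ((1 + p.1 ^ 2) ^ 2)⁻¹ * u p ^ 2

/-- The weighted energy. Its square root is controlled by the norm of the local energy space. -/
def energy (u : Param → ℝ) : ℝ := ∫ p, energyDensity u p ∂vol

theorem energyDensity_nonneg (u : Param → ℝ) (p : Param) : 0 ≤ energyDensity u p := by
  have := gradSq_nonneg u p
  unfold energyDensity
  positivity

theorem energy_nonneg (u : Param → ℝ) : 0 ≤ energy u :=
  integral_nonneg fun p => energyDensity_nonneg u p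

theorem gradSq_vanish {u : Param → ℝ} {R : ℝ} (hR : ∀ ρ y, R < |ρ| → u (ρ, y) = 0) (ρ : ℝ)
    (y : S2) (h : R < |ρ|) : gradSq u (ρ, y) = 0 := by
  rw [← gradInner_self, gradInner_vanish hR ρ y h]

theorem SmoothSupp.continuous_energyDensity {u : Param → ℝ} (hu : SmoothSupp u) :
    Continuous (energyDensity u) := by
  have h := continuous_inv_one_add_sq
  have h2 : Continuous fun p : Param => ((1 + p.1 ^ 2) ^ 2)⁻¹ :=
    Continuous.inv₀ (by fun_prop) fun p => by positivity
  exact (h.mul hu.continuous_gradSq).add (h2.mul (hu.continuous.pow 2))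

theorem energyDensity_vanish {u : Param → ℝ} {R : ℝ} (hR : ∀ ρ y, R < |ρ| → u (ρ, y) = 0) (ρ : ℝ)
    (y : S2) (h : R < |ρ|) : energyDensity u (ρ, y) = 0 := by
  simp [energyDensity, gradSq_vanish hR ρ y h, hR ρ y h]

theorem SmoothSupp.integrable_energyDensity {u : Param → ℝ} (hu : SmoothSupp u) :
    Integrable (energyDensity u) vol := by
  obtain ⟨R, hR⟩ := hu.supp
  exact integrable_vol hu.continuous_energyDensity ⟨R, energyDensity_vanish hR⟩

theorem wtSqDeriv_sq_le {ε : ℝ} (hε : 0 < ε) (ρ : ℝ) :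
    wtSqDeriv ε ρ ^ 2 ≤ 4 * ((ε ^ 2)⁻¹) ^ 2 * ((1 + ρ ^ 2)⁻¹) ^ 3 := by
  have h1 := wtDeriv_sq_le hε ρ
  have h2 := wtSq_le_inv hε ρ
  have h0 := wtSq_nonneg ε ρ
  have h3 : ρ ^ 2 / (1 + ρ ^ 2) ^ 2 ≤ (1 + ρ ^ 2)⁻¹ := by
    rw [← one_div, div_le_div_iff₀ (by positivity) (by positivity)]
    nlinarith [sq_nonneg ρ]
  have e : wtSqDeriv ε ρ ^ 2 = 4 * (wtSq ε ρ * wtDeriv ε ρ ^ 2) := by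
    rw [wtSqDeriv, ← wt_sq]; ring
  rw [e]
  calc 4 * (wtSq ε ρ * wtDeriv ε ρ ^ 2)
      ≤ 4 * (wtSq ε ρ * (ρ ^ 2 / (1 + ρ ^ 2) ^ 2 * wtSq ε ρ)) := by gcongr
    _ ≤ 4 * (((ε ^ 2)⁻¹ * (1 + ρ ^ 2)⁻¹) * ((1 + ρ ^ 2)⁻¹ * ((ε ^ 2)⁻¹ * (1 + ρ ^ 2)⁻¹))) := by
        gcongr
    _ = _ := by ring

/-- The algebra behind `abs_form_le`: `a`, `c` stand for radial derivatives, `x`, `y` for the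
lengths of spherical gradients and `z` for their inner product, `k`, `v` for values, `t` for
`⟨ρ⟩⁻²`. -/
theorem abs_form_le_real {a c k v r t K W W' x y z P ek ev : ℝ} (ht0 : 0 < t) (ht1 : t ≤ 1)
    (hr0 : 0 < r) (hr : r ≤ 2) (hK : 0 < K) (h0 : 0 ≤ W) (h1 : W ≤ K * t)
    (h2 : W' ^ 2 ≤ 4 * K ^ 2 * t ^ 3) (hz : |z| ≤ x * y) (hP0 : 0 ≤ P) (hP2 : P ^ 2 = ek * ev)
    (dk : ek = t * (r * a ^ 2 + t * x ^ 2) + t ^ 2 * k ^ 2)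
    (dv : ev = t * (r * c ^ 2 + t * y ^ 2) + t ^ 2 * v ^ 2) :
    |r * (a * (W' * v + W * c)) + t * (W * z) - 6 * t ^ 3 * (k * (W * v))| ≤ 11 * K * P := by
  have n1 : 0 ≤ t * (r * a ^ 2) := by positivity
  have n2 : 0 ≤ t * (t * x ^ 2) := by positivity
  have n3 : 0 ≤ t ^ 2 * k ^ 2 := by positivity
  have m1 : 0 ≤ t * (r * c ^ 2) := by positivity
  have m2 : 0 ≤ t * (t * y ^ 2) := by positivity
  have m3 : 0 ≤ t ^ 2 * v ^ 2 := by positivity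
  have hek : 0 ≤ ek := by rw [dk]; positivity
  have hev : 0 ≤ ev := by rw [dv]; positivity
  have k1 : t * (r * a ^ 2) ≤ ek := by linarith
  have k2 : t * (t * x ^ 2) ≤ ek := by linarith
  have k3 : t ^ 2 * k ^ 2 ≤ ek := by linarith
  have v1 : t * (r * c ^ 2) ≤ ev := by linarith
  have v2 : t * (t * y ^ 2) ≤ ev := by linarith
  have v3 : t ^ 2 * v ^ 2 ≤ ev := by linarith
  have hW2 : W ^ 2 ≤ (K * t) ^ 2 := pow_le_pow_left₀ h0 h1 2
  have hee : 0 ≤ K ^ 2 * (ek * ev) := by positivity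
  have b1 : |r * (a * (W' * v))| ≤ 3 * K * P := by
    refine abs_le_of_sq_le_sq ?_ (by positivity)
    calc (r * (a * (W' * v))) ^ 2 = r ^ 2 * a ^ 2 * v ^ 2 * W' ^ 2 := by ring
      _ ≤ r ^ 2 * a ^ 2 * v ^ 2 * (4 * K ^ 2 * t ^ 3) :=
        mul_le_mul_of_nonneg_left h2 (by positivity)
      _ = 4 * K ^ 2 * ((t * (r * a ^ 2)) * (t ^ 2 * v ^ 2)) * r := by ring
      _ ≤ 4 * K ^ 2 * (ek * ev) * 2 := by
        have := mul_le_mul k1 v3 m3 hek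
        have h5 := mul_le_mul_of_nonneg_left this (by positivity : 0 ≤ 4 * K ^ 2)
        exact mul_le_mul h5 hr hr0.le (by positivity)
      _ ≤ (3 * K * P) ^ 2 := by
        rw [mul_pow, mul_pow, hP2]
        linarith
  have b2 : |r * (a * (W * c))| ≤ K * P := by
    refine abs_le_of_sq_le_sq ?_ (by positivity)
    calc (r * (a * (W * c))) ^ 2 = r ^ 2 * a ^ 2 * c ^ 2 * W ^ 2 := by ring
      _ ≤ r ^ 2 * a ^ 2 * c ^ 2 * (K * t) ^ 2 := mul_le_mul_of_nonneg_left hW2 (by positivity)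
      _ = K ^ 2 * ((t * (r * a ^ 2)) * (t * (r * c ^ 2))) := by ring
      _ ≤ K ^ 2 * (ek * ev) :=
        mul_le_mul_of_nonneg_left (mul_le_mul k1 v1 m1 hek) (by positivity)
      _ = (K * P) ^ 2 := by rw [mul_pow, hP2]
  have b3 : |t * (W * z)| ≤ K * P := by
    have hXY2 : z ^ 2 ≤ (x * y) ^ 2 := by
      rw [← sq_abs]
      exact pow_le_pow_left₀ (abs_nonneg _) hz 2
    refine abs_le_of_sq_le_sq ?_ (by positivity)
    calc (t * (W * z)) ^ 2 = t ^ 2 * (W ^ 2 * z ^ 2) := by ring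
      _ ≤ t ^ 2 * ((K * t) ^ 2 * (x * y) ^ 2) :=
        mul_le_mul_of_nonneg_left (mul_le_mul hW2 hXY2 (sq_nonneg _) (sq_nonneg _)) (sq_nonneg _)
      _ = K ^ 2 * ((t * (t * x ^ 2)) * (t * (t * y ^ 2))) := by ring
      _ ≤ K ^ 2 * (ek * ev) :=
        mul_le_mul_of_nonneg_left (mul_le_mul k2 v2 m2 hek) (by positivity)
      _ = (K * P) ^ 2 := by rw [mul_pow, hP2]
  have b4 : |6 * t ^ 3 * (k * (W * v))| ≤ 6 * K * P := by
    refine abs_le_of_sq_le_sq ?_ (by positivity)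
    have ht4 : t ^ 4 ≤ 1 := pow_le_one₀ ht0.le ht1
    calc (6 * t ^ 3 * (k * (W * v))) ^ 2 = 36 * t ^ 6 * k ^ 2 * v ^ 2 * W ^ 2 := by ring
      _ ≤ 36 * t ^ 6 * k ^ 2 * v ^ 2 * (K * t) ^ 2 :=
        mul_le_mul_of_nonneg_left hW2 (by positivity)
      _ = 36 * K ^ 2 * ((t ^ 2 * k ^ 2) * (t ^ 2 * v ^ 2)) * t ^ 4 := by ring
      _ ≤ 36 * K ^ 2 * (ek * ev) * 1 := by
        have := mul_le_mul k3 v3 m3 hek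
        have h5 := mul_le_mul_of_nonneg_left this (by positivity : 0 ≤ 36 * K ^ 2)
        exact mul_le_mul h5 ht4 (by positivity) (by positivity)
      _ = (6 * K * P) ^ 2 := by rw [mul_pow, mul_pow, hP2]; ring
  have e : r * (a * (W' * v + W * c)) + t * (W * z) - 6 * t ^ 3 * (k * (W * v)) =
      r * (a * (W' * v)) + r * (a * (W * c)) + t * (W * z) - 6 * t ^ 3 * (k * (W * v)) := by ring
  rw [e, abs_le]
  rw [abs_le] at b1 b2 b3 b4
  constructor <;> linarith [b1.1, b1.2, b2.1, b2.2, b3.1, b3.2, b4.1, b4.2]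

/-- The bilinear form of the stability operator, with the weight `wtSq`, is bounded by the weighted
energies. -/
theorem abs_form_le {ε : ℝ} (hε : 0 < ε) {k v : Param → ℝ} (hv : SmoothSupp v) (p : Param) :
    |gradInner k (fun q => wtSq ε q.1 * v q) p -
      6 / (1 + p.1 ^ 2) ^ 3 * (k p * (wtSq ε p.1 * v p))| ≤
    11 * (ε ^ 2)⁻¹ * (Real.sqrt (energyDensity k p) * Real.sqrt (energyDensity v p)) := by
  have hr : (gRho p.1)⁻¹ ≤ 2 := by
    rw [gRho_eq, inv_div, div_le_iff₀ (by positivity)]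
    nlinarith [sq_nonneg p.1]
  have ht1 : (1 + p.1 ^ 2)⁻¹ ≤ 1 := inv_le_one_of_one_le₀ (by nlinarith [sq_nonneg p.1])
  have e6 : 6 / (1 + p.1 ^ 2) ^ 3 = 6 * ((1 + p.1 ^ 2)⁻¹) ^ 3 := by
    rw [div_eq_mul_inv, inv_pow]
  have d (w : Param → ℝ) : energyDensity w p = (1 + p.1 ^ 2)⁻¹ * ((gRho p.1)⁻¹ * dRho w p ^ 2 +
      (1 + p.1 ^ 2)⁻¹ * ‖sphereGrad (fun y => w (p.1, y)) p.2‖ ^ 2) +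
      ((1 + p.1 ^ 2)⁻¹) ^ 2 * w p ^ 2 := by
    rw [energyDensity, gradSq, jap_sq, inv_pow]
  rw [gradInner_wtSq_mul hε hv, e6, jap_sq]
  refine abs_form_le_real (by positivity) ht1 (inv_pos.2 (gRho_pos p.1)) hr (by positivity)
    (wtSq_nonneg ε p.1) (wtSq_le_inv hε p.1) (wtSqDeriv_sq_le hε p.1)
    (abs_real_inner_le_norm _ _) (by positivity) ?_ (d k) (d v)
  rw [mul_pow, Real.sq_sqrt (energyDensity_nonneg k p), Real.sq_sqrt (energyDensity_nonneg v p)]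

theorem abs_integral_form_le {ε : ℝ} (hε : 0 < ε) {k v : Param → ℝ} (hk : SmoothSupp k)
    (hv : SmoothSupp v) :
    |∫ p, (gradInner k (fun q => wtSq ε q.1 * v q) p -
      6 / (1 + p.1 ^ 2) ^ 3 * (k p * (wtSq ε p.1 * v p))) ∂vol| ≤
    11 * (ε ^ 2)⁻¹ * Real.sqrt (energy k * energy v) := by
  obtain ⟨R, hR⟩ := hk.supp
  have ck := hk.continuous_energyDensity.sqrt
  have cv := hv.continuous_energyDensity.sqrt
  have i1 : Integrable
      (fun p => Real.sqrt (energyDensity k p) * Real.sqrt (energyDensity v p)) vol :=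
    integrable_vol (ck.mul cv) ⟨R, fun ρ y h => by simp [energyDensity_vanish hR ρ y h]⟩
  have sk (p : Param) : Real.sqrt (energyDensity k p) ^ 2 = energyDensity k p :=
    Real.sq_sqrt (energyDensity_nonneg k p)
  have sv (p : Param) : Real.sqrt (energyDensity v p) ^ 2 = energyDensity v p :=
    Real.sq_sqrt (energyDensity_nonneg v p)
  have h1 := sq_integral_mul_le (μ := vol) (f := fun p => Real.sqrt (energyDensity k p))
    (g := fun p => Real.sqrt (energyDensity v p))
    (by simpa only [sk] using hk.integrable_energyDensity)
    (by simpa only [sv] using hv.integrable_energyDensity) i1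
  simp only [sk, sv] at h1
  calc _ ≤ ∫ p, |gradInner k (fun q => wtSq ε q.1 * v q) p -
        6 / (1 + p.1 ^ 2) ^ 3 * (k p * (wtSq ε p.1 * v p))| ∂vol := abs_integral_le_integral_abs
    _ ≤ ∫ p, 11 * (ε ^ 2)⁻¹ *
          (Real.sqrt (energyDensity k p) * Real.sqrt (energyDensity v p)) ∂vol :=
        integral_mono_of_nonneg (.of_forall fun p => abs_nonneg _) (i1.const_mul _)
          (.of_forall fun p => abs_form_le hε hv p)
    _ = 11 * (ε ^ 2)⁻¹ *
          ∫ p, Real.sqrt (energyDensity k p) * Real.sqrt (energyDensity v p) ∂vol :=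
        integral_const_mul _ _
    _ ≤ _ := by
        gcongr
        exact Real.le_sqrt_of_sq_le h1

theorem sphereGrad_sub {f g : S2 → ℝ} (hf : SmoothSphere f) (hg : SmoothSphere g) (y : S2) :
    sphereGrad (fun y => f y - g y) y = sphereGrad f y - sphereGrad g y := by
  have e : homExt (fun y => f y - g y) = fun x => homExt f x - homExt g x := by
    funext x
    by_cases hx : x = 0
    · simp [homExt, hx]
    · simp [homExt_of_ne _ hx]
  refine ext_inner_right ℝ fun v => ?_
  rw [inner_sphereGrad, inner_sub_left, inner_sphereGrad, inner_sphereGrad, e,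
    fderiv_fun_sub (hf.differentiableAt (sphere_ne_zero y))
      (hg.differentiableAt (sphere_ne_zero y))]
  simp

theorem dRho_sub {u v : Param → ℝ} (hu : SmoothSupp u) (hv : SmoothSupp v) (p : Param) :
    dRho (fun q => u q - v q) p = dRho u p - dRho v p :=
  ((hu.hasDerivAt_rho p.1 p.2).sub (hv.hasDerivAt_rho p.1 p.2)).deriv

theorem energyDensity_le {u v : Param → ℝ} (hu : SmoothSupp u) (hv : SmoothSupp v) (p : Param) :
    energyDensity u p ≤ 2 * energyDensity (fun q => u q - v q) p + 2 * energyDensity v p := by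
  have hr0 := inv_pos.2 (gRho_pos p.1)
  have ht0 : 0 < (1 + p.1 ^ 2)⁻¹ := by positivity
  have ht2 : 0 < ((1 + p.1 ^ 2) ^ 2)⁻¹ := by positivity
  simp only [energyDensity, gradSq, jap_sq]
  rw [dRho_sub hu hv, sphereGrad_sub (hu.smoothSphere p.1) (hv.smoothSphere p.1)]
  set X := sphereGrad (fun y => u (p.1, y)) p.2
  set Y := sphereGrad (fun y => v (p.1, y)) p.2
  have hX : ‖X‖ ^ 2 ≤ 2 * ‖X - Y‖ ^ 2 + 2 * ‖Y‖ ^ 2 := by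
    have h1 : ‖X‖ ≤ ‖X - Y‖ + ‖Y‖ := by simpa using norm_add_le (X - Y) Y
    nlinarith [norm_nonneg X, sq_nonneg (‖X - Y‖ - ‖Y‖)]
  have ha : dRho u p ^ 2 ≤ 2 * (dRho u p - dRho v p) ^ 2 + 2 * dRho v p ^ 2 := by
    nlinarith [sq_nonneg (dRho u p - 2 * dRho v p)]
  have hu2 : u p ^ 2 ≤ 2 * (u p - v p) ^ 2 + 2 * v p ^ 2 := by
    nlinarith [sq_nonneg (u p - 2 * v p)]
  have m1 := mul_le_mul_of_nonneg_left ha (mul_nonneg ht0.le hr0.le)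
  have m2 := mul_le_mul_of_nonneg_left hX (mul_nonneg ht0.le ht0.le)
  have m3 := mul_le_mul_of_nonneg_left hu2 ht2.le
  linarith

theorem energy_le {u v : Param → ℝ} (hu : SmoothSupp u) (hv : SmoothSupp v) :
    energy u ≤ 2 * energy (fun q => u q - v q) + 2 * energy v := by
  have i1 := (hu.sub hv).integrable_energyDensity
  have i2 := hv.integrable_energyDensity
  unfold energy
  rw [← integral_const_mul, ← integral_const_mul, ← integral_add (i1.const_mul 2) (i2.const_mul 2)]
  exact integral_mono hu.integrable_energyDensity ((i1.const_mul 2).add (i2.const_mul 2))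
    fun p => energyDensity_le hu hv p

section Limit

variable {u : ℕ → Param → ℝ} {φ : Param → ℝ}

theorem Approximates.smoothSupp (h : Approximates u φ) (n : ℕ) : SmoothSupp (u n) :=
  (h.test n).smoothSupp

theorem Approximates.energy_cauchy (h : Approximates u φ) :
    Tendsto (fun nm : ℕ × ℕ => energy fun q => u nm.1 q - u nm.2 q) atTop (𝓝 0) := by
  let X : ℕ → ℝ := fun n => ∫ p, (1 + p.1 ^ 2)⁻¹ * (u n p - φ p) ^ 2 ∂prodMeas
  have hX1 : Tendsto (fun nm : ℕ × ℕ => X nm.1) atTop (𝓝 0) := by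
    rw [← prod_atTop_atTop_eq]
    exact h.tendsto.comp tendsto_fst
  have hX2 : Tendsto (fun nm : ℕ × ℕ => X nm.2) atTop (𝓝 0) := by
    rw [← prod_atTop_atTop_eq]
    exact h.tendsto.comp tendsto_snd
  have hlim := h.cauchy.add ((hX1.const_mul 2).add (hX2.const_mul 2))
  simp only [mul_zero, add_zero] at hlim
  refine squeeze_zero (fun nm => energy_nonneg _) (fun nm => ?_) hlim
  have hk : SmoothSupp fun q => u nm.1 q - u nm.2 q := (h.smoothSupp nm.1).sub (h.smoothSupp nm.2)
  obtain ⟨R, hR⟩ := hk.supp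
  have i1 : Integrable (fun p => (1 + p.1 ^ 2)⁻¹ * gradSq (fun q => u nm.1 q - u nm.2 q) p) vol :=
    integrable_vol (continuous_inv_one_add_sq.mul hk.continuous_gradSq)
      ⟨R, fun ρ y h => by rw [gradSq_vanish hR ρ y h, mul_zero]⟩
  have c2 : Continuous fun p : Param => ((1 + p.1 ^ 2) ^ 2)⁻¹ :=
    Continuous.inv₀ (by fun_prop) fun p => by positivity
  have i2 : Integrable (fun p => ((1 + p.1 ^ 2) ^ 2)⁻¹ * (u nm.1 p - u nm.2 p) ^ 2) vol :=
    integrable_vol (c2.mul (hk.continuous.pow 2)) ⟨R, fun ρ y h => by rw [hR ρ y h]; simp⟩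
  have e : energy (fun q => u nm.1 q - u nm.2 q) =
      ∫ p, (1 + p.1 ^ 2)⁻¹ * gradSq (fun q => u nm.1 q - u nm.2 q) p ∂vol +
      ∫ p, ((1 + p.1 ^ 2) ^ 2)⁻¹ * (u nm.1 p - u nm.2 p) ^ 2 ∂vol := by
    rw [← integral_add i1 i2]; rfl
  rw [e]
  refine add_le_add le_rfl ?_
  have i3 := h.integrable_sub_sq nm.1
  have i4 := h.integrable_sub_sq nm.2
  have e2 : 2 * X nm.1 + 2 * X nm.2 = ∫ p, (2 * ((1 + p.1 ^ 2)⁻¹ * (u nm.1 p - φ p) ^ 2) +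
      2 * ((1 + p.1 ^ 2)⁻¹ * (u nm.2 p - φ p) ^ 2)) ∂prodMeas := by
    rw [integral_add (i3.const_mul 2) (i4.const_mul 2), integral_const_mul, integral_const_mul]
  rw [e2, integral_vol]
  refine integral_mono (integrable_vol_iff.1 i2) ((i3.const_mul 2).add (i4.const_mul 2)) fun p => ?_
  simp only
  have ht0 : 0 < (1 + p.1 ^ 2)⁻¹ := by positivity
  have h1 : density p.1 * (((1 + p.1 ^ 2) ^ 2)⁻¹ * (u nm.1 p - u nm.2 p) ^ 2) ≤
      (1 + p.1 ^ 2)⁻¹ * (u nm.1 p - u nm.2 p) ^ 2 := by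
    calc _ ≤ (1 + p.1 ^ 2) * (((1 + p.1 ^ 2) ^ 2)⁻¹ * (u nm.1 p - u nm.2 p) ^ 2) :=
          mul_le_mul_of_nonneg_right (density_le p.1) (by positivity)
      _ = _ := by field_simp
  have h2 : (u nm.1 p - u nm.2 p) ^ 2 ≤ 2 * (u nm.1 p - φ p) ^ 2 + 2 * (u nm.2 p - φ p) ^ 2 := by
    nlinarith [sq_nonneg (u nm.1 p - φ p + (u nm.2 p - φ p))]
  have h3 := mul_le_mul_of_nonneg_left h2 ht0.le
  linarith

theorem Approximates.energy_bounded (h : Approximates u φ) :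
    ∃ M : ℝ, 0 ≤ M ∧ ∀ᶠ n in atTop, energy (u n) ≤ M := by
  have h1 := h.energy_cauchy.eventually_lt_const (zero_lt_one)
  rw [eventually_atTop] at h1
  obtain ⟨⟨N1, N2⟩, hN⟩ := h1
  refine ⟨2 + 2 * energy (u N2), by have := energy_nonneg (u N2); positivity, ?_⟩
  filter_upwards [eventually_ge_atTop N1] with n hn
  have h2 := hN (n, N2) ⟨hn, le_rfl⟩
  have h3 := energy_le (h.smoothSupp n) (h.smoothSupp N2)
  simp only at h2
  linarith

/-- The pairing of the error `u m - φ` with a fixed compactly supported function tends to zero. -/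
theorem Approximates.tendsto_pairing (h : Approximates u φ) {G : Param → ℝ} (hG : Continuous G)
    (hv : ∃ R : ℝ, ∀ ρ y, R < |ρ| → G (ρ, y) = 0) :
    (∀ m, Integrable (fun p => (u m p - φ p) * G p) vol) ∧
    Tendsto (fun m => ∫ p, (u m p - φ p) * G p ∂vol) atTop (𝓝 0) := by
  obtain ⟨R, hR⟩ := hv
  let G2 : Param → ℝ := fun p => jap p.1 * density p.1 * G p
  have hcj : Continuous fun p : Param => jap p.1 := continuous_jap.comp continuous_fst
  have hcd : Continuous fun p : Param => density p.1 :=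
    contDiff_density.continuous.comp continuous_fst
  have hG2 : Continuous G2 := (hcj.mul hcd).mul hG
  have iG2 : Integrable (fun p => G2 p ^ 2) prodMeas := integrable_prodMeas (hG2.pow 2)
    ⟨R, fun ρ y h => by simp [G2, hR ρ y h]⟩
  let F : ℕ → Param → ℝ := fun m p => (jap p.1)⁻¹ * (u m p - φ p)
  have hF2 (m : ℕ) (p : Param) : F m p ^ 2 = (1 + p.1 ^ 2)⁻¹ * (u m p - φ p) ^ 2 := by
    simp only [F]; rw [mul_pow, inv_pow, jap_sq]
  have hFm (m : ℕ) : AEStronglyMeasurable (F m) prodMeas :=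
    (hcj.inv₀ fun p => (jap_pos p.1).ne').aestronglyMeasurable.mul
      ((h.smoothSupp m).continuous.aestronglyMeasurable.sub h.meas)
  have iF (m : ℕ) : Integrable (fun p => F m p ^ 2) prodMeas := by
    simpa only [hF2] using h.integrable_sub_sq m
  have iFG (m : ℕ) : Integrable (fun p => F m p * G2 p) prodMeas :=
    MemLp.integrable_mul ((memLp_two_iff_integrable_sq (hFm m)).2 (iF m))
      ((memLp_two_iff_integrable_sq hG2.aestronglyMeasurable).2 iG2)
  have e (m : ℕ) : (fun p => density p.1 * ((u m p - φ p) * G p)) = fun p => F m p * G2 p := by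
    funext p
    have := (jap_pos p.1).ne'
    simp only [F, G2]
    field_simp
  refine ⟨fun m => ?_, ?_⟩
  · rw [integrable_vol_iff, e]
    exact iFG m
  · have hb (m : ℕ) : |∫ p, (u m p - φ p) * G p ∂vol| ≤
        Real.sqrt ((∫ p, (1 + p.1 ^ 2)⁻¹ * (u m p - φ p) ^ 2 ∂prodMeas) *
          ∫ p, G2 p ^ 2 ∂prodMeas) := by
      rw [integral_vol, e]
      refine Real.abs_le_sqrt ?_
      have := sq_integral_mul_le (iF m) iG2 (iFG m)
      simpa only [hF2] using this
    have hlim := ((h.tendsto.mul_const (∫ p, G2 p ^ 2 ∂prodMeas)).sqrt)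
    rw [zero_mul, Real.sqrt_zero] at hlim
    exact squeeze_zero_norm hb hlim

/-- The quadratic form of `-H`, tested with `w² u`, becomes non-positive in the limit along the
approximations. It is not assumed that `φ` has a gradient: the form at `(u n, w² u n)` is compared
with the form at `(u m, w² u n)`, which tends to zero as `m → ∞` by the equation for `φ`. -/
theorem Approximates.eventually_form_le (h : Approximates u φ) (hφ : IsZeroSolution φ) {ε : ℝ}
    (hε : 0 < ε) {δ : ℝ} (hδ : 0 < δ) :
    ∀ᶠ n in atTop, ∫ p, (gradInner (u n) (fun q => wtSq ε q.1 * u n q) p -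
        6 / (1 + p.1 ^ 2) ^ 3 * (u n p * (wtSq ε p.1 * u n p))) ∂vol ≤ δ := by
  obtain ⟨M, hM, hMn⟩ := h.energy_bounded
  set K := 11 * (ε ^ 2)⁻¹ with hK
  have hK0 : 0 < K := by positivity
  -- `τ` is chosen so that `K √(τ M) ≤ δ / 2`
  set τ := (δ / (2 * K)) ^ 2 / (M + 1) with hτ
  have hτ0 : 0 < τ := by positivity
  have hKτ : K * Real.sqrt (τ * M) ≤ δ / 2 := by
    have h1 : τ * M ≤ (δ / (2 * K)) ^ 2 := by
      rw [hτ, div_mul_eq_mul_div, div_le_iff₀ (by positivity)]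
      have : 0 ≤ (δ / (2 * K)) ^ 2 := by positivity
      nlinarith
    have h2 : Real.sqrt (τ * M) ≤ δ / (2 * K) := by
      rw [← Real.sqrt_sq (by positivity : 0 ≤ δ / (2 * K))]
      exact Real.sqrt_le_sqrt h1
    calc K * Real.sqrt (τ * M) ≤ K * (δ / (2 * K)) := by gcongr
      _ = δ / 2 := by field_simp
  have hc := h.energy_cauchy.eventually_lt_const hτ0
  rw [eventually_atTop] at hc
  obtain ⟨⟨N1, N2⟩, hN⟩ := hc
  filter_upwards [hMn, eventually_ge_atTop N2] with n hMn hn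
  have hw := (h.test n).radial_mul (contDiff_wtSq hε)
  set η : Param → ℝ := fun q => wtSq ε q.1 * u n q with hη
  have hηN : SmoothSupp η := hw.smoothSupp
  obtain ⟨R, hR⟩ := hηN.supp
  obtain ⟨hi, ht⟩ := h.tendsto_pairing hηN.continuous_stabilityOp ⟨R, stabilityOp_vanish hR⟩
  have hsol := hφ.2 η hw
  have hub (m : ℕ) : Integrable (fun p => u m p * stabilityOp η p) vol :=
    integrable_vol ((h.smoothSupp m).continuous.mul hηN.continuous_stabilityOp)
      ⟨R, fun ρ y h => by rw [stabilityOp_vanish hR ρ y h, mul_zero]⟩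
  have hφi : Integrable (fun p => φ p * stabilityOp η p) vol := by
    refine ((hub n).sub (hi n)).congr (.of_forall fun p => ?_)
    simp only [Pi.sub_apply]
    ring
  have hpair (m : ℕ) : ∫ p, (u m p - φ p) * stabilityOp η p ∂vol =
      ∫ p, u m p * stabilityOp η p ∂vol := by
    have e : (fun p => (u m p - φ p) * stabilityOp η p) =
        fun p => u m p * stabilityOp η p - φ p * stabilityOp η p := by
      funext p; ring
    rw [e, integral_sub (hub m) hφi, hsol, sub_zero]
  have ht2 := ht.eventually (Metric.ball_mem_nhds 0 (half_pos hδ))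
  obtain ⟨m, hm1, hm2⟩ := (ht2.and (eventually_ge_atTop N1)).exists
  simp only [hpair, dist_zero_right, Real.norm_eq_abs] at hm1
  have hk : SmoothSupp fun q => u m q - u n q := (h.smoothSupp m).sub (h.smoothSupp n)
  have hkη : ∫ p, (u m p - u n p) * stabilityOp η p ∂vol =
      ∫ p, u m p * stabilityOp η p ∂vol - ∫ p, u n p * stabilityOp η p ∂vol := by
    rw [← integral_sub (hub m) (hub n)]
    refine integral_congr_ae (.of_forall fun p => ?_)
    simp only
    ring
  have hg1 := integral_mul_stabilityOp hk hηN
  have hg2 := integral_mul_stabilityOp (h.smoothSupp n) hηN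
  have hform := abs_integral_form_le hε hk (h.smoothSupp n)
  have hen : energy (fun q => u m q - u n q) < τ := hN (m, n) ⟨hm2, hn⟩
  have hsq : Real.sqrt (energy (fun q => u m q - u n q) * energy (u n)) ≤ Real.sqrt (τ * M) := by
    refine Real.sqrt_le_sqrt ?_
    have := energy_nonneg (fun q => u m q - u n q)
    have := energy_nonneg (u n)
    gcongr
  have hform2 : K * Real.sqrt (energy (fun q => u m q - u n q) * energy (u n)) ≤ δ / 2 :=
    (mul_le_mul_of_nonneg_left hsq hK0.le).trans hKτ
  have h1 := abs_le.1 (hform.trans hform2)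
  have h2 := abs_lt.1 hm1
  rw [hkη] at hg1
  linarith [h1.1, h1.2, h2.1, h2.2]

end Limit

/-! ### Square integrability of solutions with vanishing spherical means -/

theorem sq_integral_le_sph {g : S2 → ℝ} (hg : MemLp g 2 sph) :
    (∫ y, g y ∂sph) ^ 2 ≤ sph.real Set.univ * ∫ y, g y ^ 2 ∂sph := by
  have h := sq_integral_mul_le (μ := sph) (f := fun _ => 1) (g := g) (by simp) hg.integrable_sq
    (by simpa using hg.integrable one_le_two)
  simpa using h

section MeanZero

variable {u : ℕ → Param → ℝ} {φ : Param → ℝ}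

theorem Approximates.memLp_slice (h : Approximates u φ) :
    ∀ᵐ ρ : ℝ, MemLp (fun y => φ (ρ, y)) 2 sph := by
  filter_upwards [h.integrable_sq.prod_right_ae, h.meas.prodMk_left] with ρ h1 h2
  rw [memLp_two_iff_integrable_sq h2]
  have hs : (0 : ℝ) < 1 + ρ ^ 2 := by positivity
  refine (h1.const_mul (1 + ρ ^ 2)).congr (.of_forall fun y => ?_)
  simp only
  field_simp

/-- The spherical means of the approximations tend to zero in the weighted norm, if those of the
limit vanish. -/
theorem Approximates.integral_mean_sq_le (h : Approximates u φ)
    (hmean : ∀ᵐ ρ : ℝ, ∫ y, φ (ρ, y) ∂sph = 0) {ε : ℝ} (hε : 0 < ε) (n : ℕ) :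
    (sph.real Set.univ)⁻¹ * ∫ ρ, wtSq ε ρ * (∫ y, u n (ρ, y) ∂sph) ^ 2 ≤
      (ε ^ 2)⁻¹ * ∫ p, (1 + p.1 ^ 2)⁻¹ * (u n p - φ p) ^ 2 ∂prodMeas := by
  have hT := sph_univ_pos
  have hsub := h.integrable_sub_sq n
  rw [integral_prod _ hsub, ← integral_const_mul, ← integral_const_mul]
  refine integral_mono_of_nonneg (.of_forall fun ρ => ?_) (hsub.integral_prod_left.const_mul _) ?_
  · have := wtSq_nonneg ε ρ
    simp only [Pi.zero_apply]
    positivity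
  · filter_upwards [hmean, h.memLp_slice] with ρ h1 h2
    have hu : MemLp (fun y => u n (ρ, y)) 2 sph :=
      ((h.smoothSupp n).smoothSphere ρ).continuous.memLp_of_hasCompactSupport
        (HasCompactSupport.of_compactSpace _)
    have h3 := sq_integral_le_sph (hu.sub h2)
    have h4 : ∫ y, ((fun y => u n (ρ, y)) - fun y => φ (ρ, y)) y ∂sph = ∫ y, u n (ρ, y) ∂sph := by
      simp only [Pi.sub_apply]
      rw [integral_sub (hu.integrable one_le_two) (h2.integrable one_le_two), h1, sub_zero]
    rw [h4] at h3
    simp only [Pi.sub_apply] at h3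
    have hW := wtSq_le_inv hε ρ
    have hW0 := wtSq_nonneg ε ρ
    rw [integral_const_mul]
    have hA : 0 ≤ ∫ y, (u n (ρ, y) - φ (ρ, y)) ^ 2 ∂sph := integral_nonneg fun y => sq_nonneg _
    set A := ∫ y, (u n (ρ, y) - φ (ρ, y)) ^ 2 ∂sph
    calc (sph.real Set.univ)⁻¹ * (wtSq ε ρ * (∫ y, u n (ρ, y) ∂sph) ^ 2)
        ≤ (sph.real Set.univ)⁻¹ * (((ε ^ 2)⁻¹ * (1 + ρ ^ 2)⁻¹) * (sph.real Set.univ * A)) := by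
          gcongr
      _ = _ := by field_simp

theorem Approximates.integrable_wtSq_mul (h : Approximates u φ) {ε : ℝ} (hε : 0 < ε) :
    Integrable (fun p => wtSq ε p.1 * φ p ^ 2) prodMeas := by
  have hW : Continuous fun p : Param => wtSq ε p.1 :=
    (contDiff_wtSq hε).continuous.comp continuous_fst
  refine (h.integrable_sq.const_mul (ε ^ 2)⁻¹).mono'
    (hW.aestronglyMeasurable.mul (h.meas.pow 2)) (.of_forall fun p => ?_)
  have h0 := wtSq_nonneg ε p.1
  rw [Real.norm_of_nonneg (by positivity), ← mul_assoc]
  exact mul_le_mul_of_nonneg_right (wtSq_le_inv hε p.1) (sq_nonneg _)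

/-- The weighted `L²` bound, uniform in the parameter of the weight. -/
theorem Approximates.integral_wtSq_le (h : Approximates u φ) (hφ : IsZeroSolution φ)
    (hmean : ∀ᵐ ρ : ℝ, ∫ y, φ (ρ, y) ∂sph = 0) {ε : ℝ} (hε : 0 < ε) :
    ∫ p, wtSq ε p.1 * φ p ^ 2 ∂prodMeas ≤
      120000 * ∫ p, (1 + p.1 ^ 2)⁻¹ * φ p ^ 2 ∂prodMeas := by
  set I := ∫ p, (1 + p.1 ^ 2)⁻¹ * φ p ^ 2 ∂prodMeas
  have hW : Continuous fun p : Param => wtSq ε p.1 :=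
    (contDiff_wtSq hε).continuous.comp continuous_fst
  have hK : 0 < (ε ^ 2)⁻¹ := by positivity
  refine le_of_forall_pos_le_add fun δ hδ => ?_
  have ht := h.tendsto.const_mul (120000 + 202 * (ε ^ 2)⁻¹)
  rw [mul_zero] at ht
  obtain ⟨n, hn1, hn2⟩ := ((h.eventually_form_le hφ hε (δ := δ / 400) (by positivity)).and
    (ht.eventually_lt_const (half_pos hδ))).exists
  have hco := coercivity hε (h.smoothSupp n)
  have hme := h.integral_mean_sq_le hmean hε n
  have i1 := h.integrable_sub_sq n
  have i2 := (h.smoothSupp n).integrable_weighted_sq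
  have i3 := h.integrable_wtSq_mul hε
  obtain ⟨R, hR⟩ := (h.smoothSupp n).supp
  have i4 : Integrable (fun p => wtSq ε p.1 * u n p ^ 2) prodMeas :=
    integrable_prodMeas (hW.mul ((h.smoothSupp n).continuous.pow 2))
      ⟨R, fun ρ y h => by simp [hR ρ y h]⟩
  set X := ∫ p, (1 + p.1 ^ 2)⁻¹ * (u n p - φ p) ^ 2 ∂prodMeas
  have l1 : ∫ p, (1 + p.1 ^ 2)⁻¹ * u n p ^ 2 ∂prodMeas ≤ 2 * I + 2 * X := by
    rw [← integral_const_mul, ← integral_const_mul,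
      ← integral_add (h.integrable_sq.const_mul 2) (i1.const_mul 2)]
    refine integral_mono i2 ((h.integrable_sq.const_mul 2).add (i1.const_mul 2)) fun p => ?_
    have hs : (0 : ℝ) < (1 + p.1 ^ 2)⁻¹ := by positivity
    simp only
    nlinarith [mul_nonneg hs.le (sq_nonneg (u n p - 2 * φ p))]
  have l2 : ∫ p, wtSq ε p.1 * φ p ^ 2 ∂prodMeas ≤
      2 * (∫ p, wtSq ε p.1 * u n p ^ 2 ∂prodMeas) + 2 * ((ε ^ 2)⁻¹ * X) := by
    rw [← integral_const_mul, ← integral_const_mul, ← integral_const_mul,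
      ← integral_add (i4.const_mul 2) ((i1.const_mul _).const_mul 2)]
    refine integral_mono i3 ((i4.const_mul 2).add ((i1.const_mul _).const_mul 2)) fun p => ?_
    simp only
    have h1 := mul_le_mul_of_nonneg_right (wtSq_le_inv hε p.1) (sq_nonneg (u n p - φ p))
    nlinarith [mul_nonneg (wtSq_nonneg ε p.1) (sq_nonneg (2 * u n p - φ p))]
  linarith

/-- A solution in the local energy space whose spherical means vanish is square integrable. -/
theorem Approximates.memLp_two (h : Approximates u φ) (hφ : IsZeroSolution φ)
    (hmean : ∀ᵐ ρ : ℝ, ∫ y, φ (ρ, y) ∂sph = 0) (hm : AEStronglyMeasurable φ vol) :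
    MemLp φ 2 vol := by
  set I := ∫ p, (1 + p.1 ^ 2)⁻¹ * φ p ^ 2 ∂prodMeas
  let e : ℕ → ℝ := fun k => 1 / ((k : ℝ) + 1)
  have he (k : ℕ) : 0 < e k := by positivity
  have het : Tendsto e atTop (𝓝 0) := tendsto_one_div_add_atTop_nhds_zero_nat
  have hlim (p : Param) : Tendsto (fun k => ENNReal.ofReal (wtSq (e k) p.1 * φ p ^ 2)) atTop
      (𝓝 (ENNReal.ofReal ((1 + p.1 ^ 2) * φ p ^ 2))) := by
    refine (ENNReal.continuous_ofReal.tendsto _).comp (Tendsto.mul_const _ ?_)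
    have h1 : Tendsto (fun k => (1 + e k * (1 + p.1 ^ 2)) ^ 2) atTop
        (𝓝 ((1 + 0 * (1 + p.1 ^ 2)) ^ 2)) :=
      ((het.mul_const _).const_add 1).pow 2
    have h2 : Tendsto (fun k => (1 + p.1 ^ 2) / (1 + e k * (1 + p.1 ^ 2)) ^ 2) atTop
        (𝓝 ((1 + p.1 ^ 2) / (1 + 0 * (1 + p.1 ^ 2)) ^ 2)) :=
      tendsto_const_nhds.div h1 (by simp)
    simpa [wtSq] using h2
  have hb (k : ℕ) : ∫⁻ p, ENNReal.ofReal (wtSq (e k) p.1 * φ p ^ 2) ∂prodMeas ≤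
      ENNReal.ofReal (120000 * I) := by
    rw [← ofReal_integral_eq_lintegral_ofReal (h.integrable_wtSq_mul (he k))
      (.of_forall fun p => mul_nonneg (wtSq_nonneg _ _) (sq_nonneg _))]
    exact ENNReal.ofReal_le_ofReal (h.integral_wtSq_le hφ hmean (he k))
  -- Fatou's lemma as `ε → 0`
  have hfin : ∫⁻ p, ENNReal.ofReal ((1 + p.1 ^ 2) * φ p ^ 2) ∂prodMeas ≤
      ENNReal.ofReal (120000 * I) := by
    calc ∫⁻ p, ENNReal.ofReal ((1 + p.1 ^ 2) * φ p ^ 2) ∂prodMeas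
        = ∫⁻ p, liminf (fun k => ENNReal.ofReal (wtSq (e k) p.1 * φ p ^ 2)) atTop ∂prodMeas :=
          lintegral_congr fun p => (hlim p).liminf_eq.symm
      _ ≤ liminf (fun k => ∫⁻ p, ENNReal.ofReal (wtSq (e k) p.1 * φ p ^ 2) ∂prodMeas) atTop :=
          lintegral_liminf_le' fun k =>
            (h.integrable_wtSq_mul (he k)).aestronglyMeasurable.aemeasurable.ennreal_ofReal
      _ ≤ liminf (fun _ : ℕ => ENNReal.ofReal (120000 * I)) atTop :=
          liminf_le_liminf (.of_forall hb)
      _ = _ := by simp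
  rw [memLp_two_iff_integrable_sq hm, integrable_vol_iff]
  have hcd : Continuous fun p : Param => density p.1 :=
    contDiff_density.continuous.comp continuous_fst
  refine integrable_of_lintegral_lt_top (hcd.aestronglyMeasurable.mul (h.meas.pow 2))
    (fun p => mul_nonneg (density_pos _).le (sq_nonneg _)) ?_
  refine lt_of_le_of_lt (lintegral_mono fun p => ENNReal.ofReal_le_ofReal ?_)
    (lt_of_le_of_lt hfin ENNReal.ofReal_lt_top)
  exact mul_le_mul_of_nonneg_right (density_le _) (sq_nonneg _)

end MeanZero

/-! ### The radial Jacobi fields -/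

/-- The Jacobi field of the vertical translations, up to sign: the component of `∂_Z` along the
normal. It is odd in `ρ`. -/
def translationField (ρ : ℝ) : ℝ := ρ * Real.sqrt (2 + ρ ^ 2) / jap ρ ^ 2

/-- The Jacobi field of the dilations: the normal component of the position vector. It is even
in `ρ`. -/
def dilationField (ρ : ℝ) : ℝ := (jap ρ)⁻¹ - height ρ * translationField ρ

/-- The radial part of `H`, multiplied by the density `|g|^(1/2)`. -/
def radialOp (h : ℝ → ℝ) (ρ : ℝ) : ℝ :=
  deriv (fun r => flux r * deriv h r) ρ + density ρ * (6 / (1 + ρ ^ 2) ^ 3) * h ρ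

theorem sqrt_two_add_pos (ρ : ℝ) : 0 < Real.sqrt (2 + ρ ^ 2) := Real.sqrt_pos.2 (by positivity)

theorem hasDerivAt_translationField (ρ : ℝ) :
    HasDerivAt translationField (2 / (jap ρ ^ 4 * Real.sqrt (2 + ρ ^ 2))) ρ := by
  have h := (hasDerivAt_normal_axis ρ).neg
  have e : (-fun r => -(r * Real.sqrt (jap r ^ 2 + 1)) / jap r ^ 2) = translationField := by
    funext r
    have : jap r ^ 2 + 1 = 2 + r ^ 2 := by rw [jap_sq]; ring
    simp only [Pi.neg_apply, translationField, this]
    ring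
  rw [e] at h
  refine h.congr_deriv ?_
  have : jap ρ ^ 4 = (1 + ρ ^ 2) ^ 2 := by rw [← jap_sq]; ring
  rw [this]
  ring

theorem hasDerivAt_height' (ρ : ℝ) :
    HasDerivAt height (1 / (jap ρ * Real.sqrt (2 + ρ ^ 2))) ρ := by
  have h := hasDerivAt_height ρ
  have : jap ρ ^ 2 + 1 = 2 + ρ ^ 2 := by rw [jap_sq]; ring
  rwa [this] at h

theorem contDiff_height : ContDiff ℝ ∞ height := by
  rw [contDiff_infty_iff_deriv]
  refine ⟨fun ρ => (hasDerivAt_height ρ).differentiableAt, ?_⟩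
  have : deriv height = fun ρ => 1 / (jap ρ * Real.sqrt (2 + ρ ^ 2)) :=
    funext fun ρ => (hasDerivAt_height' ρ).deriv
  rw [this]
  refine ContDiff.div contDiff_const (contDiff_jap.mul
    (ContDiff.sqrt (by fun_prop) fun x => by positivity)) fun x => ?_
  exact (mul_pos (jap_pos x) (sqrt_two_add_pos x)).ne'

theorem contDiff_translationField : ContDiff ℝ ∞ translationField :=
  ContDiff.div (contDiff_id.mul (ContDiff.sqrt (by fun_prop) fun x => by positivity))
    (contDiff_jap.pow 2) fun x => (pow_pos (jap_pos x) 2).ne'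

theorem contDiff_dilationField : ContDiff ℝ ∞ dilationField :=
  (contDiff_jap.inv fun x => (jap_pos x).ne').sub (contDiff_height.mul contDiff_translationField)

theorem density_eq_div (ρ : ℝ) : density ρ = jap ρ ^ 3 / Real.sqrt (2 + ρ ^ 2) := by
  have hj := jap_pos ρ
  have ht := sqrt_two_add_pos ρ
  refine (pow_left_inj₀ (density_pos ρ).le (by positivity) two_ne_zero).1 ?_
  rw [density_sq, div_pow, Real.sq_sqrt (by positivity), ← jap_sq]
  ring

theorem jap_even (ρ : ℝ) : jap (-ρ) = jap ρ := by simp [jap]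

theorem height_odd (ρ : ℝ) : height (-ρ) = -height ρ := by
  have h := intervalIntegral.integral_comp_neg (a := 0) (b := ρ)
    (fun s => 1 / (jap s * Real.sqrt (jap s ^ 2 + 1)))
  simp only [jap_even, neg_zero] at h
  rw [height, height, intervalIntegral.integral_symm, ← h]

theorem translationField_odd (ρ : ℝ) : translationField (-ρ) = -translationField ρ := by
  simp only [translationField, jap_even, neg_sq]
  ring

theorem dilationField_even (ρ : ℝ) : dilationField (-ρ) = dilationField ρ := by
  simp only [dilationField, jap_even, height_odd, translationField_odd]
  ring

/-- The flux `|g|^(1/2) g^ρρ ∂_ρ` of the translation field. -/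
theorem flux_mul_deriv_translationField (ρ : ℝ) :
    flux ρ * (2 / (jap ρ ^ 4 * Real.sqrt (2 + ρ ^ 2))) = 2 / jap ρ ^ 3 := by
  have hj := jap_pos ρ
  have ht := sqrt_two_add_pos ρ
  rw [flux_eq]
  field_simp

theorem hasDerivAt_dilationField (ρ : ℝ) : HasDerivAt dilationField
    (-(2 * translationField ρ + 2 * height ρ / jap ρ ^ 3) / flux ρ) ρ := by
  have hj := jap_pos ρ
  have ht := sqrt_two_add_pos ρ
  have h := ((hasDerivAt_jap ρ).inv hj.ne').sub
    ((hasDerivAt_height' ρ).mul (hasDerivAt_translationField ρ))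
  refine h.congr_deriv ?_
  rw [flux_eq, translationField]
  field_simp
  ring

theorem hasDerivAt_inv_jap_pow_three (ρ : ℝ) :
    HasDerivAt (fun r => 2 / jap r ^ 3) (-(6 * ρ) / jap ρ ^ 5) ρ := by
  have hj := jap_pos ρ
  have h := (hasDerivAt_const ρ (2 : ℝ)).div ((hasDerivAt_jap ρ).pow 3) (pow_pos hj 3).ne'
  refine h.congr_deriv ?_
  simp only [Pi.pow_apply]
  push_cast
  field_simp
  ring

/-- The Wronskian of the two Jacobi fields is constant. -/
theorem wronskian (ρ : ℝ) : 2 / jap ρ ^ 3 * dilationField ρ +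
    (2 * translationField ρ + 2 * height ρ / jap ρ ^ 3) * translationField ρ = 2 := by
  have hj := jap_pos ρ
  have e : 2 / jap ρ ^ 3 * dilationField ρ +
      (2 * translationField ρ + 2 * height ρ / jap ρ ^ 3) * translationField ρ =
      2 / jap ρ ^ 4 + 2 * translationField ρ ^ 2 := by
    rw [dilationField]
    field_simp
    ring
  rw [e, translationField, div_pow, mul_pow, Real.sq_sqrt (by positivity)]
  have h4 : jap ρ ^ 4 = (1 + ρ ^ 2) ^ 2 := by rw [← jap_sq]; ring
  rw [← pow_mul, h4]
  field_simp
  ring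

/-- Variation of constants: the radial operator can be inverted, within the test functions, on the
orthogonal complement of the two Jacobi fields. -/
theorem exists_radialOp_eq {g : ℝ → ℝ} (hg : ContDiff ℝ ∞ g) (hc : HasCompactSupport g)
    (h1 : ∫ ρ, translationField ρ * g ρ = 0) (h2 : ∫ ρ, dilationField ρ * g ρ = 0) :
    ∃ h : ℝ → ℝ, ContDiff ℝ ∞ h ∧ HasCompactSupport h ∧ ∀ ρ, radialOp h ρ = g ρ := by
  obtain ⟨A, hA⟩ := hc.isCompact.isBounded.subset_closedBall 0
  have hv (ρ : ℝ) (h : A < |ρ|) : g ρ = 0 := by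
    by_contra hn
    have := hA (subset_tsupport g hn)
    rw [mem_closedBall_zero_iff, Real.norm_eq_abs] at this
    linarith
  -- the primitives of `y g` vanish on both sides of the support of `g`
  have prim {y : ℝ → ℝ} (hy : ContDiff ℝ ∞ y) (h0 : ∫ ρ, y ρ * g ρ = 0) :
      ∃ I : ℝ → ℝ, ContDiff ℝ ∞ I ∧ (∀ ρ, HasDerivAt I (y ρ * g ρ) ρ) ∧
        ∀ ρ, A < |ρ| → I ρ = 0 := by
    have hcont : Continuous fun ρ => y ρ * g ρ := (hy.mul hg).continuous
    have hint : Integrable fun ρ => y ρ * g ρ := hcont.integrable_of_hasCompactSupport hc.mul_left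
    let I : ℝ → ℝ := fun ρ => ∫ r in Set.Iic ρ, y r * g r
    have hI (ρ : ℝ) : I ρ = I 0 + ∫ r in (0 : ℝ)..ρ, y r * g r := by
      have := intervalIntegral.integral_Iic_sub_Iic (a := 0) (b := ρ) hint.integrableOn
        hint.integrableOn
      simp only [I]
      linarith
    have hder (ρ : ℝ) : HasDerivAt I (y ρ * g ρ) ρ := by
      rw [funext hI]
      exact (hcont.integral_hasStrictDerivAt 0 ρ).hasDerivAt.const_add _
    refine ⟨I, ?_, hder, fun ρ hρ => ?_⟩
    · rw [contDiff_infty_iff_deriv, funext fun ρ => (hder ρ).deriv]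
      exact ⟨fun ρ => (hder ρ).differentiableAt, hy.mul hg⟩
    · rcases lt_abs.1 hρ with h | h
      · have e := integral_add_compl (measurableSet_Iic (a := ρ)) hint
        rw [h0, setIntegral_eq_zero_of_forall_eq_zero (t := (Set.Iic ρ)ᶜ) fun r hr => ?_] at e
        · simpa using e
        · rw [hv r, mul_zero]
          rw [Set.compl_Iic, Set.mem_Ioi] at hr
          exact (h.trans hr).trans_le (le_abs_self r)
      · refine setIntegral_eq_zero_of_forall_eq_zero fun r hr => ?_
        rw [hv r, mul_zero]
        have hr : r ≤ ρ := hr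
        exact (by linarith : A < -r).trans_le (neg_le_abs r)
  obtain ⟨I1, s1, d1, v1⟩ := prim contDiff_translationField h1
  obtain ⟨I2, s2, d2, v2⟩ := prim contDiff_dilationField h2
  refine ⟨fun ρ => (translationField ρ * I2 ρ - dilationField ρ * I1 ρ) / 2, ?_, ?_, fun ρ => ?_⟩
  · exact ((contDiff_translationField.mul s2).sub (contDiff_dilationField.mul s1)).div_const 2
  · refine HasCompactSupport.intro (isCompact_closedBall (0 : ℝ) A) fun ρ hρ => ?_
    rw [mem_closedBall_zero_iff, Real.norm_eq_abs, not_le] at hρ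
    simp [v1 ρ hρ, v2 ρ hρ]
  · have hd (r : ℝ) : flux r * deriv (fun ρ =>
        (translationField ρ * I2 ρ - dilationField ρ * I1 ρ) / 2) r =
        (2 / jap r ^ 3 * I2 r +
          (2 * translationField r + height r * (2 / jap r ^ 3)) * I1 r) / 2 := by
      have h := (((hasDerivAt_translationField r).mul (d2 r)).sub
        ((hasDerivAt_dilationField r).mul (d1 r))).div_const 2
      have hf := (flux_pos r).ne'
      have h' : deriv (fun ρ => (translationField ρ * I2 ρ - dilationField ρ * I1 ρ) / 2) r = _ :=
        h.deriv
      rw [h']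
      have e := flux_mul_deriv_translationField r
      have e' : flux r * (-(2 * translationField r + 2 * height r / jap r ^ 3) / flux r) =
          -(2 * translationField r + 2 * height r / jap r ^ 3) := mul_div_cancel₀ _ hf
      linear_combination I2 r / 2 * e - I1 r / 2 * e'
    have hp := hasDerivAt_inv_jap_pow_three ρ
    have hy := hasDerivAt_translationField ρ
    have h := ((hp.mul (d2 ρ)).add (((hy.const_mul 2).add ((hasDerivAt_height' ρ).mul hp)).mul
      (d1 ρ))).div_const 2
    have hW := wronskian ρ
    have hj := jap_pos ρ
    have ht := sqrt_two_add_pos ρ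
    rw [radialOp, funext hd]
    refine (congrArg₂ _ h.deriv rfl).trans ?_
    have e6 : (1 + ρ ^ 2) ^ 3 = jap ρ ^ 6 := by rw [← jap_sq]; ring
    rw [density_eq_div, e6]
    simp only [Pi.add_apply, Pi.mul_apply]
    simp only [translationField, dilationField] at hW ⊢
    generalize Real.sqrt (2 + ρ ^ 2) = t at *
    generalize jap ρ = j at *
    generalize height ρ = Z at *
    linear_combination (norm := skip) g ρ / 2 * hW
    field_simp
    ring

/-! ### Spherical means of solutions -/

theorem sphereLaplacian_const (c : ℝ) (y : S2) : sphereLaplacian (fun _ => c) y = 0 := by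
  have : homExt (fun _ : S2 => c) =ᶠ[𝓝 (y : E3)] fun _ => c := by
    filter_upwards [isOpen_ne.mem_nhds (sphere_ne_zero y)] with x hx
    rw [homExt_of_ne _ hx]
  rw [sphereLaplacian, (InnerProductSpace.laplacian_congr_nhds this).eq_of_nhds]
  exact congrFun InnerProductSpace.laplacian_const _

theorem density_mul_stabilityOp_radial (h : ℝ → ℝ) (p : Param) :
    density p.1 * stabilityOp (fun p => h p.1) p = radialOp h p.1 := by
  rw [density_mul_stabilityOp]
  simp only [sphereLaplacian_const, mul_zero, add_zero]
  rfl

section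

variable {u : ℕ → Param → ℝ} {φ : Param → ℝ}

theorem Approximates.integrable_mul (h : Approximates u φ) :
    Integrable (fun p => (1 + p.1 ^ 2)⁻¹ * φ p) prodMeas := by
  have h1 : Integrable (fun p : Param => (1 + p.1 ^ 2)⁻¹) prodMeas :=
    integrable_inv_one_add_sq.comp_fst sph
  refine (h.integrable_sq.add h1).mono'
    (continuous_inv_one_add_sq.aestronglyMeasurable.mul h.meas) (.of_forall fun p => ?_)
  have hs : (0 : ℝ) < (1 + p.1 ^ 2)⁻¹ := by positivity
  rw [Real.norm_eq_abs, abs_mul, abs_of_pos hs]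
  simp only [Pi.add_apply]
  nlinarith [mul_nonneg hs.le (sq_nonneg (|φ p| - 1)), sq_abs (φ p),
    mul_nonneg hs.le (sq_nonneg (φ p))]

theorem Approximates.locallyIntegrable_mean (h : Approximates u φ) :
    LocallyIntegrable fun ρ : ℝ => ∫ y, φ (ρ, y) ∂sph := by
  have h1 := h.integrable_mul.integral_prod_left.locallyIntegrable
  have h2 := h1.smul_continuous (g := fun ρ : ℝ => 1 + ρ ^ 2) (by fun_prop)
  convert! h2 using 1
  funext ρ
  have hs : (0 : ℝ) < 1 + ρ ^ 2 := by positivity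
  simp only [integral_const_mul, smul_eq_mul]
  field_simp

/-- The spherical mean is a distributional solution of the radial equation. -/
theorem Approximates.integral_mean_mul_radialOp (h : Approximates u φ) (hφ : IsZeroSolution φ)
    {η : ℝ → ℝ} (hη : ContDiff ℝ ∞ η) (hc : HasCompactSupport η) {g : ℝ → ℝ} (hg : Continuous g)
    (hgc : HasCompactSupport g) (hL : ∀ ρ, radialOp η ρ = g ρ) :
    ∫ ρ, (∫ y, φ (ρ, y) ∂sph) * g ρ = 0 := by
  have h1 := hφ.2 _ (isTest_radial hη hc)
  rw [integral_vol] at h1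
  have e (p : Param) : density p.1 * (φ p * stabilityOp (fun p => η p.1) p) = φ p * g p.1 := by
    rw [mul_left_comm, density_mul_stabilityOp_radial, hL]
  simp only [e] at h1
  have hb : Continuous fun ρ : ℝ => (1 + ρ ^ 2) * g ρ := by fun_prop
  obtain ⟨C, hC⟩ := hb.bounded_above_of_compact_support hgc.mul_left
  have hi : Integrable (fun p : Param => φ p * g p.1) prodMeas := by
    refine (h.integrable_mul.mul_bdd (g := fun p : Param => (1 + p.1 ^ 2) * g p.1)
      (hb.comp continuous_fst).aestronglyMeasurable (.of_forall fun p => hC p.1)).congr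
      (.of_forall fun p => ?_)
    have hs : (0 : ℝ) < 1 + p.1 ^ 2 := by positivity
    simp only
    field_simp
  rw [integral_prod _ hi] at h1
  simpa only [integral_mul_const] using h1

theorem integral_eq_zero_of_odd {f : ℝ → ℝ} (hf : ∀ ρ, f (-ρ) = -f ρ) : ∫ ρ, f ρ = 0 := by
  have h := integral_neg_eq_self f volume
  simp only [hf, integral_neg] at h
  linarith

/-- The spherical mean of a solution is a combination of the two radial Jacobi fields. -/
theorem Approximates.mean_eq (h : Approximates u φ) (hφ : IsZeroSolution φ) :
    ∃ a b : ℝ, ∀ᵐ ρ : ℝ, ∫ y, φ (ρ, y) ∂sph = a * translationField ρ + b * dilationField ρ := by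
  set m : ℝ → ℝ := fun ρ => ∫ y, φ (ρ, y) ∂sph
  have hm : LocallyIntegrable m := h.locallyIntegrable_mean
  have key {g : ℝ → ℝ} (hg : ContDiff ℝ ∞ g) (hc : HasCompactSupport g)
      (h1 : ∫ ρ, translationField ρ * g ρ = 0) (h2 : ∫ ρ, dilationField ρ * g ρ = 0) :
      ∫ ρ, m ρ * g ρ = 0 := by
    obtain ⟨η, hη, hηc, hL⟩ := exists_radialOp_eq hg hc h1 h2
    exact h.integral_mean_mul_radialOp hφ hη hηc hg.continuous hc hL
  -- an even cutoff: by parity, the cut off Jacobi fields are biorthogonal to the Jacobi fields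
  let χ : ContDiffBump (0 : ℝ) := ⟨1, 2, one_pos, one_lt_two⟩
  have hχ : ContDiff ℝ ∞ χ := χ.contDiff
  have hχc : HasCompactSupport χ := χ.hasCompactSupport
  have hT := contDiff_translationField
  have hD := contDiff_dilationField
  let g1 : ℝ → ℝ := fun ρ => translationField ρ * χ ρ
  let g2 : ℝ → ℝ := fun ρ => dilationField ρ * χ ρ
  have s1 : ContDiff ℝ ∞ g1 := hT.mul hχ
  have s2 : ContDiff ℝ ∞ g2 := hD.mul hχ
  have c1 : HasCompactSupport g1 := hχc.mul_left
  have c2 : HasCompactSupport g2 := hχc.mul_left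
  have pos {y : ℝ → ℝ} (hy : ContDiff ℝ ∞ y) (r : ℝ) (hr : |r| ≤ 1) (hyr : y r ≠ 0) :
      0 < ∫ ρ, y ρ * (y ρ * χ ρ) := by
    have hχr : χ r = 1 := χ.one_of_mem_closedBall (by simpa using hr)
    refine (hy.mul (hy.mul hχ)).continuous.integral_pos_of_hasCompactSupport_nonneg_nonzero
      (hχc.mul_left.mul_left) (fun ρ => ?_) (x := r) ?_
    · have := χ.nonneg (x := ρ)
      simp only [Pi.zero_apply]
      nlinarith [mul_nonneg (mul_self_nonneg (y ρ)) this]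
    · simp [hχr, hyr]
  have p1 : 0 < ∫ ρ, translationField ρ * g1 ρ := by
    refine pos hT 1 (by simp) ?_
    have := jap_pos 1
    have := sqrt_two_add_pos 1
    unfold translationField
    positivity
  have p2 : 0 < ∫ ρ, dilationField ρ * g2 ρ := by
    refine pos hD 0 (by simp) ?_
    simp [dilationField, height, jap]
  have o1 : ∫ ρ, translationField ρ * g2 ρ = 0 := integral_eq_zero_of_odd fun ρ => by
    simp only [g2, translationField_odd, dilationField_even, χ.neg]
    ring
  have o2 : ∫ ρ, dilationField ρ * g1 ρ = 0 := by
    rw [← o1]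
    congr 1
    funext ρ
    simp only [g1, g2]
    ring
  set P := ∫ ρ, translationField ρ * g1 ρ
  set Q := ∫ ρ, dilationField ρ * g2 ρ
  set a := (∫ ρ, m ρ * g1 ρ) / P
  set b := (∫ ρ, m ρ * g2 ρ) / Q
  have ic {f g : ℝ → ℝ} (hf : Continuous f) (hg : ContDiff ℝ ∞ g) (hc : HasCompactSupport g) :
      Integrable fun ρ => f ρ * g ρ :=
    (hf.mul hg.continuous).integrable_of_hasCompactSupport hc.mul_left
  have im {g : ℝ → ℝ} (hg : ContDiff ℝ ∞ g) (hc : HasCompactSupport g) :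
      Integrable fun ρ => m ρ * g ρ := by
    have := hm.integrable_smul_right_of_hasCompactSupport hg.continuous hc
    simpa using this
  have hTD : Continuous fun ρ => a * translationField ρ + b * dilationField ρ :=
    (hT.continuous.const_mul a).add (hD.continuous.const_mul b)
  have hz := ae_eq_zero_of_integral_contDiff_smul_eq_zero
    (f := fun ρ => m ρ - (a * translationField ρ + b * dilationField ρ)) (μ := volume)
    (hm.sub hTD.locallyIntegrable) fun g hg hc => ?_
  · refine ⟨a, b, ?_⟩
    filter_upwards [hz] with ρ hρ
    simpa [sub_eq_zero] using hρ
  · set x := ∫ ρ, translationField ρ * g ρ with hx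
    set z := ∫ ρ, dilationField ρ * g ρ with hz
    have lin {f : ℝ → ℝ} (i0 : Integrable fun ρ => f ρ * g ρ) (i1 : Integrable fun ρ => f ρ * g1 ρ)
        (i2 : Integrable fun ρ => f ρ * g2 ρ) :
        ∫ ρ, f ρ * (g ρ - x / P * g1 ρ - z / Q * g2 ρ) =
          (∫ ρ, f ρ * g ρ) - x / P * (∫ ρ, f ρ * g1 ρ) - z / Q * (∫ ρ, f ρ * g2 ρ) := by
      rw [← integral_const_mul, ← integral_const_mul, ← integral_sub i0 (i1.const_mul _),
        ← integral_sub (by exact i0.sub (i1.const_mul _)) (i2.const_mul _)]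
      congr 1
      funext ρ
      ring
    have hk := key (g := fun ρ => g ρ - x / P * g1 ρ - z / Q * g2 ρ)
      ((hg.sub (contDiff_const.mul s1)).sub (contDiff_const.mul s2))
      ((hc.sub c1.mul_left).sub c2.mul_left) ?_ ?_
    · rw [lin (im hg hc) (im s1 c1) (im s2 c2)] at hk
      have e : ∫ ρ, g ρ • (m ρ - (a * translationField ρ + b * dilationField ρ)) =
          (∫ ρ, m ρ * g ρ) - a * x - b * z := by
        rw [hx, hz, ← integral_const_mul, ← integral_const_mul,
          ← integral_sub (im hg hc) ((ic hT.continuous hg hc).const_mul _),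
          ← integral_sub (by exact (im hg hc).sub ((ic hT.continuous hg hc).const_mul _))
            ((ic hD.continuous hg hc).const_mul _)]
        congr 1
        funext ρ
        simp only [smul_eq_mul]
        ring
      rw [e, ← hk]
      simp only [a, b]
      ring
    · rw [lin (ic hT.continuous hg hc) (ic hT.continuous s1 c1) (ic hT.continuous s2 c2), o1,
        div_mul_cancel₀ _ p1.ne']
      simp [x]
    · rw [lin (ic hD.continuous hg hc) (ic hD.continuous s1 c1) (ic hD.continuous s2 c2), o2,
        div_mul_cancel₀ _ p2.ne']
      simp [z]

end

/-! ### The Jacobi fields in the local energy norm -/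

theorem height_one_ge : 2 / 5 ≤ height 1 := by
  have hc : Continuous fun s => 1 / (jap s * Real.sqrt (jap s ^ 2 + 1)) := by
    have := continuous_jap
    refine Continuous.div (by fun_prop) (by fun_prop) fun s => ?_
    have := jap_pos s
    positivity
  have h : ∫ _ in (0 : ℝ)..1, (2 / 5 : ℝ) ≤ height 1 := by
    refine intervalIntegral.integral_mono_on zero_le_one (by simp)
      (hc.intervalIntegrable 0 1) fun s hs => ?_
    have hj := jap_pos s
    have hs2 : s ^ 2 ≤ 1 := by nlinarith [hs.1, hs.2]
    have hp : 0 < Real.sqrt (jap s ^ 2 + 1) := Real.sqrt_pos.2 (by positivity)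
    have hsq : (jap s * Real.sqrt (jap s ^ 2 + 1)) ^ 2 = (1 + s ^ 2) * (2 + s ^ 2) := by
      rw [mul_pow, Real.sq_sqrt (by positivity), jap_sq]
      ring
    have hle : jap s * Real.sqrt (jap s ^ 2 + 1) ≤ 5 / 2 := by
      refine (abs_le_of_sq_le_sq' ?_ (by norm_num)).2
      rw [hsq]
      nlinarith [sq_nonneg s]
    rw [le_div_iff₀ (by positivity)]
    linarith
  simpa using h

theorem translationField_sq (ρ : ℝ) : translationField ρ ^ 2 = 1 - 1 / (1 + ρ ^ 2) ^ 2 := by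
  rw [translationField, div_pow, mul_pow, Real.sq_sqrt (by positivity), jap_sq]
  field_simp
  ring

theorem le_translationField {ρ : ℝ} (h : 4 ≤ ρ) : 9 / 10 ≤ translationField ρ := by
  have hj := jap_pos ρ
  have ht := sqrt_two_add_pos ρ
  refine (abs_le_of_sq_le_sq' ?_ (by unfold translationField; positivity)).2
  have h17 : (17 : ℝ) ≤ 1 + ρ ^ 2 := by nlinarith
  have : 1 / (1 + ρ ^ 2) ^ 2 ≤ 1 / 17 ^ 2 := by gcongr
  rw [translationField_sq]
  norm_num at this ⊢
  linarith

theorem dilationField_le {ρ : ℝ} (h : 4 ≤ ρ) : dilationField ρ ≤ -(1 / 10) := by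
  have hmono : Monotone height := monotone_of_deriv_nonneg
    (fun r => (hasDerivAt_height r).differentiableAt) fun r => by
      rw [(hasDerivAt_height r).deriv]
      have := jap_pos r
      positivity
  have h1 := height_one_ge.trans (hmono (by linarith : (1 : ℝ) ≤ ρ))
  have h2 := le_translationField h
  have h3 : (jap ρ)⁻¹ ≤ 4⁻¹ := by
    refine inv_anti₀ (by norm_num) ?_
    have := jap_sq ρ
    nlinarith [jap_pos ρ]
  rw [dilationField]
  nlinarith

/-- At one of the two ends, no cancellation occurs between the two Jacobi fields: their product
is odd. -/
theorem exists_sign_le_sq (a b : ℝ) : ∃ σ : ℝ, |σ| = 1 ∧ ∀ ρ, 4 ≤ σ * ρ →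
    (a ^ 2 + b ^ 2) / 100 ≤ (a * translationField ρ + b * dilationField ρ) ^ 2 := by
  have key (a b : ℝ) (hab : a * b ≤ 0) (ρ : ℝ) (h : 4 ≤ ρ) :
      (a ^ 2 + b ^ 2) / 100 ≤ (a * translationField ρ + b * dilationField ρ) ^ 2 := by
    have h1 := le_translationField h
    have h2 := dilationField_le h
    have h3 : (1 : ℝ) / 100 ≤ translationField ρ ^ 2 := by nlinarith
    have h4 : (1 : ℝ) / 100 ≤ dilationField ρ ^ 2 := by nlinarith
    have h5 : 0 ≤ (a * b) * (translationField ρ * dilationField ρ) :=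
      mul_nonneg_of_nonpos_of_nonpos hab (by nlinarith)
    nlinarith [mul_le_mul_of_nonneg_left h3 (sq_nonneg a),
      mul_le_mul_of_nonneg_left h4 (sq_nonneg b)]
  rcases le_total (a * b) 0 with h | h
  · exact ⟨1, by simp, fun ρ hρ => key a b h ρ (by simpa using hρ)⟩
  · refine ⟨-1, by simp, fun ρ hρ => ?_⟩
    have := key (-a) b (by linarith) (-ρ) (by linarith)
    rw [translationField_odd, dilationField_even, neg_sq] at this
    simpa using this

theorem setLIntegral_vol {f : Param → ENNReal} (hf : AEMeasurable f prodMeas) {s : Set Param}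
    (hs : MeasurableSet s) :
    ∫⁻ p in s, f p ∂vol = ∫⁻ p in s, ENNReal.ofReal (density p.1) * f p ∂prodMeas := by
  rw [vol_eq, restrict_withDensity hs,
    lintegral_withDensity_eq_lintegral_mul₀ measurable_density_fst.aemeasurable hf.restrict]
  rfl

/-- A function whose spherical mean does not decay has positive distance, in the local energy norm,
from the test functions. The bound is on a dyadic region beyond the support of the test function,
at the end `σ ρ → ∞`. -/
theorem le_leNorm_of_mean {φ v : Param → ℝ} (hφ : AEStronglyMeasurable φ prodMeas)
    (hslice : ∀ᵐ ρ : ℝ, MemLp (fun y => φ (ρ, y)) 2 sph) (hv : SmoothSupp v)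
    {σ C : ℝ} (hσ : |σ| = 1)
    (hC : ∀ᵐ ρ : ℝ, 4 ≤ σ * ρ → C ≤ (∫ y, φ (ρ, y) ∂sph) ^ 2) :
    ENNReal.ofReal (C / (8 * sph.real Set.univ)) ≤
      leNorm (fun p => (jap p.1)⁻¹ * (v p - φ p)) ^ 2 := by
  set T := sph.real Set.univ
  have hT : 0 < T := sph_univ_pos
  obtain ⟨R, hR⟩ := hv.supp
  obtain ⟨j, hj⟩ := pow_unbounded_of_one_lt (max R 4) (one_lt_two (α := ℝ))
  have hjR := (le_max_left _ _).trans_lt hj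
  have hj4 := (le_max_right _ _).trans_lt hj
  let I : Set ℝ := (fun ρ => σ * ρ) ⁻¹' Set.Icc (2 ^ j) (3 / 2 * 2 ^ j)
  have hI : MeasurableSet I := (measurable_const_mul σ) measurableSet_Icc
  have hIv : volume I = ENNReal.ofReal (2 ^ j / 2) := by
    have hσ0 : σ ≠ 0 := fun h => by simp [h] at hσ
    rw [Real.volume_preimage_mul_left hσ0, abs_inv, hσ, Real.volume_Icc, inv_one,
      ENNReal.ofReal_one, one_mul]
    ring_nf
  have habs (ρ : ℝ) (h : ρ ∈ I) : |ρ| = σ * ρ := by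
    have : 0 < σ * ρ := lt_of_lt_of_le (by positivity) h.1
    rw [← abs_of_pos this, abs_mul, hσ, one_mul]
  have hjap (ρ : ℝ) (h : ρ ∈ I) : 2 ^ j ≤ jap ρ ∧ jap ρ < 2 ^ (j + 1) := by
    have e := habs ρ h
    have h1 : 2 ^ j ≤ |ρ| := e ▸ h.1
    have h2 : |ρ| ≤ 3 / 2 * 2 ^ j := e ▸ h.2
    have hq := jap_sq ρ
    have hp := jap_pos ρ
    rw [← sq_abs ρ] at hq
    refine ⟨by nlinarith [abs_nonneg ρ], ?_⟩
    rw [pow_succ]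
    nlinarith [abs_nonneg ρ]
  have hsub : I ×ˢ Set.univ ⊆ annulus j := fun p hp => hjap p.1 hp.1
  have hjm : Measurable fun p : Param => jap p.1 := (continuous_jap.comp continuous_fst).measurable
  have hvφ : AEMeasurable (fun p => v p - φ p) prodMeas :=
    hv.continuous.measurable.aemeasurable.sub hφ.aemeasurable
  have hF : AEMeasurable (fun p : Param =>
      ENNReal.ofReal ((jap p.1)⁻¹ * ((jap p.1)⁻¹ * (v p - φ p)) ^ 2)) prodMeas :=
    (hjm.inv.aemeasurable.mul ((hjm.inv.aemeasurable.mul hvφ).pow_const 2)).ennreal_ofReal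
  have hG := measurable_density_fst.aemeasurable.mul hF
  have hprod : prodMeas.restrict (I ×ˢ Set.univ) = (volume.restrict I).prod sph := by
    rw [← Measure.prod_restrict, Measure.restrict_univ]
  calc ENNReal.ofReal (C / (8 * T))
      = ENNReal.ofReal ((4 * 2 ^ j)⁻¹ * (T⁻¹ * C)) * volume I := by
        rw [hIv, ← ENNReal.ofReal_mul' (by positivity)]
        congr 1
        field_simp
        ring
    _ = ∫⁻ _ in I, ENNReal.ofReal ((4 * 2 ^ j)⁻¹ * (T⁻¹ * C)) := by
        rw [setLIntegral_const]
    _ ≤ ∫⁻ ρ in I, ∫⁻ y, ENNReal.ofReal (density ρ) *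
          ENNReal.ofReal ((jap ρ)⁻¹ * ((jap ρ)⁻¹ * (v (ρ, y) - φ (ρ, y))) ^ 2) ∂sph := by
        refine setLIntegral_mono_ae' hI ?_
        filter_upwards [hslice, hC] with ρ h1 h2 h
        have e := habs ρ h
        have hlow : 2 ^ j ≤ σ * ρ := h.1
        have h3 := sq_integral_le_sph h1
        have h4 := h2 (by linarith)
        have hp := jap_pos ρ
        have hd := le_density ρ
        have hd0 := density_pos ρ
        have hup := (hjap ρ h).2
        -- the weight `|g|^(1/2) ⟨ρ⟩⁻³` is comparable to `⟨ρ⟩⁻¹`; `I` has length `2 ^ j / 2`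
        have hk : (4 * 2 ^ j)⁻¹ ≤ density ρ * (jap ρ ^ 3)⁻¹ := by
          rw [← jap_sq] at hd
          calc (4 * 2 ^ j : ℝ)⁻¹ ≤ (2 * jap ρ)⁻¹ := by
                refine inv_anti₀ (by positivity) ?_
                rw [pow_succ] at hup
                linarith
            _ = jap ρ ^ 2 / 2 * (jap ρ ^ 3)⁻¹ := by field_simp
            _ ≤ _ := by gcongr
        have h5 : T⁻¹ * C ≤ ∫ y, φ (ρ, y) ^ 2 ∂sph := by
          rw [inv_mul_le_iff₀ hT]
          exact h4.trans h3
        have h6 : 0 ≤ ∫ y, φ (ρ, y) ^ 2 ∂sph := integral_nonneg fun y => sq_nonneg _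
        calc ENNReal.ofReal ((4 * 2 ^ j)⁻¹ * (T⁻¹ * C))
            ≤ ENNReal.ofReal (density ρ * (jap ρ ^ 3)⁻¹ * ∫ y, φ (ρ, y) ^ 2 ∂sph) := by
              refine ENNReal.ofReal_le_ofReal ?_
              refine (mul_le_mul_of_nonneg_left h5 (by positivity)).trans ?_
              exact mul_le_mul_of_nonneg_right hk h6
          _ = ∫⁻ y, ENNReal.ofReal (density ρ * (jap ρ ^ 3)⁻¹ * φ (ρ, y) ^ 2) ∂sph := by
              rw [← integral_const_mul, ofReal_integral_eq_lintegral_ofReal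
                (h1.integrable_sq.const_mul _) (.of_forall fun y => by positivity)]
          _ = _ := by
              refine lintegral_congr fun y => ?_
              rw [hR ρ y (by rw [e]; linarith), ← ENNReal.ofReal_mul hd0.le]
              congr 1
              field_simp
              ring
    _ = ∫⁻ p in I ×ˢ Set.univ, ENNReal.ofReal (density p.1) *
          ENNReal.ofReal ((jap p.1)⁻¹ * ((jap p.1)⁻¹ * (v p - φ p)) ^ 2) ∂prodMeas := by
        rw [hprod]
        refine (lintegral_prod (fun p : Param => ENNReal.ofReal (density p.1) *
          ENNReal.ofReal ((jap p.1)⁻¹ * ((jap p.1)⁻¹ * (v p - φ p)) ^ 2)) ?_).symm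
        rw [← hprod]
        exact hG.restrict
    _ ≤ ∫⁻ p in annulus j, ENNReal.ofReal (density p.1) *
          ENNReal.ofReal ((jap p.1)⁻¹ * ((jap p.1)⁻¹ * (v p - φ p)) ^ 2) ∂prodMeas :=
        lintegral_mono_set hsub
    _ = ∫⁻ p in annulus j,
          ENNReal.ofReal ((jap p.1)⁻¹ * ((jap p.1)⁻¹ * (v p - φ p)) ^ 2) ∂vol :=
        (setLIntegral_vol hF (measurableSet_annulus j)).symm
    _ ≤ _ := lintegral_annulus_le _ j

/-- The spherical mean of a zero solution in the local energy space vanishes: the two radial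
Jacobi fields do not decay, hence no combination of them is in the closure of the test
functions. -/
theorem Approximates.mean_eq_zero {φ : Param → ℝ} {u : ℕ → Param → ℝ} (h : Approximates u φ)
    (hsol : IsZeroSolution φ)
    (hlim : Tendsto (fun n => leNorm fun p => (jap p.1)⁻¹ * (u n p - φ p)) atTop (𝓝 0)) :
    ∀ᵐ ρ : ℝ, ∫ y, φ (ρ, y) ∂sph = 0 := by
  obtain ⟨a, b, hab⟩ := h.mean_eq hsol
  obtain ⟨σ, hσ, hlow⟩ := exists_sign_le_sq a b
  have hT := sph_univ_pos
  have hbound (n : ℕ) := le_leNorm_of_mean (C := (a ^ 2 + b ^ 2) / 100) h.meas h.memLp_slice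
    (h.smoothSupp n) hσ (hab.mono fun ρ hρ h4 => hρ ▸ hlow ρ h4)
  have hz : Tendsto (fun n => leNorm (fun p => (jap p.1)⁻¹ * (u n p - φ p)) ^ 2) atTop (𝓝 0) := by
    simpa [Function.comp_def] using ((ENNReal.continuous_pow 2).tendsto 0).comp hlim
  have h0 := ge_of_tendsto' hz hbound
  rw [nonpos_iff_eq_zero, ENNReal.ofReal_eq_zero, div_le_iff₀ (by positivity), zero_mul] at h0
  have ha : a = 0 := by nlinarith [sq_nonneg a, sq_nonneg b]
  have hb : b = 0 := by nlinarith [sq_nonneg a, sq_nonneg b]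
  filter_upwards [hab] with ρ hρ
  simpa [ha, hb] using hρ

end Catenoid

end

theorem lemma2p2 : ¬ ∃ φ : Catenoid.Param → ℝ, Catenoid.IsThresholdResonance φ := by
  rintro ⟨φ, hsol, ⟨hm, u, hu, h1, h2⟩, hnot⟩
  have h := Catenoid.approximates_of_leNorm hm hu h1 h2
  exact hnot (h.memLp_two hsol (h.mean_eq_zero hsol h1) hm)
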